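/- Model. Consider a random access machine with $w$-bit words: a program has a fixed finite number of scalar variables (one word each) and a fixed finite number of arrays, each allocated once with a length and a cell width of at most $w$ bits. Every arithmetic, comparison, shift or bitwise operation, operand fetch, array access, assignment, test and output costs one step, and an allocation costs in addition one step per cell. The space used is the number of bits of all scalar variables and arrays (length times cell width); the output is a write-only stream and is not counted. No value may overflow a word or the array cell in which it is stored. Algorithm. On input $x$, let $L$ be the bit length of $x$, $W$ the bit length of $L$, $r=\lfloor\sqrt x\rfloor$, $\Delta=\lfloor r/(LW)\rfloor+1$ and $M=\lfloor 8L/W\rfloor+1$. The algorithm computes these numbers, finds the odd primes up to $r$ by trial division, and stores them as the list of half-gaps between consecutive odd primes, in cells of $3W$ bits; for a gap larger than $L^3$ it stores a $0$, and stores the primes before and after the gap, in cells of $L$ bits, in an overflow list. It then runs a sieve of Eratosthenes over $1,\dots,x$ in consecutive segments of length $\Delta$ (the last one may be shorter). For each integer $n$ of the segment there is a cell of $L$ bits in which the odd primes $p\le r$ dividing $n$ are packed in increasing order, in binary and without their trailing $1$-bit, an array of $M$ cells of $W$ bits with the bit positions where these primes end, and a $W$-bit counter. In each segment, each odd prime $p\le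 r$ (recovered in order from the half-gaps and the overflow list) is added to the lists of its multiples. Then, for each $n$ of the segment, it divides $n$ by $2$ and by the primes in its list as often as possible, writing each prime at each division, and writes the remaining cofactor if it exceeds $1$, followed by the end mark $0$. Theorem. There is a constant $C>0$ such that for every integer $x\ge 3$ there is a word size $w\le C\log x$, with $x<2^w$, for which this algorithm on input $x$ halts, and: 1. its output is the complete factorization of every integer $1\le n\le x$ in order (the prime factors of $n$ in increasing order and with multiplicity, then a $0$); 2. it takes at most $C\,x\log\log x$ steps; 3. it uses at most $C\sqrt x/\log\log x$ bits of space; 4. its segment length satisfies $C^{-1}\sqrt x/((\log x)\log\log x)\le\Delta\le C\sqrt x/((\log x)\log\log x)$; 5. for each integer of a segment the packed list of primes has at most $C\log x$ bits, and the array of end pointers has at most $C\log x$ bits; 6. the half-gaps and the overflow list together take at most $C\sqrt x(\log\log x)/\log x$ bits. Moreover, for every integer $n\ge1$, the binary representations of the odd primes dividing $n$, without their trailing bits, have at most $C\log n$ bits in total, and the number of odd primes dividing $n$ times the bit length of the bit length of $n$ is at most $C\log n$. -/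

import Mathlib

namespace FactorSieve

/-!
A random access machine working on `w`-bit words, programmed in a structured language.

* A program has finitely many scalar variables, each of them one word, and finitely many arrays.
  An array is allocated once, with a length and a cell width (at most `w` bits); it occupies
  length times width bits of storage.
* Every arithmetic, comparison, shift and bitwise operation, every operand fetch, array access,
  assignment, test and output costs one step; an allocation also costs one step per cell.
* The output is a write-only stream, which is not charged as storage.
* A computation is stuck if a value does not fit into a word or into the array cell it is stored
  in, if an array index is out of range, if a subtraction would be negative, or if a divisor is 0.
-/

/-- The primitive operations on words. Comparisons return `1` or `0`. -/
inductive BinOp where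
  | add | sub | mul | div | mod | shl | shr | band | bor | lt | le | eq | ne

/-- The result of a primitive operation, `none` if it is undefined. -/
def BinOp.apply : BinOp → ℕ → ℕ → Option ℕ
  | .add, a, b => some (a + b)
  | .sub, a, b => if b ≤ a then some (a - b) else none
  | .mul, a, b => some (a * b)
  | .div, a, b => if b = 0 then none else some (a / b)
  | .mod, a, b => if b = 0 then none else some (a % b)
  | .shl, a, b => some (a <<< b)
  | .shr, a, b => some (a >>> b)
  | .band, a, b => some (a &&& b)
  | .bor, a, b => some (a ||| b)
  | .lt, a, b => some (if a < b then 1 else 0)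
  | .le, a, b => some (if a ≤ b then 1 else 0)
  | .eq, a, b => some (if a = b then 1 else 0)
  | .ne, a, b => some (if a = b then 0 else 1)

/-- Expressions over scalar variables `V` and arrays `A`; `get a e` is the cell `a[e]`. -/
inductive Expr (V A : Type) where
  | lit (n : ℕ)
  | var (v : V)
  | get (a : A) (e : Expr V A)
  | bin (o : BinOp) (e₁ e₂ : Expr V A)

/-- Statements. `alloc a l b` creates the array `a` with `l` cells of `b` bits each. -/
inductive Stmt (V A : Type) where
  | skip
  | assign (v : V) (e : Expr V A)
  | store (a : A) (i e : Expr V A)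
  | alloc (a : A) (l b : Expr V A)
  | emit (e : Expr V A)
  | seq (s₁ s₂ : Stmt V A)
  | ite (e : Expr V A) (s₁ s₂ : Stmt V A)
  | loop (e : Expr V A) (s : Stmt V A)

/-- An array: `len` cells of `width` bits; only `data i` with `i < len` can be accessed. -/
structure Block where
  len : ℕ
  width : ℕ
  data : ℕ → ℕ

/-- The state of a computation; `out` is what has been written so far. -/
structure State (V A : Type) where
  vars : V → ℕ
  arr : A → Block
  out : List ℕ

section Semantics

variable {V A : Type}

/-- The state with the scalar variable `v` set to `n`. -/
def State.setVar [DecidableEq V] (σ : State V A) (v : V) (n : ℕ) : State V A :=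
  ⟨Function.update σ.vars v n, σ.arr, σ.out⟩

/-- The state with the array `a` replaced by `B`. -/
def State.setArr [DecidableEq A] (σ : State V A) (a : A) (B : Block) : State V A :=
  ⟨σ.vars, Function.update σ.arr a B, σ.out⟩

/-- The storage in bits: one `w`-bit word for each scalar variable, and all the arrays.
Arrays are never freed, so the storage of the final state is the maximum over the computation. -/
def State.bits [Fintype V] [Fintype A] (w : ℕ) (σ : State V A) : ℕ :=
  Fintype.card V * w + ∑ a : A, (σ.arr a).len * (σ.arr a).width

/-- The value of an expression on a machine with `w`-bit words. -/
def Expr.eval (w : ℕ) (σ : State V A) : Expr V A → Option ℕ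
  | .lit n => if n < 2 ^ w then some n else none
  | .var v => some (σ.vars v)
  | .get a e => (e.eval w σ).bind fun i =>
      if i < (σ.arr a).len then some ((σ.arr a).data i) else none
  | .bin o e₁ e₂ => (e₁.eval w σ).bind fun m => (e₂.eval w σ).bind fun n =>
      (o.apply m n).bind fun k => if k < 2 ^ w then some k else none

/-- The number of steps for evaluating an expression. -/
def Expr.cost : Expr V A → ℕ
  | .lit _ => 1
  | .var _ => 1
  | .get _ e => e.cost + 1
  | .bin _ e₁ e₂ => e₁.cost + e₂.cost + 1

/-- `Exec w s σ σ' t`: on a machine with `w`-bit words, the statement `s` started in the state `σ`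
halts in the state `σ'` after exactly `t` steps. -/
inductive Exec [DecidableEq V] [DecidableEq A] (w : ℕ) :
    Stmt V A → State V A → State V A → ℕ → Prop
  | skip (σ : State V A) : Exec w .skip σ σ 0
  | assign (σ : State V A) (v : V) (e : Expr V A) (n : ℕ) (he : e.eval w σ = some n) :
      Exec w (.assign v e) σ (σ.setVar v n) (e.cost + 1)
  | store (σ : State V A) (a : A) (i e : Expr V A) (m n : ℕ)
      (hi : i.eval w σ = some m) (he : e.eval w σ = some n)
      (hm : m < (σ.arr a).len) (hn : n < 2 ^ (σ.arr a).width) :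
      Exec w (.store a i e) σ
        (σ.setArr a ⟨(σ.arr a).len, (σ.arr a).width, Function.update (σ.arr a).data m n⟩)
        (i.cost + e.cost + 1)
  | alloc (σ : State V A) (a : A) (l b : Expr V A) (m n : ℕ)
      (hl : l.eval w σ = some m) (hb : b.eval w σ = some n)
      (h0 : (σ.arr a).len = 0) (hn : n ≤ w) :
      Exec w (.alloc a l b) σ
        (σ.setArr a ⟨m, n, fun _ => 0⟩)
        (l.cost + b.cost + m + 1)
  | emit (σ : State V A) (e : Expr V A) (n : ℕ) (he : e.eval w σ = some n) :
      Exec w (.emit e) σ ⟨σ.vars, σ.arr, σ.out ++ [n]⟩ (e.cost + 1)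
  | seq (σ σ' σ'' : State V A) (s₁ s₂ : Stmt V A) (t₁ t₂ : ℕ)
      (h₁ : Exec w s₁ σ σ' t₁) (h₂ : Exec w s₂ σ' σ'' t₂) :
      Exec w (.seq s₁ s₂) σ σ'' (t₁ + t₂)
  | iteTrue (σ σ' : State V A) (e : Expr V A) (s₁ s₂ : Stmt V A) (n t : ℕ)
      (he : e.eval w σ = some n) (hn : n ≠ 0) (h : Exec w s₁ σ σ' t) :
      Exec w (.ite e s₁ s₂) σ σ' (e.cost + 1 + t)
  | iteFalse (σ σ' : State V A) (e : Expr V A) (s₁ s₂ : Stmt V A) (t : ℕ)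
      (he : e.eval w σ = some 0) (h : Exec w s₂ σ σ' t) :
      Exec w (.ite e s₁ s₂) σ σ' (e.cost + 1 + t)
  | loopTrue (σ σ' σ'' : State V A) (e : Expr V A) (s : Stmt V A) (n t₁ t₂ : ℕ)
      (he : e.eval w σ = some n) (hn : n ≠ 0)
      (h₁ : Exec w s σ σ' t₁) (h₂ : Exec w (.loop e s) σ' σ'' t₂) :
      Exec w (.loop e s) σ σ'' (e.cost + 1 + t₁ + t₂)
  | loopFalse (σ : State V A) (e : Expr V A) (s : Stmt V A) (he : e.eval w σ = some 0) :
      Exec w (.loop e s) σ σ (e.cost + 1)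

instance (n : ℕ) : OfNat (Expr V A) n := ⟨.lit n⟩
instance : Add (Expr V A) := ⟨.bin .add⟩
instance : Sub (Expr V A) := ⟨.bin .sub⟩
instance : Mul (Expr V A) := ⟨.bin .mul⟩
instance : Div (Expr V A) := ⟨.bin .div⟩
instance : Mod (Expr V A) := ⟨.bin .mod⟩
instance : ShiftLeft (Expr V A) := ⟨.bin .shl⟩
instance : ShiftRight (Expr V A) := ⟨.bin .shr⟩
instance : AndOp (Expr V A) := ⟨.bin .band⟩
instance : OrOp (Expr V A) := ⟨.bin .bor⟩

end Semantics

infix:50 " <ₑ " => Expr.bin BinOp.lt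
infix:50 " ≤ₑ " => Expr.bin BinOp.le
infix:50 " =ₑ " => Expr.bin BinOp.eq
infix:50 " ≠ₑ " => Expr.bin BinOp.ne
infix:40 " ::= " => Stmt.assign
infixr:35 " ;; " => Stmt.seq

/-- The scalar variables of the sieve; `x` is the input. -/
inductive Var where
  /-- input, its integer square root, the bit length of `x`, the bit length of that -/
  | x | r | L | W
  /-- segment length, number of pointers per integer, number of gaps, number of large gaps -/
  | Delta | M | ngap | nbig
  /-- counters and temporaries -/
  | t | c | d | p | j | k | b | q | x1 | x2 | i | n | y | pos | left | f
  deriving DecidableEq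

instance : Fintype Var where
  elems := {.x, .r, .L, .W, .Delta, .M, .ngap, .nbig, .t, .c, .d, .p, .j, .k, .b, .q, .x1, .x2,
    .i, .n, .y, .pos, .left, .f}
  complete v := by cases v <;> decide

/-- The arrays of the sieve.
* `gap`: the half-gaps between consecutive odd primes up to `√x`, with `0` for a large gap;
* `big`: for each large gap, the primes before and after it;
* `list`, `ptr`, `plen`: for each integer of the segment, its packed odd prime divisors, the bit
  positions where they end (`M` cells for each integer), and their number. -/
inductive Arr where
  | gap | big | list | ptr | plen
  deriving DecidableEq

instance : Fintype Arr where
  elems := {.gap, .big, .list, .ptr, .plen}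
  complete a := by cases a <;> decide

section Program

open Var Arr

/-- The value of a scalar variable. -/
abbrev rd (v : Var) : Expr Var Arr := .var v

/-- `s` if `e` is nonzero, nothing otherwise. -/
abbrev when (e : Expr Var Arr) (s : Stmt Var Arr) : Stmt Var Arr := .ite e s .skip

/-- Bit lengths of `x` and of the bit length, integer square root, segment length, and the
allocation of the lists of prime divisors. -/
def setup : Stmt Var Arr :=
  L ::= 0 ;;
  t ::= rd x ;;
  .loop (0 <ₑ rd t) (
    L ::= rd L + 1 ;;
    t ::= rd t / 2) ;;
  W ::= 0 ;;
  t ::= rd L ;;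
  .loop (0 <ₑ rd t) (
    W ::= rd W + 1 ;;
    t ::= rd t / 2) ;;
  r ::= 0 ;;
  .loop ((rd r + 1) * (rd r + 1) ≤ₑ rd x)
    (r ::= rd r + 1) ;;
  Delta ::= rd r / (rd L * rd W) + 1 ;;
  M ::= (8 * rd L) / rd W + 1 ;;
  .alloc list (rd Delta) (rd L) ;;
  .alloc plen (rd Delta) (rd W) ;;
  .alloc ptr (rd Delta * rd M) (rd W)

/-- Runs through the primes `5 ≤ c ≤ √x` in increasing order (found by trial division) and
executes `body` for each of them; `p` is the prime before `c`. -/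
def scanPrimes (body : Stmt Var Arr) : Stmt Var Arr :=
  p ::= 3 ;;
  c ::= 5 ;;
  .loop (rd c ≤ₑ rd r) (
    d ::= 3 ;;
    .loop ((rd d * rd d ≤ₑ rd c) &&& (rd c % rd d ≠ₑ 0))
      (d ::= rd d + 2) ;;
    when (rd c <ₑ rd d * rd d) (
      body ;;
      p ::= rd c) ;;
    c ::= rd c + 2)

/-- Counts the gaps, and those larger than `L³`. -/
def countGaps : Stmt Var Arr :=
  ngap ::= 0 ;;
  nbig ::= 0 ;;
  scanPrimes (
    ngap ::= rd ngap + 1 ;;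
    when (rd L * rd L * rd L <ₑ rd c - rd p)
      (nbig ::= rd nbig + 1))

/-- Stores the half-gaps in cells of `3 W` bits and the large gaps in the overflow list. -/
def storeGaps : Stmt Var Arr :=
  .alloc gap (rd ngap) (3 * rd W) ;;
  .alloc big (2 * rd nbig) (rd L) ;;
  j ::= 0 ;;
  k ::= 0 ;;
  scanPrimes (
    .ite (rd L * rd L * rd L <ₑ rd c - rd p) (
      .store gap (rd j) 0 ;;
      .store big (2 * rd k) (rd p) ;;
      .store big (2 * rd k + 1) (rd c) ;;
      k ::= rd k + 1)
      (.store gap (rd j) ((rd c - rd p) / 2)) ;;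
    j ::= rd j + 1)

/-- Replaces the odd prime `p` by the next one, read from the compressed list; `j` is the position
in the list of gaps, `k` that in the overflow list. After the last prime, `p` becomes `r + 1`. -/
def nextPrime : Stmt Var Arr :=
  .ite (rd j <ₑ rd ngap) (
    .ite (.get gap (rd j) =ₑ 0) (
      p ::= .get big (2 * rd k + 1) ;;
      k ::= rd k + 1)
      (p ::= rd p + 2 * .get gap (rd j)) ;;
    j ::= rd j + 1)
    (p ::= rd r + 1)

/-- Empties the lists of prime divisors. -/
def clearAll : Stmt Var Arr :=
  i ::= 0 ;;
  .loop (rd i <ₑ rd Delta) (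
    .store list (rd i) 0 ;;
    .store plen (rd i) 0 ;;
    i ::= rd i + 1)

/-- Sets `left` to the bit position where the prime number `pos` of list `i` begins. -/
def findLeft : Stmt Var Arr :=
  .ite (0 <ₑ rd pos)
    (left ::= .get ptr (rd i * rd M + rd pos - 1))
    (left ::= 0)

/-- Adds `p` to list `i`, without its trailing bit; `b` is the bit length of `p >> 1`. -/
def addPrime : Stmt Var Arr :=
  pos ::= .get plen (rd i) ;;
  .store plen (rd i) (rd pos + 1) ;;
  findLeft ;;
  .store list (rd i) (.get list (rd i) ||| ((rd p >>> 1) <<< rd left)) ;;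
  .store ptr (rd i * rd M + rd pos) (rd left + rd b)

/-- Sets `f` to the prime number `pos` of list `i`. -/
def getPrime : Stmt Var Arr :=
  findLeft ;;
  f ::= .get list (rd i) >>> rd left ;;
  f ::= rd f &&& ((1 <<< (.get ptr (rd i * rd M + rd pos) - rd left)) - 1) ;;
  f ::= (rd f <<< 1) ||| 1

/-- Adds each odd prime `p ≤ √x` to the lists of its multiples `q` with `x1 ≤ q < x2`. -/
def sieveSegment : Stmt Var Arr :=
  p ::= 3 ;;
  j ::= 0 ;;
  k ::= 0 ;;
  b ::= 1 ;;
  .loop (rd p ≤ₑ rd r) (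
    .loop (1 <<< rd b ≤ₑ rd p >>> 1)
      (b ::= rd b + 1) ;;
    q ::= rd x1 + (rd p - rd x1 % rd p) % rd p ;;
    .loop (rd q <ₑ rd x2) (
      i ::= rd q - rd x1 ;;
      addPrime ;;
      q ::= rd q + rd p) ;;
    nextPrime)

/-- Writes the prime factors of each `n` with `x1 ≤ n < x2`, with multiplicity, and a `0` after
those of each `n`. -/
def outputSegment : Stmt Var Arr :=
  n ::= rd x1 ;;
  .loop (rd n <ₑ rd x2) (
    i ::= rd n - rd x1 ;;
    y ::= rd n ;;
    .loop (rd y % 2 =ₑ 0) (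
      .emit 2 ;;
      y ::= rd y / 2) ;;
    pos ::= 0 ;;
    .loop (rd pos <ₑ .get plen (rd i)) (
      getPrime ;;
      .loop (rd y % rd f =ₑ 0) (
        .emit (rd f) ;;
        y ::= rd y / rd f) ;;
      pos ::= rd pos + 1) ;;
    when (1 <ₑ rd y) (.emit (rd y)) ;;
    .emit 0 ;;
    n ::= rd n + 1)

/-- The segmented sieve of Eratosthenes with packed prime divisors and compressed primes. -/
def factorSieve : Stmt Var Arr :=
  setup ;;
  countGaps ;;
  storeGaps ;;
  x1 ::= 1 ;;
  .loop (rd x1 ≤ₑ rd x) (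
    x2 ::= rd x1 + rd Delta ;;
    when (rd x + 1 <ₑ rd x2) (x2 ::= rd x + 1) ;;
    clearAll ;;
    sieveSegment ;;
    outputSegment ;;
    x1 ::= rd x2)

end Program

/-- The initial state on input `x`: no array is allocated and nothing has been written. -/
def input (x : ℕ) : State Var Arr where
  vars := fun v => if v = .x then x else 0
  arr := fun _ => { len := 0, width := 0, data := fun _ => 0 }
  out := []

/-- The complete factorizations of `1, 2, …, x` in this order: the prime factors of each integer in
increasing order and with multiplicity, followed by a `0`. -/
def factorizations (x : ℕ) : List ℕ :=
  (List.range' 1 x).flatMap fun n => n.primeFactorsList ++ [0]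

end FactorSieve

/-! Correctness. Once every odd prime up to `√x` has been sieved, the packed list of `n ≤ x`
consists of the odd primes `≤ √x` dividing `n`, in increasing order. After division by 2 and by
these primes the cofactor has no prime factor `≤ √x`, so it is 1 or a prime above `√x`
(`prime_of_no_small_factor`). What was written is then a sorted list of primes with product `n`, and
unique factorization identifies it.

Room in the cells. Without its trailing bit an odd prime `p` takes `k` bits with `2 ^ k ≤ p`;
multiplying over the distinct primes dividing `n` bounds the total by the binary logarithm of `n`
(`two_pow_sum_size_le`). The number of entries is `O(L / W)`: few odd numbers lie below about `√L`,
and every larger prime uses up about `W / 2` bits of `n` (`card_mul_size_le`).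

Storage of the primes. By Chebyshev there are `O(√x / log x)` gaps, each taking `3 W` bits. Gaps
longer than `L ^ 3` are disjoint intervals below `√x`, so at most `√x / L ^ 3` of them exist
(`bigCount_mul_le_sqrt`) and the overflow list is negligible. No theorem on prime gaps is needed.

Time. Each of the `O(√x L W)` segments visits all `O(√x / log x)` primes, which makes `O(x log log
x)` visits. The remaining work is charged to prime factors, with total `∑ Ω(n) = Ω(x!)`. Legendre's
formula gives `v_p(x!) ≤ 2 x / p`, and the sum of `1 / p` is compared with a harmonic number of
index about `log x` by cutting into dyadic blocks and using `primorial n ≤ 4 ^ n`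
(`sum_inv_primes_le`).

The program is treated by a Hoare-style logic in which each loop has an invariant and a potential
(`Runs.loop`). The potential pays for every pass, so it proves termination and the step count
together. -/

namespace FactorSieve

/-! ### Program logic: total values, frames, and rules with step counts. -/

section Logic

set_option linter.unusedSectionVars false

variable {V A : Type}

open Classical in
/-- The number `1` or `0` that represents the truth of `p`. -/
noncomputable def truth (p : Prop) : ℕ := if p then 1 else 0

@[simp] theorem truth_eq_zero {p : Prop} : truth p = 0 ↔ ¬p := by
  unfold truth; split_ifs with h <;> simp [h]

theorem truth_le_one (p : Prop) : truth p ≤ 1 := by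
  unfold truth; split_ifs <;> omega

@[simp] theorem truth_and_truth (p q : Prop) : truth p &&& truth q = truth (p ∧ q) := by
  unfold truth; split_ifs <;> simp_all

/-- The result of a primitive operation, with an arbitrary value where it is undefined. -/
noncomputable def BinOp.val : BinOp → ℕ → ℕ → ℕ
  | .add, a, b => a + b
  | .sub, a, b => a - b
  | .mul, a, b => a * b
  | .div, a, b => a / b
  | .mod, a, b => a % b
  | .shl, a, b => a <<< b
  | .shr, a, b => a >>> b
  | .band, a, b => a &&& b
  | .bor, a, b => a ||| b
  | .lt, a, b => truth (a < b)
  | .le, a, b => truth (a ≤ b)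
  | .eq, a, b => truth (a = b)
  | .ne, a, b => truth (a ≠ b)

/-- The number of values of a `w`-bit word. -/
def cap (w : ℕ) : ℕ := 2 ^ w

/-- A condition under which a primitive operation is defined and yields a `w`-bit word. -/
def BinOp.Ok (w : ℕ) : BinOp → ℕ → ℕ → Prop
  | .add, a, b => a + b < cap w
  | .sub, a, b => b ≤ a ∧ a - b < cap w
  | .mul, a, b => a * b < cap w
  | .div, a, b => b ≠ 0 ∧ a / b < cap w
  | .mod, a, b => b ≠ 0 ∧ a % b < cap w
  | .shl, a, b => a <<< b < cap w
  | .shr, a, b => a >>> b < cap w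
  | .band, a, b => a &&& b < cap w
  | .bor, a, b => a ||| b < cap w
  | .lt, _, _ => 1 < cap w
  | .le, _, _ => 1 < cap w
  | .eq, _, _ => 1 < cap w
  | .ne, _, _ => 1 < cap w

/-- The value of an expression, ignoring overflow and undefined operations. -/
noncomputable def Expr.val (σ : State V A) : Expr V A → ℕ
  | .lit n => n
  | .var v => σ.vars v
  | .get a e => (σ.arr a).data (e.val σ)
  | .bin o e₁ e₂ => o.val (e₁.val σ) (e₂.val σ)

/-- The evaluation of an expression meets no overflow and no undefined operation. -/
def Expr.Ok (w : ℕ) (σ : State V A) : Expr V A → Prop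
  | .lit n => n < cap w
  | .var _ => True
  | .get a e => e.Ok w σ ∧ e.val σ < (σ.arr a).len
  | .bin o e₁ e₂ => e₁.Ok w σ ∧ e₂.Ok w σ ∧ o.Ok w (e₁.val σ) (e₂.val σ)

theorem BinOp.Ok.apply_eq {w : ℕ} {o : BinOp} {a b : ℕ} (h : o.Ok w a b) :
    o.apply a b = some (o.val a b) ∧ o.val a b < cap w := by
  cases o <;> simp only [BinOp.Ok] at h <;> simp only [BinOp.apply, BinOp.val, true_and]
  case sub => exact ⟨if_pos h.1, h.2⟩
  case div => exact ⟨if_neg h.1, h.2⟩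
  case mod => exact ⟨if_neg h.1, h.2⟩
  case lt | le | eq | ne =>
    exact ⟨by unfold truth; split_ifs <;> simp_all, lt_of_le_of_lt (truth_le_one _) h⟩
  all_goals exact h

/-- This separates the partial evaluation into a total value and a purely arithmetic side condition,
so both can be unfolded by `simp` and settled by `omega`. -/
theorem Expr.Ok.eval_eq {w : ℕ} {σ : State V A} {e : Expr V A} (h : e.Ok w σ) :
    e.eval w σ = some (e.val σ) := by
  induction e with
  | lit n => simp only [Expr.Ok] at h; simp only [cap] at h; simpa [Expr.eval, Expr.val] using h
  | var v => rfl
  | get a e ih => simp only [Expr.Ok] at h; simp [Expr.eval, Expr.val, ih h.1, h.2]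
  | bin o e₁ e₂ ih₁ ih₂ =>
    simp only [Expr.Ok] at h
    obtain ⟨h1, h2, h3⟩ := h
    simp [Expr.eval, Expr.val, ih₁ h1, ih₂ h2, h3.apply_eq.1, show o.val _ _ < 2 ^ w from h3.apply_eq.2]

section Values

variable (w : ℕ) (σ : State V A) (e₁ e₂ : Expr V A) (n : ℕ)

@[simp] theorem val_lit : (no_index (OfNat.ofNat n) : Expr V A).val σ = OfNat.ofNat n := rfl
@[simp] theorem val_var (v : V) : (Expr.var v : Expr V A).val σ = σ.vars v := rfl
@[simp] theorem val_get (a : A) : (Expr.get a e₁).val σ = (σ.arr a).data (e₁.val σ) := rfl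
@[simp] theorem val_add : (e₁ + e₂).val σ = e₁.val σ + e₂.val σ := rfl
@[simp] theorem val_sub : (e₁ - e₂).val σ = e₁.val σ - e₂.val σ := rfl
@[simp] theorem val_mul : (e₁ * e₂).val σ = e₁.val σ * e₂.val σ := rfl
@[simp] theorem val_div : (e₁ / e₂).val σ = e₁.val σ / e₂.val σ := rfl
@[simp] theorem val_mod : (e₁ % e₂).val σ = e₁.val σ % e₂.val σ := rfl
@[simp] theorem val_shl : (e₁ <<< e₂).val σ = e₁.val σ <<< e₂.val σ := rfl
@[simp] theorem val_shr : (e₁ >>> e₂).val σ = e₁.val σ >>> e₂.val σ := rfl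
@[simp] theorem val_and : (e₁ &&& e₂).val σ = e₁.val σ &&& e₂.val σ := rfl
@[simp] theorem val_or : (e₁ ||| e₂).val σ = e₁.val σ ||| e₂.val σ := rfl
@[simp] theorem val_lt : (e₁ <ₑ e₂).val σ = truth (e₁.val σ < e₂.val σ) := rfl
@[simp] theorem val_le : (e₁ ≤ₑ e₂).val σ = truth (e₁.val σ ≤ e₂.val σ) := rfl
@[simp] theorem val_eq : (e₁ =ₑ e₂).val σ = truth (e₁.val σ = e₂.val σ) := rfl
@[simp] theorem val_ne : (e₁ ≠ₑ e₂).val σ = truth (e₁.val σ ≠ e₂.val σ) := rfl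

@[simp] theorem ok_lit : (no_index (OfNat.ofNat n) : Expr V A).Ok w σ ↔ OfNat.ofNat n < cap w := Iff.rfl
@[simp] theorem ok_var (v : V) : (Expr.var v : Expr V A).Ok w σ := trivial
@[simp] theorem ok_get (a : A) :
    (Expr.get a e₁).Ok w σ ↔ e₁.Ok w σ ∧ e₁.val σ < (σ.arr a).len := Iff.rfl
@[simp] theorem ok_add : (e₁ + e₂).Ok w σ ↔
    e₁.Ok w σ ∧ e₂.Ok w σ ∧ e₁.val σ + e₂.val σ < cap w := Iff.rfl
@[simp] theorem ok_sub : (e₁ - e₂).Ok w σ ↔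
    e₁.Ok w σ ∧ e₂.Ok w σ ∧ e₂.val σ ≤ e₁.val σ ∧ e₁.val σ - e₂.val σ < cap w := Iff.rfl
@[simp] theorem ok_mul : (e₁ * e₂).Ok w σ ↔
    e₁.Ok w σ ∧ e₂.Ok w σ ∧ e₁.val σ * e₂.val σ < cap w := Iff.rfl
@[simp] theorem ok_div : (e₁ / e₂).Ok w σ ↔
    e₁.Ok w σ ∧ e₂.Ok w σ ∧ e₂.val σ ≠ 0 ∧ e₁.val σ / e₂.val σ < cap w := Iff.rfl
@[simp] theorem ok_mod : (e₁ % e₂).Ok w σ ↔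
    e₁.Ok w σ ∧ e₂.Ok w σ ∧ e₂.val σ ≠ 0 ∧ e₁.val σ % e₂.val σ < cap w := Iff.rfl
@[simp] theorem ok_shl : (e₁ <<< e₂).Ok w σ ↔
    e₁.Ok w σ ∧ e₂.Ok w σ ∧ e₁.val σ <<< e₂.val σ < cap w := Iff.rfl
@[simp] theorem ok_shr : (e₁ >>> e₂).Ok w σ ↔
    e₁.Ok w σ ∧ e₂.Ok w σ ∧ e₁.val σ >>> e₂.val σ < cap w := Iff.rfl
@[simp] theorem ok_and : (e₁ &&& e₂).Ok w σ ↔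
    e₁.Ok w σ ∧ e₂.Ok w σ ∧ e₁.val σ &&& e₂.val σ < cap w := Iff.rfl
@[simp] theorem ok_or : (e₁ ||| e₂).Ok w σ ↔
    e₁.Ok w σ ∧ e₂.Ok w σ ∧ e₁.val σ ||| e₂.val σ < cap w := Iff.rfl
@[simp] theorem ok_lt : (e₁ <ₑ e₂).Ok w σ ↔ e₁.Ok w σ ∧ e₂.Ok w σ ∧ 1 < cap w := Iff.rfl
@[simp] theorem ok_le : (e₁ ≤ₑ e₂).Ok w σ ↔ e₁.Ok w σ ∧ e₂.Ok w σ ∧ 1 < cap w := Iff.rfl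
@[simp] theorem ok_eq : (e₁ =ₑ e₂).Ok w σ ↔ e₁.Ok w σ ∧ e₂.Ok w σ ∧ 1 < cap w := Iff.rfl
@[simp] theorem ok_ne : (e₁ ≠ₑ e₂).Ok w σ ↔ e₁.Ok w σ ∧ e₂.Ok w σ ∧ 1 < cap w := Iff.rfl

@[simp] theorem cost_lit : (no_index (OfNat.ofNat n) : Expr V A).cost = 1 := rfl
@[simp] theorem cost_var (v : V) : (Expr.var v : Expr V A).cost = 1 := rfl
@[simp] theorem cost_get (a : A) : (Expr.get a e₁).cost = e₁.cost + 1 := rfl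
@[simp] theorem cost_add : (e₁ + e₂).cost = e₁.cost + e₂.cost + 1 := rfl
@[simp] theorem cost_sub : (e₁ - e₂).cost = e₁.cost + e₂.cost + 1 := rfl
@[simp] theorem cost_mul : (e₁ * e₂).cost = e₁.cost + e₂.cost + 1 := rfl
@[simp] theorem cost_div : (e₁ / e₂).cost = e₁.cost + e₂.cost + 1 := rfl
@[simp] theorem cost_mod : (e₁ % e₂).cost = e₁.cost + e₂.cost + 1 := rfl
@[simp] theorem cost_shl : (e₁ <<< e₂).cost = e₁.cost + e₂.cost + 1 := rfl
@[simp] theorem cost_shr : (e₁ >>> e₂).cost = e₁.cost + e₂.cost + 1 := rfl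
@[simp] theorem cost_and : (e₁ &&& e₂).cost = e₁.cost + e₂.cost + 1 := rfl
@[simp] theorem cost_or : (e₁ ||| e₂).cost = e₁.cost + e₂.cost + 1 := rfl
@[simp] theorem cost_bin (o : BinOp) : (Expr.bin o e₁ e₂).cost = e₁.cost + e₂.cost + 1 := rfl

end Values

variable [DecidableEq V] [DecidableEq A]

/-- The state after writing `n` into the cell `a[m]`. -/
def State.put (σ : State V A) (a : A) (m n : ℕ) : State V A :=
  σ.setArr a ⟨(σ.arr a).len, (σ.arr a).width, Function.update (σ.arr a).data m n⟩

@[simp] theorem setVar_vars (σ : State V A) (v u : V) (n : ℕ) :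
    (σ.setVar v n).vars u = if u = v then n else σ.vars u := by
  simp [State.setVar, Function.update_apply]

@[simp] theorem setVar_arr (σ : State V A) (v : V) (n : ℕ) : (σ.setVar v n).arr = σ.arr := rfl

@[simp] theorem setVar_out (σ : State V A) (v : V) (n : ℕ) : (σ.setVar v n).out = σ.out := rfl

@[simp] theorem setArr_vars (σ : State V A) (a : A) (B : Block) :
    (σ.setArr a B).vars = σ.vars := rfl

@[simp] theorem setArr_out (σ : State V A) (a : A) (B : Block) : (σ.setArr a B).out = σ.out := rfl

@[simp] theorem setArr_arr (σ : State V A) (a b : A) (B : Block) :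
    (σ.setArr a B).arr b = if b = a then B else σ.arr b := by
  simp [State.setArr, Function.update_apply]

@[simp] theorem put_vars (σ : State V A) (a : A) (m n : ℕ) : (σ.put a m n).vars = σ.vars := rfl

@[simp] theorem put_out (σ : State V A) (a : A) (m n : ℕ) : (σ.put a m n).out = σ.out := rfl

@[simp] theorem put_len (σ : State V A) (a b : A) (m n : ℕ) :
    ((σ.put a m n).arr b).len = (σ.arr b).len := by
  unfold State.put; rw [setArr_arr]; split_ifs with h <;> simp [h]

@[simp] theorem put_width (σ : State V A) (a b : A) (m n : ℕ) :
    ((σ.put a m n).arr b).width = (σ.arr b).width := by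
  unfold State.put; rw [setArr_arr]; split_ifs with h <;> simp [h]

@[simp] theorem put_data (σ : State V A) (a b : A) (m n i : ℕ) :
    ((σ.put a m n).arr b).data i = if b = a ∧ i = m then n else (σ.arr b).data i := by
  unfold State.put; rw [setArr_arr]
  by_cases h : b = a
  · subst h; simp [Function.update_apply]
  · simp [h]

/-- The variables a statement may assign. -/
def Stmt.writes (v : V) : Stmt V A → Bool
  | .assign u _ => decide (u = v)
  | .seq s₁ s₂ => s₁.writes v || s₂.writes v
  | .ite _ s₁ s₂ => s₁.writes v || s₂.writes v
  | .loop _ s => s.writes v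
  | _ => false

/-- The arrays a statement may change. -/
def Stmt.touches (a : A) : Stmt V A → Bool
  | .store b _ _ => decide (b = a)
  | .alloc b _ _ => decide (b = a)
  | .seq s₁ s₂ => s₁.touches a || s₂.touches a
  | .ite _ s₁ s₂ => s₁.touches a || s₂.touches a
  | .loop _ s => s.touches a
  | _ => false

/-- The arrays a statement may allocate. -/
def Stmt.allocs (a : A) : Stmt V A → Bool
  | .alloc b _ _ => decide (b = a)
  | .seq s₁ s₂ => s₁.allocs a || s₂.allocs a
  | .ite _ s₁ s₂ => s₁.allocs a || s₂.allocs a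
  | .loop _ s => s.allocs a
  | _ => false

/-- Whether a statement may write output. -/
def Stmt.emits : Stmt V A → Bool
  | .emit _ => true
  | .seq s₁ s₂ => s₁.emits || s₂.emits
  | .ite _ s₁ s₂ => s₁.emits || s₂.emits
  | .loop _ s => s.emits
  | _ => false

/-- `σ'` differs from `σ` only in what the statement `s` may change. -/
structure Frame (s : Stmt V A) (σ σ' : State V A) : Prop where
  vars : ∀ v, s.writes v = false → σ'.vars v = σ.vars v
  arr : ∀ a, s.touches a = false → σ'.arr a = σ.arr a
  len : ∀ a, s.allocs a = false → (σ'.arr a).len = (σ.arr a).len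
  width : ∀ a, s.allocs a = false → (σ'.arr a).width = (σ.arr a).width
  out : s.emits = false → σ'.out = σ.out

theorem Frame.refl (s : Stmt V A) (σ : State V A) : Frame s σ σ :=
  ⟨fun _ _ => rfl, fun _ _ => rfl, fun _ _ => rfl, fun _ _ => rfl, fun _ => rfl⟩

theorem Frame.trans {s : Stmt V A} {σ σ' σ'' : State V A} (h : Frame s σ σ')
    (h' : Frame s σ' σ'') : Frame s σ σ'' :=
  ⟨fun v hv => (h'.vars v hv).trans (h.vars v hv), fun v hv => (h'.arr v hv).trans (h.arr v hv),
    fun v hv => (h'.len v hv).trans (h.len v hv), fun v hv => (h'.width v hv).trans (h.width v hv),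
    fun hv => (h'.out hv).trans (h.out hv)⟩

/-- What a program does not mention it does not change, and this is decidable from its text.
Invariants therefore only list what varies; the rest is recovered by `rfl` side conditions. -/
theorem Exec.frame {w : ℕ} {s : Stmt V A} {σ σ' : State V A} {t : ℕ} (h : Exec w s σ σ' t) :
    Frame s σ σ' := by
  induction h with
  | skip => exact .refl _ _
  | assign σ v e n he =>
    refine ⟨fun u hu => ?_, fun _ _ => rfl, fun _ _ => rfl, fun _ _ => rfl, fun _ => rfl⟩
    simp only [Stmt.writes, decide_eq_false_iff_not] at hu
    simp [Ne.symm hu]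
  | store σ a i e m n hi he hm hn =>
    refine ⟨fun _ _ => rfl, fun u hu => ?_, fun u hu => ?_, fun u hu => ?_, fun _ => rfl⟩
    · simp only [Stmt.touches, decide_eq_false_iff_not] at hu
      simp [Ne.symm hu]
    · exact put_len σ a u m n
    · exact put_width σ a u m n
  | alloc σ a l b m n hl hb h0 hn =>
    refine ⟨fun _ _ => rfl, fun u hu => ?_, fun u hu => ?_, fun u hu => ?_, fun _ => rfl⟩ <;>
    · simp only [Stmt.touches, Stmt.allocs, decide_eq_false_iff_not] at hu
      simp [Ne.symm hu]
  | emit σ e n he =>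
    exact ⟨fun _ _ => rfl, fun _ _ => rfl, fun _ _ => rfl, fun _ _ => rfl, fun h => by cases h⟩
  | seq σ σ' σ'' s₁ s₂ t₁ t₂ h₁ h₂ ih₁ ih₂ =>
    constructor
    · intro v hv
      simp only [Stmt.writes, Bool.or_eq_false_iff] at hv
      exact (ih₂.vars v hv.2).trans (ih₁.vars v hv.1)
    · intro v hv
      simp only [Stmt.touches, Bool.or_eq_false_iff] at hv
      exact (ih₂.arr v hv.2).trans (ih₁.arr v hv.1)
    · intro v hv
      simp only [Stmt.allocs, Bool.or_eq_false_iff] at hv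
      exact (ih₂.len v hv.2).trans (ih₁.len v hv.1)
    · intro v hv
      simp only [Stmt.allocs, Bool.or_eq_false_iff] at hv
      exact (ih₂.width v hv.2).trans (ih₁.width v hv.1)
    · intro hv
      simp only [Stmt.emits, Bool.or_eq_false_iff] at hv
      exact (ih₂.out hv.2).trans (ih₁.out hv.1)
  | iteTrue σ σ' e s₁ s₂ n t he hn h ih =>
    constructor <;> intros <;>
      simp only [Stmt.writes, Stmt.touches, Stmt.allocs, Stmt.emits, Bool.or_eq_false_iff] at *
    exacts [ih.vars _ ‹_ ∧ _›.1, ih.arr _ ‹_ ∧ _›.1, ih.len _ ‹_ ∧ _›.1, ih.width _ ‹_ ∧ _›.1,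
      ih.out ‹_ ∧ _›.1]
  | iteFalse σ σ' e s₁ s₂ t he h ih =>
    constructor <;> intros <;>
      simp only [Stmt.writes, Stmt.touches, Stmt.allocs, Stmt.emits, Bool.or_eq_false_iff] at *
    exacts [ih.vars _ ‹_ ∧ _›.2, ih.arr _ ‹_ ∧ _›.2, ih.len _ ‹_ ∧ _›.2, ih.width _ ‹_ ∧ _›.2,
      ih.out ‹_ ∧ _›.2]
  | loopTrue σ σ' σ'' e s n t₁ t₂ he hn h₁ h₂ ih₁ ih₂ =>
    exact .trans ⟨ih₁.vars, ih₁.arr, ih₁.len, ih₁.width, ih₁.out⟩ ih₂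
  | loopFalse => exact .refl _ _

/-- The statement `s` started in `σ` halts in a state and after a number of steps satisfying `Q`. -/
def Runs (w : ℕ) (s : Stmt V A) (σ : State V A) (Q : State V A → ℕ → Prop) : Prop :=
  ∃ σ' t, Exec w s σ σ' t ∧ Q σ' t

section Rules

variable {w : ℕ} {s s₁ s₂ : Stmt V A} {σ : State V A} {Q Q' : State V A → ℕ → Prop}
  {e e₁ e₂ : Expr V A} {v : V} {a : A}

/-- The frame is handed over together with the postcondition, so specifications of subprograms need
not mention untouched variables. -/
theorem Runs.mono (h : Runs w s σ Q) (hQ : ∀ σ' t, Frame s σ σ' → Q σ' t → Q' σ' t) :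
    Runs w s σ Q' :=
  let ⟨σ', t, he, hq⟩ := h
  ⟨σ', t, he, hQ σ' t he.frame hq⟩

theorem Runs.skip (h : Q σ 0) : Runs w .skip σ Q := ⟨_, _, .skip σ, h⟩

theorem Runs.assign (n : ℕ) (he : e.Ok w σ) (hn : e.val σ = n)
    (h : Q (σ.setVar v n) (e.cost + 1)) : Runs w (v ::= e) σ Q :=
  ⟨_, _, .assign σ v e n (hn ▸ he.eval_eq), h⟩

theorem Runs.store (m n : ℕ) (h₁ : e₁.Ok w σ) (hm : e₁.val σ = m) (h₂ : e₂.Ok w σ)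
    (hn : e₂.val σ = n) (hl : m < (σ.arr a).len) (hw : n < 2 ^ (σ.arr a).width)
    (h : Q (σ.put a m n) (e₁.cost + e₂.cost + 1)) : Runs w (.store a e₁ e₂) σ Q :=
  ⟨_, _, .store σ a e₁ e₂ m n (hm ▸ h₁.eval_eq) (hn ▸ h₂.eval_eq) hl hw, h⟩

theorem Runs.alloc (m n : ℕ) (h₁ : e₁.Ok w σ) (hm : e₁.val σ = m) (h₂ : e₂.Ok w σ)
    (hn : e₂.val σ = n) (h0 : (σ.arr a).len = 0) (hw : n ≤ w)
    (h : Q (σ.setArr a ⟨m, n, fun _ => 0⟩) (e₁.cost + e₂.cost + m + 1)) :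
    Runs w (.alloc a e₁ e₂) σ Q :=
  ⟨_, _, .alloc σ a e₁ e₂ m n (hm ▸ h₁.eval_eq) (hn ▸ h₂.eval_eq) h0 hw, h⟩

theorem Runs.emit (n : ℕ) (he : e.Ok w σ) (hn : e.val σ = n)
    (h : Q ⟨σ.vars, σ.arr, σ.out ++ [n]⟩ (e.cost + 1)) : Runs w (.emit e) σ Q :=
  ⟨_, _, .emit σ e n (hn ▸ he.eval_eq), h⟩

theorem Runs.seq
    (h : Runs w s₁ σ fun σ' t₁ => Runs w s₂ σ' fun σ'' t₂ => Q σ'' (t₁ + t₂)) :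
    Runs w (s₁ ;; s₂) σ Q :=
  let ⟨σ', t₁, h₁, σ'', t₂, h₂, hq⟩ := h
  ⟨σ'', t₁ + t₂, .seq σ σ' σ'' s₁ s₂ t₁ t₂ h₁ h₂, hq⟩

theorem Runs.ite (he : e.Ok w σ)
    (h₁ : e.val σ ≠ 0 → Runs w s₁ σ fun σ' t => Q σ' (e.cost + 1 + t))
    (h₂ : e.val σ = 0 → Runs w s₂ σ fun σ' t => Q σ' (e.cost + 1 + t)) :
    Runs w (.ite e s₁ s₂) σ Q := by
  by_cases h0 : e.val σ = 0
  · obtain ⟨σ', t, h, hq⟩ := h₂ h0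
    exact ⟨_, _, .iteFalse σ σ' e s₁ s₂ t (h0 ▸ he.eval_eq) h, hq⟩
  · obtain ⟨σ', t, h, hq⟩ := h₁ h0
    exact ⟨_, _, .iteTrue σ σ' e s₁ s₂ _ t he.eval_eq h0 h, hq⟩

/-- Loops, with an invariant `I` and a potential `Φ` that pays for the steps. -/
theorem Runs.loop (I : State V A → Prop) (Φ : State V A → ℕ) (h0 : I σ)
    (hok : ∀ σ', Frame s σ σ' → I σ' → e.Ok w σ')
    (hstep : ∀ σ', Frame s σ σ' → I σ' → e.val σ' ≠ 0 →
      Runs w s σ' fun σ'' t => I σ'' ∧ t + e.cost + 1 + Φ σ'' ≤ Φ σ')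
    (hend : ∀ σ' t, Frame s σ σ' → I σ' → e.val σ' = 0 → t + Φ σ' ≤ Φ σ + e.cost + 1 → Q σ' t) :
    Runs w (.loop e s) σ Q := by
  -- Each pass lowers the potential by at least `e.cost + 1 > 0`, so strong induction on its value
  -- applies and no separate termination measure is needed.
  suffices H : ∀ N σ', Φ σ' = N → Frame s σ σ' → I σ' →
      Runs w (.loop e s) σ' fun σ'' t =>
        I σ'' ∧ e.val σ'' = 0 ∧ Frame s σ σ'' ∧ t + Φ σ'' ≤ Φ σ' + e.cost + 1 from
    (H _ σ rfl (.refl _ _) h0).mono fun σ' t _ h => hend σ' t h.2.2.1 h.1 h.2.1 h.2.2.2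
  intro N
  induction N using Nat.strong_induction_on with
  | _ N ih =>
    intro σ' hN hf hI
    have hk := hok σ' hf hI
    by_cases hz : e.val σ' = 0
    · exact ⟨σ', _, .loopFalse σ' e s (hz ▸ hk.eval_eq), hI, hz, hf, by omega⟩
    · obtain ⟨σ₁, t₁, hx, hI₁, ht₁⟩ := hstep σ' hf hI hz
      obtain ⟨σ₂, t₂, hx₂, hI₂, hz₂, hf₂, ht₂⟩ :=
        ih (Φ σ₁) (by omega) σ₁ rfl (hf.trans hx.frame) hI₁
      exact ⟨σ₂, _, .loopTrue σ' σ₁ σ₂ e s _ t₁ t₂ hk.eval_eq hz hx hx₂, hI₂, hz₂, hf₂, by omega⟩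

end Rules

end Logic

/-! ### Odd prime divisors of an integer and their packed representation. -/

section OddPrimes

/-- The odd primes below `p` that divide `n`, in increasing order. -/
def oddPrimes (n p : ℕ) : List ℕ :=
  (List.range p).filter fun q => q.Prime ∧ q ≠ 2 ∧ q ∣ n

theorem mem_oddPrimes {n p q : ℕ} :
    q ∈ oddPrimes n p ↔ q < p ∧ q.Prime ∧ q ≠ 2 ∧ q ∣ n := by
  simp [oddPrimes]

theorem oddPrimes_pairwise (n p : ℕ) : (oddPrimes n p).Pairwise (· < ·) :=
  List.pairwise_lt_range.filter _

theorem oddPrimes_nodup (n p : ℕ) : (oddPrimes n p).Nodup :=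
  List.nodup_range.filter _

theorem oddPrimes_eq_nil (n : ℕ) {p : ℕ} (hp : p ≤ 3) : oddPrimes n p = [] := by
  rw [List.eq_nil_iff_forall_not_mem]
  intro q hq
  obtain ⟨h1, h2, h3, -⟩ := mem_oddPrimes.1 hq
  have := h2.two_le
  omega

theorem oddPrimes_succ_of_dvd {n p : ℕ} (hp : p.Prime) (h2 : p ≠ 2) (hn : p ∣ n) :
    oddPrimes n (p + 1) = oddPrimes n p ++ [p] := by
  simp [oddPrimes, List.range_succ, List.filter_append, hp, h2, hn]

theorem oddPrimes_succ_of_not {n p : ℕ} (h : ¬(p.Prime ∧ p ∣ n)) :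
    oddPrimes n (p + 1) = oddPrimes n p := by
  rw [oddPrimes, List.range_succ, List.filter_append, oddPrimes,
    List.filter_eq_nil_iff (l := [p]).2, List.append_nil]
  intro a ha
  simp only [List.mem_singleton] at ha
  subst ha
  simp only [decide_eq_true_eq]
  tauto

theorem oddPrimes_eq_of_forall_not_prime {n p p' : ℕ} (h : p ≤ p')
    (hp : ∀ q, p ≤ q → q < p' → ¬q.Prime) : oddPrimes n p' = oddPrimes n p := by
  induction p', h using Nat.le_induction with
  | base => rfl
  | succ k hk ih =>
    rw [oddPrimes_succ_of_not fun h => hp k hk (by omega) h.1,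
      ih fun q h1 h2 => hp q h1 (by omega)]

theorem oddPrimes_toFinset_subset {n : ℕ} (hn : n ≠ 0) (p : ℕ) :
    (oddPrimes n p).toFinset ⊆ n.primeFactors.erase 2 := by
  intro q hq
  rw [List.mem_toFinset, mem_oddPrimes] at hq
  simp [hq.2.1, hq.2.2, hn]

/-- Dropping the last bit turns `p < 2 ^ size` into a lower bound for `p`. This direction is what
allows bit lengths to be added over the divisors of `n` without rounding losses. -/
theorem two_pow_size_half_le {p : ℕ} (hp : 0 < p) : 2 ^ Nat.size (p / 2) ≤ p := by
  rcases Nat.eq_zero_or_pos (p / 2) with h | h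
  · rw [h, Nat.size_zero, pow_zero]; exact hp
  · have h1 : 0 < Nat.size (p / 2) := Nat.size_pos.2 h
    have h2 : 2 ^ (Nat.size (p / 2) - 1) ≤ p / 2 := Nat.lt_size.1 (by omega)
    obtain ⟨k, hk⟩ : ∃ k, Nat.size (p / 2) = k + 1 := ⟨Nat.size (p / 2) - 1, by omega⟩
    rw [hk] at h2 ⊢
    rw [pow_succ]
    simp only [Nat.add_sub_cancel] at h2
    omega

theorem two_pow_sum_size_le {n : ℕ} (hn : n ≠ 0) :
    2 ^ (∑ p ∈ n.primeFactors.erase 2, Nat.size (p / 2)) ≤ n := by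
  rw [← Finset.prod_pow_eq_pow_sum]
  calc ∏ p ∈ n.primeFactors.erase 2, 2 ^ Nat.size (p / 2)
      ≤ ∏ p ∈ n.primeFactors.erase 2, p := Finset.prod_le_prod' fun p hp =>
        two_pow_size_half_le (Nat.prime_of_mem_primeFactors (Finset.mem_of_mem_erase hp)).pos
    _ ≤ ∏ p ∈ n.primeFactors, p := Finset.prod_le_prod_of_subset_of_one_le'
        (Finset.erase_subset _ _) fun p hp _ => (Nat.prime_of_mem_primeFactors hp).one_le
    _ ≤ n := Nat.le_of_dvd (Nat.pos_of_ne_zero hn) (Nat.prod_primeFactors_dvd n)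

/-- The number of odd primes dividing `n`, in terms of the bit length of `n`. -/
theorem card_mul_size_le {n l : ℕ} (hn : n ≠ 0) (hl : n < 2 ^ l) :
    (n.primeFactors.erase 2).card * Nat.size l ≤ 8 * l := by
  set S := n.primeFactors.erase 2 with hS
  have hl0 : 0 < l := by
    rcases Nat.eq_zero_or_pos l with h | h
    · subst h; simp at hl; omega
    · exact h
  -- The cut between small and large primes is at `2 ^ (s + 1)`, of order `√l`: both `2 ^ (2 s) ≤ l`
  -- and `Nat.size l ≤ 2 (s + 1)` hold.
  obtain ⟨s, hs⟩ : ∃ s, (Nat.size l + 1) / 2 = s + 1 :=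
    ⟨(Nat.size l + 1) / 2 - 1, by have := Nat.size_pos.2 hl0; omega⟩
  have hodd : ∀ p ∈ S, p.Prime ∧ p % 2 = 1 := by
    intro p hp
    have h1 := Nat.prime_of_mem_primeFactors (Finset.mem_of_mem_erase hp)
    exact ⟨h1, h1.eq_two_or_odd.resolve_left (Finset.ne_of_mem_erase hp)⟩
  -- Halving is injective on odd numbers.
  have hsmall : (S.filter (· < 2 ^ (s + 1))).card ≤ 2 ^ s := by
    rw [← Finset.card_range (2 ^ s)]
    refine Finset.card_le_card_of_injOn (· / 2) ?_ ?_
    · intro p hp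
      simp only [Finset.coe_filter, Set.mem_ofPred_eq, pow_succ] at hp
      simp only [Finset.coe_range, Set.mem_Iio]
      omega
    · intro p hp q hq hpq
      simp only [Finset.coe_filter, Set.mem_ofPred_eq] at hp hq
      have := (hodd p hp.1).2
      have := (hodd q hq.1).2
      simp only at hpq
      omega
  -- The product of the large primes divides `n < 2 ^ l`, and each of them contributes a factor of
  -- at least `2 ^ (s + 1)`.
  have hlarge : (s + 1) * (S.filter (¬ · < 2 ^ (s + 1))).card ≤ l := by
    refine (Nat.pow_lt_pow_iff_right (a := 2) (by norm_num)).1 (lt_of_le_of_lt ?_ hl) |>.le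
    rw [pow_mul, ← Finset.prod_const]
    calc ∏ _p ∈ S.filter (¬ · < 2 ^ (s + 1)), 2 ^ (s + 1)
        ≤ ∏ p ∈ S.filter (¬ · < 2 ^ (s + 1)), p := Finset.prod_le_prod' fun p hp => by
          simpa using (Finset.mem_filter.1 hp).2
      _ ≤ ∏ p ∈ n.primeFactors, p := Finset.prod_le_prod_of_subset_of_one_le'
          ((Finset.filter_subset _ _).trans (Finset.erase_subset _ _))
          fun p hp _ => (Nat.prime_of_mem_primeFactors hp).one_le
      _ ≤ n := Nat.le_of_dvd (Nat.pos_of_ne_zero hn) (Nat.prod_primeFactors_dvd n)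
  have hcard := Finset.card_filter_add_card_filter_not (s := S) (· < 2 ^ (s + 1))
  have h2l : 2 ^ (2 * s) ≤ l := Nat.lt_size.1 (by omega)
  have hs2 : s + 1 ≤ 2 ^ s := Nat.lt_two_pow_self
  have hpow : (2 : ℕ) ^ (2 * s) = 2 ^ s * 2 ^ s := by rw [two_mul, pow_add]
  have hW : Nat.size l ≤ 2 * (s + 1) := by omega
  calc S.card * Nat.size l ≤ S.card * (2 * (s + 1)) := by gcongr
    _ ≤ 8 * l := by
      rw [← hcard]
      nlinarith [Nat.mul_le_mul_left (s + 1) hsmall, Nat.mul_le_mul_right (2 ^ s) hs2]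

/-- The number of bits taken by a list of odd primes without their trailing bits. -/
def packBits (l : List ℕ) : ℕ := (l.map fun p => Nat.size (p / 2)).sum

/-- The odd primes of a list packed in one number, without their trailing bits. -/
def pack : List ℕ → ℕ
  | [] => 0
  | p :: l => p / 2 + 2 ^ Nat.size (p / 2) * pack l

@[simp] theorem packBits_nil : packBits [] = 0 := rfl

@[simp] theorem packBits_cons (p : ℕ) (l : List ℕ) :
    packBits (p :: l) = Nat.size (p / 2) + packBits l := by simp [packBits]

@[simp] theorem packBits_append (l l' : List ℕ) :
    packBits (l ++ l') = packBits l + packBits l' := by simp [packBits]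

theorem pack_append (l l' : List ℕ) : pack (l ++ l') = pack l + 2 ^ packBits l * pack l' := by
  induction l with
  | nil => simp [pack]
  | cons p l ih => simp only [List.cons_append, pack, ih, packBits_cons, pow_add]; ring

theorem pack_lt (l : List ℕ) : pack l < 2 ^ packBits l := by
  induction l with
  | nil => simp [pack]
  | cons p l ih =>
    rw [pack, packBits_cons, pow_add]
    have h1 := Nat.lt_size_self (p / 2)
    have h2 := Nat.mul_le_mul_left (2 ^ Nat.size (p / 2)) (Nat.succ_le_of_lt ih)
    rw [Nat.mul_succ] at h2
    omega

/-- The packed part lies below bit `packBits l`, so the bitwise or acts as an addition without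
carries. -/
theorem pack_or_shiftLeft (l : List ℕ) (p : ℕ) :
    pack l ||| (p >>> 1) <<< packBits l = pack (l ++ [p]) := by
  rw [Nat.or_comm, ← Nat.shiftLeft_add_eq_or_of_lt (pack_lt l), pack_append, Nat.shiftRight_one,
    Nat.shiftLeft_eq]
  simp [pack]
  ring

theorem pack_append_cons_shiftRight (l l' : List ℕ) (p : ℕ) :
    (pack (l ++ p :: l') >>> packBits l) &&& (2 ^ Nat.size (p / 2) - 1) = p / 2 := by
  rw [Nat.and_two_pow_sub_one_eq_mod, Nat.shiftRight_eq_div_pow, pack_append,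
    Nat.add_mul_div_left _ _ (by positivity), Nat.div_eq_of_lt (pack_lt l), zero_add, pack,
    Nat.add_mul_mod_self_left, Nat.mod_eq_of_lt (Nat.lt_size_self _)]

theorem packBits_oddPrimes {n : ℕ} (p : ℕ) :
    packBits (oddPrimes n p) = ∑ q ∈ (oddPrimes n p).toFinset, Nat.size (q / 2) := by
  rw [packBits, List.sum_toFinset _ (oddPrimes_nodup n p)]

/-- With `l` the bit length of `x`, this makes the packed list fit into `L` bits, and every end
position, being below `L`, into `W` bits. -/
theorem packBits_oddPrimes_lt {n l : ℕ} (hn : n ≠ 0) (hl : n < 2 ^ l) (p : ℕ) :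
    packBits (oddPrimes n p) < l := by
  refine (Nat.pow_lt_pow_iff_right (a := 2) (by norm_num)).1 (lt_of_le_of_lt ?_ hl)
  refine le_trans ?_ (two_pow_sum_size_le hn)
  rw [packBits_oddPrimes]
  exact Nat.pow_le_pow_right (by norm_num)
    (Finset.sum_le_sum_of_subset (oddPrimes_toFinset_subset hn p))

theorem length_oddPrimes_le {n : ℕ} (hn : n ≠ 0) (p : ℕ) :
    (oddPrimes n p).length ≤ (n.primeFactors.erase 2).card := by
  rw [← List.toFinset_card_of_nodup (oddPrimes_nodup n p)]
  exact Finset.card_le_card (oddPrimes_toFinset_subset hn p)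

theorem length_oddPrimes_le_div {n l : ℕ} (hn : n ≠ 0) (hl : n < 2 ^ l) (p : ℕ) :
    (oddPrimes n p).length ≤ 8 * l / Nat.size l := by
  have hl0 : 0 < l := by
    rcases Nat.eq_zero_or_pos l with h | h
    · subst h; simp at hl; omega
    · exact h
  rw [Nat.le_div_iff_mul_le (Nat.size_pos.2 hl0)]
  exact (Nat.mul_le_mul_right _ (length_oddPrimes_le hn p)).trans (card_mul_size_le hn hl)

theorem length_oddPrimes_le_cardFactors {n : ℕ} (hn : n ≠ 0) (p : ℕ) :
    (oddPrimes n p).length ≤ n.primeFactorsList.length := by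
  refine (length_oddPrimes_le hn p).trans (((Finset.card_le_card (Finset.erase_subset _ _))).trans ?_)
  exact List.toFinset_card_le _

end OddPrimes

/-! ### Word size, fixed parameters, and the setup phase. -/

section Setup

/-- The segment length. -/
def segLen (x : ℕ) : ℕ := x.sqrt / (x.size * x.size.size) + 1

/-- The number of pointers for each integer of a segment. -/
def ptrCount (x : ℕ) : ℕ := 8 * x.size / x.size.size + 1

/-- The word size `w` is large enough for the input `x`. -/
structure WordOk (x w : ℕ) : Prop where
  pos : 3 ≤ x
  le_cap : 100 * (x + 1) ^ 3 ≤ cap w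
  size_le : 3 * x.size ≤ w

theorem size_le_self (x : ℕ) : x.size ≤ x := Nat.size_le.2 Nat.lt_two_pow_self

theorem size_eq_size_half_add_one {t : ℕ} (ht : 0 < t) : t.size = (t / 2).size + 1 := by
  have h := Nat.size_bit (b := t.bodd) (n := t.div2) (by rw [Nat.bit_bodd_div2]; omega)
  rwa [Nat.bit_bodd_div2, Nat.div2_val] at h

theorem two_le_size {x : ℕ} (h : 3 ≤ x) : 2 ≤ x.size := Nat.lt_size.2 (by omega)

theorem two_le_size_size {x : ℕ} (h : 3 ≤ x) : 2 ≤ x.size.size :=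
  Nat.lt_size.2 (two_le_size h)

theorem segLen_le (x : ℕ) : segLen x ≤ x.sqrt + 1 := by
  unfold segLen; gcongr; exact Nat.div_le_self _ _

theorem ptrCount_le {x : ℕ} (h : 3 ≤ x) : ptrCount x ≤ 5 * x.size := by
  have h2 := two_le_size_size h
  have h3 := two_le_size h
  have : 8 * x.size / x.size.size ≤ 8 * x.size / 2 := Nat.div_le_div_left h2 (by norm_num)
  unfold ptrCount
  omega

/-- The factor `L` in the divisor defining `segLen` cancels the `5 L` bounding `ptrCount`. Pointer
indices thus stay far below the word capacity, and allocating the pointers takes linear time. -/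
theorem segLen_mul_ptrCount_le {x : ℕ} (h : 3 ≤ x) : segLen x * ptrCount x ≤ 10 * x := by
  have h2 := two_le_size_size h
  have h3 := two_le_size h
  have h4 : x.sqrt / (x.size * x.size.size) * x.size ≤ x.sqrt := by
    calc x.sqrt / (x.size * x.size.size) * x.size
        ≤ x.sqrt / x.size * x.size := by
          gcongr; exact Nat.le_mul_of_pos_right _ (by omega)
      _ ≤ x.sqrt := Nat.div_mul_le_self _ _
  have h5 : segLen x * ptrCount x ≤ segLen x * (5 * x.size) := by
    gcongr; exact ptrCount_le h
  have h6 : segLen x * (5 * x.size) = 5 * (x.sqrt / (x.size * x.size.size) * x.size) + 5 * x.size := by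
    unfold segLen; ring
  have := size_le_self x
  have := x.sqrt_le_self
  omega

/-- The variables and arrays that stay fixed after the setup. -/
structure Env (x : ℕ) (σ : State Var Arr) : Prop where
  x_eq : σ.vars .x = x
  r_eq : σ.vars .r = x.sqrt
  L_eq : σ.vars .L = x.size
  W_eq : σ.vars .W = x.size.size
  Delta_eq : σ.vars .Delta = segLen x
  M_eq : σ.vars .M = ptrCount x
  list_len : (σ.arr .list).len = segLen x
  list_width : (σ.arr .list).width = x.size
  plen_len : (σ.arr .plen).len = segLen x
  plen_width : (σ.arr .plen).width = x.size.size
  ptr_len : (σ.arr .ptr).len = segLen x * ptrCount x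
  ptr_width : (σ.arr .ptr).width = x.size.size

/-- Statements that preserve the fixed variables and arrays. -/
def Stmt.keepsEnv (s : Stmt Var Arr) : Bool :=
  !s.writes .x && !s.writes .r && !s.writes .L && !s.writes .W && !s.writes .Delta &&
    !s.writes .M && !s.allocs .list && !s.allocs .plen && !s.allocs .ptr

theorem Env.frame {x : ℕ} {σ σ' : State Var Arr} {s : Stmt Var Arr} (h : Env x σ)
    (hs : s.keepsEnv = true) (hf : Frame s σ σ') : Env x σ' := by
  simp only [Stmt.keepsEnv, Bool.and_eq_true, Bool.not_eq_true'] at hs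
  obtain ⟨⟨⟨⟨⟨⟨⟨⟨h1, h2⟩, h3⟩, h4⟩, h5⟩, h6⟩, h7⟩, h8⟩, h9⟩ := hs
  exact ⟨(hf.vars _ h1).trans h.x_eq, (hf.vars _ h2).trans h.r_eq, (hf.vars _ h3).trans h.L_eq,
    (hf.vars _ h4).trans h.W_eq, (hf.vars _ h5).trans h.Delta_eq, (hf.vars _ h6).trans h.M_eq,
    (hf.len _ h7).trans h.list_len, (hf.width _ h7).trans h.list_width,
    (hf.len _ h8).trans h.plen_len, (hf.width _ h8).trans h.plen_width,
    (hf.len _ h9).trans h.ptr_len, (hf.width _ h9).trans h.ptr_width⟩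

section

variable {x w : ℕ}

/-- A quadratic bound covers the products and indices that occur; only `L ^ 3`
(`WordOk.size_cube_lt_cap`) and shifted values are treated apart. -/
theorem WordOk.lt_cap (h : WordOk x w) {n : ℕ} (hn : n ≤ 20 * (x + 1) * (x + 1)) : n < cap w := by
  have := h.le_cap
  have h1 := h.pos
  refine lt_of_lt_of_le ?_ this
  nlinarith [sq_nonneg x]

theorem WordOk.lt_cap_of_le (h : WordOk x w) {n : ℕ} (hn : n ≤ 60 * x) : n < cap w :=
  h.lt_cap (by have := h.pos; nlinarith)

theorem WordOk.mul_lt_cap (h : WordOk x w) {a b : ℕ} (ha : a ≤ 4 * (x + 1))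
    (hb : b ≤ 5 * (x + 1)) : a * b < cap w :=
  h.lt_cap ((Nat.mul_le_mul ha hb).trans (by ring_nf; rfl))

theorem runs_setup (h : WordOk x w) : Runs w setup (input x) fun σ t =>
    Env x σ ∧ σ.out = [] ∧ (σ.arr .gap).len = 0 ∧ (σ.arr .big).len = 0 ∧ t ≤ 200 * x := by
  have hx := h.pos
  have c0 := h.lt_cap_of_le le_rfl
  have c1 : ∀ n, n ≤ 60 * x → n < cap w := fun n => h.lt_cap_of_le
  have hL := size_le_self x
  have hW := size_le_self x.size
  have hL2 := two_le_size hx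
  have hW2 := two_le_size_size hx
  have hr : x.sqrt * x.sqrt ≤ x := Nat.sqrt_le x
  have hr1 : x.sqrt ≤ x := Nat.sqrt_le_self x
  unfold setup
  refine Runs.seq (Runs.assign 0 (by simp; omega) rfl ?_)
  refine Runs.seq (Runs.assign x (by simp) (by simp [input]) ?_)
  -- Halving `t` removes one bit, which is moved to the counter. The potential is linear in `t`,
  -- although the loop runs only logarithmically often, because linear time is affordable here.
  refine Runs.seq (Runs.loop (fun σ => σ.vars .L + (σ.vars .t).size = x.size ∧ σ.vars .t ≤ x)
    (fun σ => 12 * σ.vars .t) (by simp) ?_ ?_ ?_)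
  · intro σ hf hI
    simp; omega
  · intro σ hf ⟨hI, hI'⟩ hc
    simp at hc
    have := size_eq_size_half_add_one (Nat.pos_of_ne_zero hc)
    refine Runs.seq (Runs.assign (σ.vars .L + 1) (by simp; omega) (by simp) ?_)
    refine Runs.assign (σ.vars .t / 2) (by simp; omega) (by simp) ?_
    simp
    omega
  intro σ t₁ hf ⟨hI, hI'⟩ hc ht
  simp only [val_lt, val_lit, val_var] at hc
  simp only [setVar_vars, reduceCtorEq, if_true, if_false, cost_bin, cost_lit, cost_var] at ht
  have ht0 : σ.vars .t = 0 := by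
    simpa using hc
  rw [ht0, Nat.size_zero, add_zero] at hI
  have hfx : σ.vars .x = x := (hf.vars .x rfl).trans (by simp [input])
  have hfa : σ.arr = (input x).arr := funext fun a => hf.arr a (by cases a <;> rfl)
  have hfo : σ.out = [] := hf.out rfl
  clear hf
  refine Runs.seq (Runs.assign 0 (by simp; omega) rfl ?_)
  refine Runs.seq (Runs.assign x.size (by simp) (by simp [hI]) ?_)
  refine Runs.seq (Runs.loop (fun σ => σ.vars .W + (σ.vars .t).size = x.size.size ∧ σ.vars .t ≤ x)
    (fun σ => 12 * σ.vars .t) (by simp; omega) ?_ ?_ ?_)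
  · intro σ hf hI
    simp; omega
  · intro σ hf ⟨hI, hI'⟩ hc
    simp at hc
    have := size_eq_size_half_add_one (Nat.pos_of_ne_zero hc)
    refine Runs.seq (Runs.assign (σ.vars .W + 1) (by simp; omega) (by simp) ?_)
    refine Runs.assign (σ.vars .t / 2) (by simp; omega) (by simp) ?_
    simp
    omega
  intro σ₂ t₂ hf ⟨hI₂, hI₂'⟩ hc ht₂
  simp only [val_lt, val_lit, val_var] at hc
  simp only [setVar_vars, reduceCtorEq, if_true, if_false, cost_bin, cost_lit, cost_var] at ht₂
  have ht0 : σ₂.vars .t = 0 := by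
    simpa using hc
  rw [ht0, Nat.size_zero, add_zero] at hI₂
  replace hfx : σ₂.vars .x = x := (hf.vars .x rfl).trans (by simp [hfx])
  have hfL : σ₂.vars .L = x.size := (hf.vars .L rfl).trans (by simp [hI])
  replace hfa : σ₂.arr = (input x).arr := (funext fun a => hf.arr a (by cases a <;> rfl)).trans hfa
  replace hfo : σ₂.out = [] := (hf.out rfl).trans hfo
  clear hf
  refine Runs.seq (Runs.assign 0 (by simp; omega) rfl ?_)
  refine Runs.seq (Runs.loop (fun σ => σ.vars .r * σ.vars .r ≤ x)
    (fun σ => 20 * (x - σ.vars .r)) (by simp) ?_ ?_ ?_)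
  · intro σ hf hI
    have hle : σ.vars .r ≤ x := le_trans (Nat.le_mul_self _) hI
    have h1 : (σ.vars .r + 1) * (σ.vars .r + 1) < cap w :=
      h.mul_lt_cap (by omega) (by omega)
    simp
    omega
  · intro σ hf hI hc
    have hle : σ.vars .r ≤ x := le_trans (Nat.le_mul_self _) hI
    have hfx : σ.vars .x = x := (hf.vars .x rfl).trans (by simp [hfx])
    simp [hfx] at hc
    refine Runs.assign (σ.vars .r + 1) (by simp; exact ⟨c1 _ (by omega), c1 _ (by omega)⟩) (by simp) ?_
    have : σ.vars .r + 1 ≤ x := le_trans (Nat.le_mul_self _) hc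
    simp
    exact ⟨hc, by omega⟩
  intro σ₃ t₃ hf hI₃ hc ht₃
  replace hfx : σ₃.vars .x = x := (hf.vars .x rfl).trans (by simp [hfx])
  replace hfL : σ₃.vars .L = x.size := (hf.vars .L rfl).trans (by simp [hfL])
  have hfW : σ₃.vars .W = x.size.size := (hf.vars .W rfl).trans (by simp [hI₂])
  replace hfa : σ₃.arr = (input x).arr := (funext fun a => hf.arr a (by cases a <;> rfl)).trans hfa
  replace hfo : σ₃.out = [] := (hf.out rfl).trans hfo
  clear hf
  have hfr : σ₃.vars .r = x.sqrt := by
    simp [hfx] at hc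
    exact (Nat.eq_sqrt.2 ⟨hI₃, hc⟩)
  have hLW : x.size * x.size.size ≤ x * x := Nat.mul_le_mul (by omega) (by omega)
  have hLW' : x.size * x.size.size ≠ 0 := by positivity
  have hD := segLen_le x
  have hM := ptrCount_le hx
  have hDM := segLen_mul_ptrCount_le hx
  have hLW1 : x.size * x.size.size < cap w := h.mul_lt_cap (by omega) (by omega)
  have hdiv : x.sqrt / (x.size * x.size.size) ≤ x.sqrt := Nat.div_le_self _ _
  have hdiv' : 8 * x.size / x.size.size ≤ 8 * x.size := Nat.div_le_self _ _
  refine Runs.seq (Runs.assign (segLen x) ?_ (by simp [hfr, hfL, hfW, segLen]) ?_)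
  · simp [hfr, hfL, hfW]
    omega
  refine Runs.seq (Runs.assign (ptrCount x) ?_ (by simp [hfL, hfW, ptrCount]) ?_)
  · simp [hfL, hfW]
    omega
  refine Runs.seq (Runs.alloc (segLen x) x.size (by simp) (by simp) (by simp) (by simp [hfL])
    (by simp [hfa, input]) (by have := h.size_le; omega) ?_)
  refine Runs.seq (Runs.alloc (segLen x) x.size.size (by simp) (by simp) (by simp) (by simp [hfW])
    (by simp [hfa, input]) (by have := h.size_le; omega) ?_)
  refine Runs.alloc (segLen x * ptrCount x) x.size.size ?_ (by simp) (by simp) (by simp [hfW])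
    (by simp [hfa, input]) (by have := h.size_le; omega) ?_
  · simp; omega
  simp only [setArr_out, setVar_out, setArr_arr, setVar_arr, reduceCtorEq, if_false, hfa, hfo, input]
  refine ⟨⟨?_, ?_, ?_, ?_, ?_, ?_, ?_, ?_, ?_, ?_, ?_, ?_⟩, trivial, trivial, trivial, ?_⟩ <;>
    try simp [hfx, hfr, hfL, hfW]
  simp at ht₃
  have h₁ : t₁ ≤ 12 * x + 4 := by clear ht₂ ht₃; omega
  have h₂ : t₂ ≤ 12 * x.size + 4 := by clear ht ht₃; omega
  have h₃ : t₃ ≤ 20 * x + 10 := by clear ht ht₂; omega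
  linarith

end

end Setup
-- Enumerating the odd primes up to `√x` by trial division.
section Scan

/-- The odd primes in increasing order. -/
noncomputable def oddPrime (j : ℕ) : ℕ := Nat.nth Nat.Prime (j + 1)

/-- The number of primes `5 ≤ c ≤ √x`. -/
def gapCount (x : ℕ) : ℕ := Nat.count Nat.Prime (x.sqrt + 1) - 2

theorem oddPrime_prime (j : ℕ) : (oddPrime j).Prime := Nat.prime_nth_prime _

theorem oddPrime_of_count {c j : ℕ} (hc : c.Prime) (h : Nat.count Nat.Prime c = j + 1) :
    oddPrime j = c := by
  rw [oddPrime, ← h, Nat.nth_count hc]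

theorem oddPrime_zero : oddPrime 0 = 3 :=
  oddPrime_of_count Nat.prime_three (by decide)

theorem oddPrime_strictMono : StrictMono oddPrime := fun _ _ h =>
  Nat.nth_strictMono Nat.infinite_setOfPred_prime (by omega)

theorem three_le_oddPrime (j : ℕ) : 3 ≤ oddPrime j :=
  oddPrime_zero ▸ oddPrime_strictMono.monotone j.zero_le

theorem oddPrime_mod_two (j : ℕ) : oddPrime j % 2 = 1 :=
  (oddPrime_prime j).eq_two_or_odd.resolve_left (by have := three_le_oddPrime j; omega)

theorem oddPrime_lt_succ (j : ℕ) : oddPrime j < oddPrime (j + 1) :=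
  oddPrime_strictMono j.lt_succ_self

theorem not_prime_of_between {j m : ℕ} (h1 : oddPrime j < m) (h2 : m < oddPrime (j + 1)) :
    ¬m.Prime := by
  intro hm
  have h3 : Nat.nth Nat.Prime (Nat.count Nat.Prime m) = m := Nat.nth_count hm
  rw [oddPrime, ← h3, Nat.nth_lt_nth Nat.infinite_setOfPred_prime] at h1 h2
  omega

/-- The index `j + 1` in `oddPrime` is `j + 2` in `Nat.nth`, which skips the primes 2 and 3. The
truncated subtraction in `gapCount` is harmless: when fewer than two primes are counted, both sides
are false. -/
theorem oddPrime_le_iff {x j : ℕ} : oddPrime (j + 1) ≤ x.sqrt ↔ j < gapCount x := by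
  rw [← Nat.lt_succ_iff, oddPrime, gapCount]
  have : Nat.nth Nat.Prime (j + 1 + 1) < x.sqrt.succ ↔ j + 1 + 1 < Nat.count Nat.Prime x.sqrt.succ := by
    rw [← not_le, ← not_le, Nat.count_le_iff_le_nth Nat.infinite_setOfPred_prime]
  rw [this]
  simp only [Nat.succ_eq_add_one]
  omega

theorem prime_of_odd_trial {c d : ℕ} (hc : c % 2 = 1) (hc5 : 5 ≤ c) (hd : c < d * d)
    (h : ∀ m, m % 2 = 1 → 3 ≤ m → m < d → ¬m ∣ c) : c.Prime := by
  by_contra hp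
  have h1 := Nat.minFac_sq_le_self (by omega) hp
  have h2 := Nat.minFac_prime (n := c) (by omega)
  have h3 := Nat.minFac_dvd c
  have h4 : c.minFac % 2 = 1 := by
    rcases h2.eq_two_or_odd with h | h
    · rw [h] at h3; omega
    · exact h
  have h5 : c.minFac < d := by nlinarith
  have := h2.two_le
  exact h _ h4 (by omega) h5 h3

theorem count_prime_add_two {c : ℕ} (hc : c % 2 = 1) (hc5 : 5 ≤ c) :
    Nat.count Nat.Prime (c + 2) = Nat.count Nat.Prime (c + 1) := by
  rw [Nat.count_succ, if_neg, add_zero]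
  intro h
  have := h.eq_two_or_odd
  omega

variable {x w : ℕ}

/-- The trial division of `c`. -/
theorem runs_trial (h : WordOk x w) {σ : State Var Arr} {c : ℕ} (hc : σ.vars .c = c)
    (hc2 : c % 2 = 1) (hc5 : 5 ≤ c) (hcx : c ≤ x) (hd : σ.vars .d = 3) :
    Runs w (.loop ((rd .d * rd .d ≤ₑ rd .c) &&& (rd .c % rd .d ≠ₑ 0)) (.d ::= rd .d + 2)) σ
      fun σ' t => σ'.vars .d ≤ c ∧ (c < σ'.vars .d * σ'.vars .d ↔ c.Prime) ∧ t ≤ 16 * c + 100 := by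
  have c0 := h.lt_cap_of_le le_rfl
  have hx := h.pos
  refine Runs.loop (fun σ => σ.vars .d % 2 = 1 ∧ 3 ≤ σ.vars .d ∧ σ.vars .d ≤ c ∧
      ∀ m, m % 2 = 1 → 3 ≤ m → m < σ.vars .d → ¬m ∣ c) (fun σ => 16 * (c - σ.vars .d))
    ⟨by omega, by omega, by omega, fun m _ _ _ => by omega⟩ ?_ ?_ ?_
  · intro σ' hf ⟨h1, h2, h3, h4⟩
    have h5 : σ'.vars .d * σ'.vars .d < cap w := h.mul_lt_cap (by omega) (by omega)
    have h6 : σ'.vars .c = c := (hf.vars .c rfl).trans hc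
    have h7 : c % σ'.vars .d ≤ c := Nat.mod_le _ _
    have h8 := truth_le_one (σ'.vars .d * σ'.vars .d ≤ c ∧ c % σ'.vars .d ≠ 0)
    simp only [ok_and, ok_le, ok_mul, ok_var, ok_ne, ok_mod, ok_lit, val_mul, val_var, h6,
      val_le, val_ne, val_mod, val_lit, truth_and_truth]
    refine ⟨⟨⟨trivial, trivial, h5⟩, trivial, by omega⟩, ⟨⟨trivial, trivial, by omega, by omega⟩,
      by omega, by omega⟩, ?_⟩
    omega
  · intro σ' hf ⟨h1, h2, h3, h4⟩ hz
    have h6 : σ'.vars .c = c := (hf.vars .c rfl).trans hc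
    simp [h6] at hz
    have h7 : 3 * σ'.vars .d ≤ σ'.vars .d * σ'.vars .d := Nat.mul_le_mul_right _ h2
    refine Runs.assign (σ'.vars .d + 2) (by simp; omega) (by simp) ?_
    simp only [setVar_vars, if_true]
    refine ⟨⟨by omega, by omega, by omega, ?_⟩, ?_⟩
    · intro m hm hm3 hmd hdvd
      rcases lt_or_ge m (σ'.vars .d) with hlt | hge
      · exact h4 m hm hm3 hlt hdvd
      · have : m = σ'.vars .d := by omega
        subst this
        exact hz.2 (Nat.mod_eq_zero_of_dvd hdvd)
    · simp
      omega
  · intro σ' t hf ⟨h1, h2, h3, h4⟩ hz ht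
    have h6 : σ'.vars .c = c := (hf.vars .c rfl).trans hc
    simp [h6] at hz
    refine ⟨h3, ⟨fun hlt => prime_of_odd_trial hc2 hc5 hlt h4, fun hp => ?_⟩, ?_⟩
    · by_contra hle
      rw [not_lt] at hle
      have h7 : 3 * σ'.vars .d ≤ σ'.vars .d * σ'.vars .d := Nat.mul_le_mul_right _ h2
      exact Nat.not_prime_of_dvd_of_lt (Nat.dvd_of_mod_eq_zero (hz hle)) (by omega) (by omega) hp
    · simp at ht
      omega

/-- One specification serves both the counting and the storing pass. `I j` is the property after `j`
gaps; it must survive changes of the scan's own variables `p`, `c`, `d`, and `K` bounds one run of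
the body. -/
theorem runs_scanPrimes (h : WordOk x w) {body : Stmt Var Arr} (I : ℕ → State Var Arr → Prop)
    (K : ℕ) (hbc : body.writes .c = false) (hbr : body.writes .r = false)
    (hstable : ∀ j σ σ', (∀ v, v ≠ .p → v ≠ .c → v ≠ .d → σ'.vars v = σ.vars v) →
      σ'.arr = σ.arr → σ'.out = σ.out → I j σ → I j σ')
    (hbody : ∀ j σ, I j σ → σ.vars .p = oddPrime j → σ.vars .c = oddPrime (j + 1) →
      j < gapCount x → Runs w body σ fun σ' t => I (j + 1) σ' ∧ t ≤ K)
    {σ : State Var Arr} (hr : σ.vars .r = x.sqrt) (h0 : I 0 σ) :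
    Runs w (scanPrimes body) σ fun σ' t => I (gapCount x) σ' ∧ t ≤ (K + 200) * (x + 1) := by
  have c0 := h.lt_cap_of_le le_rfl
  have hx := h.pos
  have hsq : x.sqrt * x.sqrt ≤ x := Nat.sqrt_le x
  have hsx := Nat.sqrt_le_self x
  unfold scanPrimes
  refine Runs.seq (Runs.assign 3 (by simp; omega) (by simp) ?_)
  refine Runs.seq (Runs.assign 5 (by simp; omega) (by simp) ?_)
  -- The primes below `c` are 2 and the first `j + 1` odd primes, the last of which is `p`. The
  -- alternative `c = 5` covers `√x < 3`, where the initial candidate already exceeds `√x + 2`.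
  refine Runs.loop (fun σ' => ∃ j, Nat.count Nat.Prime (σ'.vars .c) = j + 2 ∧
      σ'.vars .p = oddPrime j ∧ σ'.vars .c % 2 = 1 ∧ 5 ≤ σ'.vars .c ∧
      (σ'.vars .c = 5 ∨ σ'.vars .c ≤ x.sqrt + 2) ∧ σ'.vars .r = x.sqrt ∧ I j σ')
    -- Even with trial division charged linearly in `c ≤ √x`, the scan costs `O(√x · √x)`, which is
    -- linear in `x`.
    (fun σ' => (K + 16 * x.sqrt + 150) * (x.sqrt + 2 - σ'.vars .c)) ?_ ?_ ?_ ?_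
  · refine ⟨0, ?_, by simp [oddPrime_zero], by simp, by simp, by simp, by simp [hr],
      hstable 0 σ _ (fun v h1 h2 h3 => by simp [h1, h2]) rfl rfl h0⟩
    simp only [setVar_vars, if_true]
    decide
  · intro σ' _ _
    simp; omega
  · rintro σ₁ - ⟨j, hcount, hp, hc2, hc5, -, hr₁, hI⟩ hz
    simp [hr₁] at hz
    set c := σ₁.vars .c with hc
    refine Runs.seq (Runs.assign 3 (by simp; omega) (by simp) ?_)
    refine Runs.seq ((runs_trial h (c := c) (by simp [hc]) hc2 hc5 (by omega) (by simp)).mono ?_)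
    rintro σ₂ t₂ hf ⟨hdc, hprime, ht₂⟩
    have hc₂ : σ₂.vars .c = c := (hf.vars .c rfl).trans (by simp [hc])
    have hp₂ : σ₂.vars .p = oddPrime j := (hf.vars .p rfl).trans (by simp [hp])
    have hr₂ : σ₂.vars .r = x.sqrt := (hf.vars .r rfl).trans (by simp [hr₁])
    have hI₂ : I j σ₂ := hstable j σ₁ σ₂ (fun v h1 h2 h3 => by
      rw [hf.vars v (by simp [Stmt.writes, Ne.symm h3])]; simp [h3])
      (funext fun a => hf.arr a rfl) (hf.out rfl) hI
    have h5 : σ₂.vars .d * σ₂.vars .d < cap w := h.mul_lt_cap (by omega) (by omega)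
    clear hf
    have hΦ : (K + 16 * x.sqrt + 150) * (x.sqrt - c) + (K + 16 * x.sqrt + 150) ≤
        (K + 16 * x.sqrt + 150) * (x.sqrt + 2 - c) := by
      rw [← Nat.mul_succ]
      exact Nat.mul_le_mul_left _ (by omega)
    refine Runs.seq (Runs.ite (by simp; omega) ?_ ?_)
    · intro hz
      simp [hc₂] at hz
      have hcp := hprime.1 hz
      have hcj : oddPrime (j + 1) = c := oddPrime_of_count hcp hcount
      refine Runs.seq ((hbody j σ₂ hI₂ hp₂ (by rw [hc₂, hcj])
        (oddPrime_le_iff.1 (by omega))).mono ?_)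
      rintro σ₃ t₃ hf ⟨hI₃, ht₃⟩
      have hc₃ : σ₃.vars .c = c := (hf.vars .c hbc).trans hc₂
      have hr₃ : σ₃.vars .r = x.sqrt := (hf.vars .r hbr).trans hr₂
      refine Runs.assign c (by simp) (by simp [hc₃]) ?_
      refine Runs.assign (c + 2) (by simp; omega) (by simp [hc₃]) ?_
      refine ⟨⟨j + 1, ?_, ?_, ?_, ?_, ?_, ?_, ?_⟩, ?_⟩
      · simp [count_prime_add_two hc2 hc5, Nat.count_succ, hcount, hcp]
      · simp [hcj]
      · simp; omega
      · simp; omega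
      · simp; omega
      · simp [hr₃]
      · exact hstable _ σ₃ _ (fun v h1 h2 h3 => by simp [h1, h2]) rfl rfl hI₃
      · simp
        omega
    · intro hz
      simp [hc₂] at hz
      have hcp : ¬c.Prime := fun hp => by have := hprime.2 hp; omega
      refine Runs.skip ?_
      refine Runs.assign (c + 2) (by simp; omega) (by simp [hc₂]) ?_
      refine ⟨⟨j, ?_, ?_, ?_, ?_, ?_, ?_, ?_⟩, ?_⟩
      · simp [count_prime_add_two hc2 hc5, Nat.count_succ, hcount, hcp]
      · simp [hp₂]
      · simp; omega
      · simp; omega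
      · simp; omega
      · simp [hr₂]
      · exact hstable _ σ₂ _ (fun v h1 h2 h3 => by simp [h2]) rfl rfl hI₂
      · simp
        omega
  · rintro σ₁ t - ⟨j, hcount, hp, hc2, hc5, hcle, hr₁, hI⟩ hz ht
    simp [hr₁] at hz
    -- The final `c` is either 5, with too few primes for any gap, or one of `√x + 1` and `√x + 2`.
    -- In the last case `√x + 1` is even and does not affect the count.
    have hj : j = gapCount x := by
      unfold gapCount
      rcases lt_or_ge (x.sqrt + 2) (σ₁.vars .c) with h6 | h6
      · have h7 : σ₁.vars .c = 5 := by omega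
        have h8 : Nat.count Nat.Prime 5 = 2 := by decide
        have h9 : Nat.count Nat.Prime (x.sqrt + 1) ≤ Nat.count Nat.Prime 5 :=
          Nat.count_monotone _ (by omega)
        rw [h7] at hcount
        omega
      · have h7 : Nat.count Nat.Prime (σ₁.vars .c) = Nat.count Nat.Prime (x.sqrt + 1) := by
          rcases Nat.eq_or_lt_of_le hz with h8 | h8
          · rw [← h8]
          · have h9 : σ₁.vars .c = x.sqrt + 1 + 1 := by omega
            rw [h9, Nat.count_succ, if_neg, add_zero]
            intro h10
            have := h10.eq_two_or_odd
            omega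
        omega
    refine ⟨hj ▸ hI, ?_⟩
    have h7 : (K + 16 * x.sqrt + 150) * (x.sqrt - 3) ≤ (K + 16 * x.sqrt + 150) * x.sqrt :=
      Nat.mul_le_mul_left _ (by omega)
    have h8 : (K + 16 * x.sqrt + 150) * x.sqrt = K * x.sqrt + 16 * (x.sqrt * x.sqrt) + 150 * x.sqrt := by
      ring
    have h9 : K * x.sqrt ≤ K * x := Nat.mul_le_mul_left _ hsx
    have h10 : (K + 200) * (x + 1) = K * x + K + 200 * x + 200 := by ring
    simp at ht
    simp only [cost_lit]
    omega

end Scan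
-- The compressed list of half-gaps and the overflow list.
section Gaps

/-- The gap after the odd prime number `j` is too large for a cell of `gap`. -/
def BigGap (x j : ℕ) : Prop := x.size * x.size * x.size < oddPrime (j + 1) - oddPrime j

noncomputable instance (x : ℕ) : DecidablePred (BigGap x) := fun _ => Nat.decLt _ _

/-- The number of large gaps among the first `j` gaps. -/
noncomputable def bigCount (x j : ℕ) : ℕ := Nat.count (BigGap x) j

variable {x w : ℕ}

theorem bigCount_succ_of (j : ℕ) (h : BigGap x j) : bigCount x (j + 1) = bigCount x j + 1 := by
  rw [bigCount, Nat.count_succ, if_pos h, bigCount]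

theorem bigCount_succ_of_not (j : ℕ) (h : ¬BigGap x j) : bigCount x (j + 1) = bigCount x j := by
  rw [bigCount, Nat.count_succ, if_neg h, bigCount, add_zero]

theorem bigCount_mono (x : ℕ) : Monotone (bigCount x) := Nat.count_monotone _

theorem bigCount_le (x j : ℕ) : bigCount x j ≤ j := Nat.count_le _

theorem bigCount_lt {j j' : ℕ} (h : j < j') (hb : BigGap x j) : bigCount x j < bigCount x j' := by
  have := bigCount_mono x (Nat.succ_le_of_lt h)
  rw [Nat.succ_eq_add_one, bigCount_succ_of j hb] at this
  omega

theorem gapCount_le (x : ℕ) : gapCount x ≤ x := by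
  have h : Nat.count Nat.Prime (x.sqrt + 1) ≤ x.sqrt + 1 := Nat.count_le _
  have := Nat.sqrt_le_self x
  unfold gapCount
  omega

theorem Env.setVar {σ : State Var Arr} (h : Env x σ) {v : Var} {n : ℕ}
    (hv : (v ::= .lit 0 : Stmt Var Arr).keepsEnv = true := by rfl) : Env x (σ.setVar v n) :=
  h.frame hv ⟨fun u hu => by
    simp only [Stmt.writes, decide_eq_false_iff_not] at hu
    simp [Ne.symm hu], fun _ _ => rfl, fun _ _ => rfl, fun _ _ => rfl, fun _ => rfl⟩

theorem Env.put {σ : State Var Arr} (h : Env x σ) {a : Arr} {m n : ℕ} : Env x (σ.put a m n) :=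
  h.frame (s := .store a (.lit 0) (.lit 0)) rfl ⟨fun _ _ => rfl, fun u hu => by
    simp only [Stmt.touches, decide_eq_false_iff_not] at hu
    simp [State.put, Ne.symm hu], fun _ _ => put_len .., fun _ _ => put_width .., fun _ => rfl⟩

theorem Env.of_eq {σ σ' : State Var Arr} (h : Env x σ)
    (hv : ∀ v, v ≠ .p → v ≠ .c → v ≠ .d → σ'.vars v = σ.vars v) (ha : σ'.arr = σ.arr) :
    Env x σ' := by
  refine ⟨?_, ?_, ?_, ?_, ?_, ?_, ?_, ?_, ?_, ?_, ?_, ?_⟩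
  · rw [hv _ (by decide) (by decide) (by decide), h.x_eq]
  · rw [hv _ (by decide) (by decide) (by decide), h.r_eq]
  · rw [hv _ (by decide) (by decide) (by decide), h.L_eq]
  · rw [hv _ (by decide) (by decide) (by decide), h.W_eq]
  · rw [hv _ (by decide) (by decide) (by decide), h.Delta_eq]
  · rw [hv _ (by decide) (by decide) (by decide), h.M_eq]
  all_goals rw [ha]
  exacts [h.list_len, h.list_width, h.plen_len, h.plen_width, h.ptr_len, h.ptr_width]

theorem WordOk.size_cube_lt_cap (h : WordOk x w) : x.size * x.size * x.size < cap w := by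
  have h1 := size_le_self x
  have h2 : x.size * x.size * x.size ≤ x * x * x := by gcongr
  have h3 := h.le_cap
  have h4 : 100 * (x + 1) ^ 3 = 100 * (x * x * x) + 300 * (x * x) + 300 * x + 100 := by ring
  omega

/-- The number of gaps and of large gaps. -/
structure GapCounts (x : ℕ) (σ : State Var Arr) : Prop extends Env x σ where
  out_eq : σ.out = []
  gap_len : (σ.arr .gap).len = 0
  big_len : (σ.arr .big).len = 0
  ngap_eq : σ.vars .ngap = gapCount x
  nbig_eq : σ.vars .nbig = bigCount x (gapCount x)

theorem runs_countGaps (h : WordOk x w) {σ : State Var Arr} (hE : Env x σ) (ho : σ.out = [])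
    (hg : (σ.arr .gap).len = 0) (hb : (σ.arr .big).len = 0) :
    Runs w countGaps σ fun σ' t => GapCounts x σ' ∧ t ≤ 300 * (x + 1) := by
  have c0 := h.lt_cap_of_le le_rfl
  have c3 := h.size_cube_lt_cap
  have hx := h.pos
  have hs := size_le_self x
  have c2 : x.size * x.size < cap w := h.mul_lt_cap (by omega) (by omega)
  have hsq := Nat.sqrt_le_self x
  unfold countGaps
  refine Runs.seq (Runs.assign 0 (by simp; omega) (by simp) ?_)
  refine Runs.seq (Runs.assign 0 (by simp; omega) (by simp) ?_)
  refine (runs_scanPrimes h (fun j σ => Env x σ ∧ σ.out = [] ∧ (σ.arr .gap).len = 0 ∧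
    (σ.arr .big).len = 0 ∧ σ.vars .ngap = j ∧ σ.vars .nbig = bigCount x j) 50 rfl rfl ?_ ?_
    (by simp [hE.r_eq]) ?_).mono ?_
  · rintro j σ σ' hv ha ho ⟨h1, h2, h3, h4, h5, h6⟩
    refine ⟨h1.of_eq hv ha, ho.trans h2, by rw [ha, h3], by rw [ha, h4], ?_, ?_⟩
    · rw [hv _ (by decide) (by decide) (by decide), h5]
    · rw [hv _ (by decide) (by decide) (by decide), h6]
  · rintro j σ ⟨h1, h2, h3, h4, h5, h6⟩ hp hc hj
    have hjx := gapCount_le x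
    have hbj := bigCount_le x j
    have hcx := oddPrime_le_iff.2 hj
    have hlt := oddPrime_lt_succ j
    refine Runs.seq (Runs.assign (j + 1) (by simp; omega) (by simp [h5]) ?_)
    refine Runs.ite (by simp [h1.L_eq, hp, hc]; omega) ?_ ?_
    · intro hz
      simp [h1.L_eq, hp, hc] at hz
      refine Runs.assign (bigCount x j + 1) (by simp; omega) (by simp [h6]) ?_
      have hz' : BigGap x j := by unfold BigGap; omega
      refine ⟨⟨h1.setVar.setVar, ?_⟩, ?_⟩
      · simp [h2, h3, h4, bigCount_succ_of j hz']
      · simp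
    · intro hz
      simp [h1.L_eq, hp, hc] at hz
      have hz' : ¬BigGap x j := by unfold BigGap; omega
      refine Runs.skip ?_
      refine ⟨⟨h1.setVar, ?_⟩, ?_⟩
      · simp [h2, h3, h4, h6, bigCount_succ_of_not j hz']
      · simp
  · refine ⟨hE.setVar.setVar, ?_⟩
    simp [ho, hg, hb, bigCount]
  · rintro σ' t - ⟨⟨h1, h2, h3, h4, h5, h6⟩, ht⟩
    refine ⟨⟨h1, h2, h3, h4, h5, h6⟩, ?_⟩
    simp only [cost_lit]
    omega

/-- The compressed list of the odd primes up to `√x`. -/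
structure Gaps (x : ℕ) (σ : State Var Arr) : Prop where
  ngap_eq : σ.vars .ngap = gapCount x
  gap_len : (σ.arr .gap).len = gapCount x
  gap_width : (σ.arr .gap).width = 3 * x.size.size
  big_len : (σ.arr .big).len = 2 * bigCount x (gapCount x)
  big_width : (σ.arr .big).width = x.size
  gap_big : ∀ j < gapCount x, BigGap x j → (σ.arr .gap).data j = 0
  gap_small : ∀ j < gapCount x, ¬BigGap x j →
    (σ.arr .gap).data j = (oddPrime (j + 1) - oddPrime j) / 2
  big_data : ∀ j < gapCount x, BigGap x j →
    (σ.arr .big).data (2 * bigCount x j + 1) = oddPrime (j + 1)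

/-- A small gap is at most `L ^ 3`, and `L < 2 ^ W`; hence cells of `3 W` bits. -/
theorem half_gap_lt {j : ℕ} (h : ¬BigGap x j) :
    (oddPrime (j + 1) - oddPrime j) / 2 < 2 ^ (3 * x.size.size) := by
  have h1 : x.size * x.size * x.size < 2 ^ (3 * x.size.size) := by
    have h2 := Nat.lt_size_self x.size
    have h3 : (2 : ℕ) ^ (3 * x.size.size) =
        2 ^ x.size.size * 2 ^ x.size.size * 2 ^ x.size.size := by ring
    rw [h3]
    gcongr
  unfold BigGap at h
  omega

/-- `bigCount x j` is the position in the overflow list on reaching gap `j`, and its strict growth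
at large gaps keeps the entries apart. Only the odd cells of `big` enter the invariant, since
`nextPrime` never reads the even ones. -/
theorem runs_storeGaps (h : WordOk x w) {σ : State Var Arr} (hE : GapCounts x σ) :
    Runs w storeGaps σ fun σ' t =>
      Env x σ' ∧ Gaps x σ' ∧ σ'.out = [] ∧ t ≤ 400 * (x + 1) := by
  have c0 := h.lt_cap_of_le le_rfl
  have c3 := h.size_cube_lt_cap
  have hx := h.pos
  have hs := size_le_self x
  have hss := size_le_self x.size
  have c2 : x.size * x.size < cap w := h.mul_lt_cap (by omega) (by omega)
  have hsq := Nat.sqrt_le_self x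
  have hjx := gapCount_le x
  have hbx := bigCount_le x (gapCount x)
  have hw := h.size_le
  have hx2 : x < 2 ^ x.size := Nat.lt_size_self x
  unfold storeGaps
  refine Runs.seq (Runs.alloc (gapCount x) (3 * x.size.size) (by simp) (by simp [hE.ngap_eq])
    (by simp [hE.W_eq]; omega) (by simp [hE.W_eq]) hE.gap_len (by omega) ?_)
  refine Runs.seq (Runs.alloc (2 * bigCount x (gapCount x)) x.size (by simp [hE.nbig_eq]; omega)
    (by simp [hE.nbig_eq]) (by simp) (by simp [hE.L_eq]) (by simp [hE.big_len]) (by omega) ?_)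
  refine Runs.seq (Runs.assign 0 (by simp; omega) (by simp) ?_)
  refine Runs.seq (Runs.assign 0 (by simp; omega) (by simp) ?_)
  refine (runs_scanPrimes h (fun j σ => Env x σ ∧ σ.out = [] ∧ σ.vars .j = j ∧
    σ.vars .k = bigCount x j ∧ σ.vars .ngap = gapCount x ∧
    (σ.arr .gap).len = gapCount x ∧ (σ.arr .gap).width = 3 * x.size.size ∧
    (σ.arr .big).len = 2 * bigCount x (gapCount x) ∧ (σ.arr .big).width = x.size ∧
    (∀ i < j, BigGap x i → (σ.arr .gap).data i = 0) ∧
    (∀ i < j, ¬BigGap x i → (σ.arr .gap).data i = (oddPrime (i + 1) - oddPrime i) / 2) ∧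
    (∀ i < j, BigGap x i → (σ.arr .big).data (2 * bigCount x i + 1) = oddPrime (i + 1)))
    60 rfl rfl ?_ ?_ (by simp [hE.r_eq]) ?_).mono ?_
  · rintro j σ σ' hv ha ho ⟨h1, h2, h3, h4, h5, h6⟩
    refine ⟨h1.of_eq hv ha, ho.trans h2, ?_, ?_, ?_, by rwa [ha]⟩
    · rw [hv _ (by decide) (by decide) (by decide), h3]
    · rw [hv _ (by decide) (by decide) (by decide), h4]
    · rw [hv _ (by decide) (by decide) (by decide), h5]
  · rintro j σ ⟨h1, h2, h3, h4, h5, h6, h7, h8, h9, h10, h11, h12⟩ hp hc hj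
    have hbj := bigCount_mono x hj.le
    have hcx := oddPrime_le_iff.2 hj
    have hlt := oddPrime_lt_succ j
    refine Runs.seq (Runs.ite (by simp [h1.L_eq, hp, hc]; omega) ?_ ?_)
    · intro hz
      simp [h1.L_eq, hp, hc] at hz
      have hz' : BigGap x j := by unfold BigGap; omega
      have hbl := bigCount_lt hj hz'
      refine Runs.seq (Runs.store j 0 (by simp) (by simp [h3]) (by simp; omega) (by simp)
        (by omega) (by positivity) ?_)
      refine Runs.seq (Runs.store (2 * bigCount x j) (oddPrime j) (by simp [h4]; omega)
        (by simp [h4]) (by simp) (by simp [hp]) (by simp; omega) (by simp [h9]; omega) ?_)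
      refine Runs.seq (Runs.store (2 * bigCount x j + 1) (oddPrime (j + 1)) (by simp [h4]; omega)
        (by simp [h4]) (by simp) (by simp [hc]) (by simp; omega) (by simp [h9]; omega) ?_)
      refine Runs.assign (bigCount x j + 1) (by simp [h4]; omega) (by simp [h4]) ?_
      refine Runs.assign (j + 1) (by simp [h3]; omega) (by simp [h3]) ?_
      refine ⟨⟨h1.put.put.put.setVar.setVar, by simp [h2], by simp,
        by simp [bigCount_succ_of j hz'], by simp [h5], by simp [h6], by simp [h7], by simp [h8],
        by simp [h9], ?_, ?_, ?_⟩, by simp⟩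
      · intro i hi hib
        simp only [setVar_arr, put_data, reduceCtorEq, false_and, if_false, true_and]
        split_ifs with hij
        · rfl
        · exact h10 i (by omega) hib
      · intro i hi hib
        simp only [setVar_arr, put_data, reduceCtorEq, false_and, if_false, true_and]
        rw [if_neg (by rintro rfl; exact hib hz')]
        exact h11 i (lt_of_le_of_ne (by omega) (by rintro rfl; exact hib hz')) hib
      · intro i hi hib
        simp only [setVar_arr, put_data, reduceCtorEq, false_and, if_false, true_and]
        rcases Nat.eq_or_lt_of_le (Nat.lt_succ_iff.1 hi) with rfl | hij
        · simp
        · have := bigCount_lt hij hib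
          rw [if_neg (by omega), if_neg (by omega)]
          exact h12 i hij hib
    · intro hz
      simp [h1.L_eq, hp, hc] at hz
      have hz' : ¬BigGap x j := by unfold BigGap; omega
      have hhalf := half_gap_lt hz'
      refine Runs.store j ((oddPrime (j + 1) - oddPrime j) / 2) (by simp) (by simp [h3])
        (by simp [hp, hc]; omega) (by simp [hp, hc]) (by omega) (by rw [h7]; exact hhalf) ?_
      refine Runs.assign (j + 1) (by simp [h3]; omega) (by simp [h3]) ?_
      refine ⟨⟨h1.put.setVar, by simp [h2], by simp,
        by simp [bigCount_succ_of_not j hz', h4], by simp [h5], by simp [h6], by simp [h7],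
        by simp [h8], by simp [h9], ?_, ?_, ?_⟩, by simp⟩
      · intro i hi hib
        simp only [setVar_arr, put_data, true_and]
        rw [if_neg (by rintro rfl; exact hz' hib)]
        exact h10 i (lt_of_le_of_ne (by omega) (by rintro rfl; exact hz' hib)) hib
      · intro i hi hib
        simp only [setVar_arr, put_data, true_and]
        split_ifs with hij
        · rw [hij]
        · exact h11 i (by omega) hib
      · intro i hi hib
        simp only [setVar_arr, put_data, reduceCtorEq, false_and, if_false]
        exact h12 i (lt_of_le_of_ne (by omega) (by rintro rfl; exact hz' hib)) hib
  · refine ⟨Env.setVar (Env.setVar ?_), by simp [hE.out_eq], by simp, by simp [bigCount],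
      by simp [hE.ngap_eq], by simp, by simp, by simp, by simp, fun i hi => by omega,
      fun i hi => by omega, fun i hi => by omega⟩
    -- Here `storeGaps` merely serves as a statement that allocates `gap` and `big` and no other
    -- array.
    refine hE.toEnv.frame (s := storeGaps) rfl ⟨fun _ _ => rfl, ?_, ?_, ?_, fun _ => rfl⟩ <;>
    · intro a ha
      cases a <;> first | rfl | cases ha
  · rintro σ' t - ⟨⟨h1, h2, h3, h4, h5, h6, h7, h8, h9, h10, h11, h12⟩, ht⟩
    refine ⟨h1, ⟨h5, h6, h7, h8, h9, h10, h11, h12⟩, h2, ?_⟩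
    simp only [cost_lit, cost_mul, cost_var]
    omega

end Gaps
-- Appending to and reading from a packed list.
section Cells

/-- The pointers of list `i` describe the packed list `l`. -/
def PtrOk (x : ℕ) (σ : State Var Arr) (i : ℕ) (l : List ℕ) : Prop :=
  ∀ l₁ p l₂, l = l₁ ++ p :: l₂ →
    (σ.arr .ptr).data (i * ptrCount x + l₁.length) = packBits (l₁ ++ [p])

/-- List `i` of the segment holds the odd primes `l`. -/
structure Cell (x : ℕ) (σ : State Var Arr) (i : ℕ) (l : List ℕ) : Prop where
  plen_eq : (σ.arr .plen).data i = l.length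
  list_eq : (σ.arr .list).data i = pack l
  ptr_ok : PtrOk x σ i l

theorem Cell.of_arr {x : ℕ} {σ σ' : State Var Arr} {i : ℕ} {l : List ℕ} (h : Cell x σ i l)
    (ha : ∀ a, a ≠ .gap → a ≠ .big → σ'.arr a = σ.arr a) : Cell x σ' i l := by
  refine ⟨?_, ?_, ?_⟩
  · rw [ha _ (by decide) (by decide), h.plen_eq]
  · rw [ha _ (by decide) (by decide), h.list_eq]
  · intro l₁ p l₂ hl
    rw [ha _ (by decide) (by decide), h.ptr_ok l₁ p l₂ hl]

theorem PtrOk.append {x : ℕ} {σ : State Var Arr} {i p : ℕ} {l : List ℕ} (h : PtrOk x σ i l)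
    (hp : (σ.arr .ptr).data (i * ptrCount x + l.length) = packBits (l ++ [p])) :
    PtrOk x σ i (l ++ [p]) := by
  intro l₁ q l₂ hl
  rcases List.eq_nil_or_concat l₂ with rfl | ⟨l₃, a, rfl⟩
  · obtain ⟨rfl, h2⟩ := List.append_inj' hl rfl
    simp only [List.cons.injEq, and_true] at h2
    rw [← h2, hp]
  · rw [List.concat_eq_append, ← List.cons_append, ← List.append_assoc] at hl
    exact h l₁ q l₃ (List.append_inj' hl rfl).1

variable {x w : ℕ}

theorem WordOk.two_pow_size_lt (h : WordOk x w) {n : ℕ} (hn : n ≤ x.size) : 2 ^ n < cap w := by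
  have := two_le_size h.pos
  have := h.size_le
  exact Nat.pow_lt_pow_right (by norm_num) (by omega)

/-- Row-major addressing: this gives both the range check for `ptr` and, with `s` another row index,
the disjointness of the pointer rows of different integers. -/
theorem index_lt {i m s k : ℕ} (hi : i < s) (hk : k < m) : i * m + k < s * m := by
  calc i * m + k < (i + 1) * m := by rw [Nat.succ_mul]; omega
    _ ≤ s * m := Nat.mul_le_mul_right _ hi

theorem runs_findLeft (h : WordOk x w) {σ : State Var Arr} (hE : Env x σ) {i : ℕ}
    {l l₁ l₂ : List ℕ} (hi : σ.vars .i = i) (hix : i < segLen x) (hl : l = l₁ ++ l₂)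
    (hpos : σ.vars .pos = l₁.length) (hM : l₁.length ≤ ptrCount x) (hp : PtrOk x σ i l) :
    Runs w findLeft σ fun σ' t => σ' = σ.setVar .left (packBits l₁) ∧ t ≤ 15 := by
  have c0 := h.lt_cap_of_le le_rfl
  have hx := h.pos
  have hDM := segLen_mul_ptrCount_le hx
  unfold findLeft
  refine Runs.ite (by simp; omega) ?_ ?_
  · intro hz
    simp [hpos] at hz
    rcases List.eq_nil_or_concat l₁ with rfl | ⟨l₀, p, rfl⟩
    · simp at hz
    · have h1 := hp l₀ p l₂ (by simp [hl])
      simp at hM hpos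
      have h2 := index_lt hix (show l₀.length < ptrCount x by omega)
      have h3 : i * ptrCount x + (l₀.length + 1) - 1 = i * ptrCount x + l₀.length := by omega
      refine Runs.assign (packBits (l₀ ++ [p])) ?_ ?_ ⟨by simp, by simp⟩
      · simp [hi, hE.M_eq, hpos, hE.ptr_len]
        omega
      · simp only [val_get, val_sub, val_add, val_mul, val_var, val_lit, hi, hE.M_eq, hpos]
        rw [h3, h1]
  · intro hz
    simp [hpos] at hz
    exact Runs.assign 0 (by simp; omega) (by simp) ⟨by simp [hz], by simp⟩

/-- The bounds on `l` are the capacities of the three cells written: `hM` for the pointer row,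
`hbits` for the packed list and the end position, `hlen` for the counter. -/
theorem runs_addPrime (h : WordOk x w) {σ : State Var Arr} (hE : Env x σ) {i p : ℕ}
    {l : List ℕ} (hi : σ.vars .i = i) (hix : i < segLen x) (hp : σ.vars .p = p) (hpx : p ≤ x)
    (hb : σ.vars .b = Nat.size (p / 2)) (hc : Cell x σ i l) (hM : l.length < ptrCount x)
    (hbits : packBits (l ++ [p]) < x.size) (hlen : l.length < x.size) :
    Runs w addPrime σ fun σ' t => Cell x σ' i (l ++ [p]) ∧
      (∀ i' l', i' ≠ i → l'.length ≤ ptrCount x → Cell x σ i' l' → Cell x σ' i' l') ∧ t ≤ 60 := by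
  have c0 := h.lt_cap_of_le le_rfl
  have hx := h.pos
  have hDM := segLen_mul_ptrCount_le hx
  have hL := Nat.lt_size_self x.size
  have hsx := size_le_self x
  have hidx := index_lt hix hM
  have hpk := pack_or_shiftLeft l p
  have hpk' : pack (l ++ [p]) < 2 ^ x.size :=
    (pack_lt _).trans (Nat.pow_lt_pow_right (by norm_num) hbits)
  have hcap := h.two_pow_size_lt le_rfl
  have hshift : (p >>> 1) <<< packBits l < cap w := by
    refine lt_of_le_of_lt ?_ (hpk'.trans hcap)
    rw [← hpk]
    exact Nat.right_le_or
  have hbits' : packBits (l ++ [p]) = packBits l + Nat.size (p / 2) := by simp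
  have hp1 : p >>> 1 ≤ p := by rw [Nat.shiftRight_one]; omega
  unfold addPrime
  refine Runs.seq (Runs.assign l.length (by simp [hi, hE.plen_len, hix]) (by simp [hi, hc.plen_eq]) ?_)
  refine Runs.seq (Runs.store i (l.length + 1) (by simp) (by simp [hi]) (by simp; omega) (by simp)
    (by simp [hE.plen_len, hix]) (by simp [hE.plen_width]; omega) ?_)
  refine Runs.seq ((runs_findLeft h (l := l) (l₁ := l) (l₂ := []) hE.setVar.put (by simp [hi]) hix
    (by simp) (by simp) hM.le ?_).mono ?_)
  · intro l₁ q l₂ hl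
    simp only [put_data, setVar_arr, reduceCtorEq, false_and, if_false]
    exact hc.ptr_ok l₁ q l₂ hl
  rintro _ t - ⟨rfl, ht⟩
  refine Runs.seq (Runs.store i (pack (l ++ [p])) (by simp) (by simp [hi]) ?_ ?_
    (by simp [hE.list_len, hix]) (by simp [hE.list_width, hpk']) ?_)
  · simp [hi, hE.list_len, hix, hp, hc.list_eq, hpk]
    omega
  · simp [hi, hp, hc.list_eq, hpk]
  refine Runs.store (i * ptrCount x + l.length) (packBits (l ++ [p])) ?_ ?_ ?_ ?_ ?_ ?_ ?_
  · simp [hi, hE.M_eq]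
    omega
  · simp [hi, hE.M_eq]
  · simp [hb]
    omega
  · simp [hb]
  · simp [hE.ptr_len, hidx]
  · simp only [put_width, setVar_arr, hE.ptr_width]
    omega
  refine ⟨⟨by simp, by simp, PtrOk.append (fun l₁ q l₂ hl => ?_) (by simp)⟩,
    fun i' l' hne hl' hc' => ⟨?_, ?_, fun l₁ q l₂ hl => ?_⟩, ?_⟩
  · simp only [put_data, setVar_arr, reduceCtorEq, false_and, if_false, true_and]
    have : l.length = l₁.length + (l₂.length + 1) := by rw [hl]; simp
    rw [if_neg (by omega)]
    exact hc.ptr_ok l₁ q l₂ hl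
  · simp [hne, hc'.plen_eq]
  · simp [hne, hc'.list_eq]
  · simp only [put_data, setVar_arr, reduceCtorEq, false_and, if_false, true_and]
    have h1 : l'.length = l₁.length + (l₂.length + 1) := by rw [hl]; simp
    rw [if_neg, hc'.ptr_ok l₁ q l₂ hl]
    intro heq
    rcases lt_or_gt_of_ne hne with hlt | hlt
    · have := index_lt hlt (show l₁.length < ptrCount x by omega)
      omega
    · have := index_lt hlt hM
      omega
  · simp
    omega

/-- Consecutive end positions differ by the length of `p / 2`, so shift and mask isolate `p / 2`.
Oddness of `p` is what permits restoring the last bit as 1. -/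
theorem runs_getPrime (h : WordOk x w) {σ : State Var Arr} (hE : Env x σ) {i p : ℕ}
    {l l₁ l₂ : List ℕ} (hi : σ.vars .i = i) (hix : i < segLen x) (hc : Cell x σ i l)
    (hl : l = l₁ ++ p :: l₂) (hpos : σ.vars .pos = l₁.length) (hM : l.length ≤ ptrCount x)
    (hbits : packBits l < x.size) (hp : p % 2 = 1) (hpx : p ≤ x) :
    Runs w getPrime σ fun σ' t => σ'.vars .f = p ∧ t ≤ 50 := by
  have c0 := h.lt_cap_of_le le_rfl
  have hx := h.pos
  have hDM := segLen_mul_ptrCount_le hx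
  have hlen : l.length = l₁.length + (l₂.length + 1) := by rw [hl]; simp
  have hidx := index_lt hix (show l₁.length < ptrCount x by omega)
  have hcap := h.two_pow_size_lt le_rfl
  have hpk : pack l < 2 ^ x.size :=
    (pack_lt _).trans (Nat.pow_lt_pow_right (by norm_num) hbits)
  have hptr : (σ.arr .ptr).data (i * ptrCount x + l₁.length) = packBits l₁ + Nat.size (p / 2) := by
    rw [hc.ptr_ok l₁ p l₂ hl]; simp
  have hsz : Nat.size (p / 2) ≤ x.size := by
    rw [hl] at hbits; simp at hbits; omega
  have h2 := h.two_pow_size_lt hsz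
  have hsx := size_le_self x
  have hsr : pack l >>> packBits l₁ ≤ pack l := by
    rw [Nat.shiftRight_eq_div_pow]; exact Nat.div_le_self _ _
  have hand := pack_append_cons_shiftRight l₁ l₂ p
  rw [← hl] at hand
  have hor : (p / 2) <<< 1 ||| 1 = p := by
    rw [← Nat.shiftLeft_add_eq_or_of_lt (by norm_num), Nat.shiftLeft_eq]; omega
  have hsh : (p / 2) <<< 1 ≤ p := by rw [Nat.shiftLeft_eq]; omega
  unfold getPrime
  refine Runs.seq ((runs_findLeft h hE hi hix hl hpos (by omega) hc.ptr_ok).mono ?_)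
  rintro _ t - ⟨rfl, ht⟩
  refine Runs.seq (Runs.assign (pack l >>> packBits l₁) ?_ ?_ ?_)
  · simp [hi, hE.list_len, hix, hc.list_eq]
    omega
  · simp [hi, hc.list_eq]
  refine Runs.seq (Runs.assign (p / 2) ?_ ?_ ?_)
  · have h3 : 1 <<< Nat.size (p / 2) = 2 ^ Nat.size (p / 2) := by simp [Nat.shiftLeft_eq]
    have h4 : 1 ≤ 2 ^ Nat.size (p / 2) := Nat.one_le_two_pow
    simp [hi, hE.M_eq, hpos, hE.ptr_len, hidx, hptr, h3, hand]
    omega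
  · simp [hi, hE.M_eq, hpos, hptr, Nat.shiftLeft_eq, hand]
  refine Runs.assign p ?_ ?_ ⟨by simp, ?_⟩
  · simp [hor]
    omega
  · simp [hor]
  · simp
    omega

end Cells
-- Sieving one segment.
section Sieve

variable {x w : ℕ}

theorem Gaps.frame {σ σ' : State Var Arr} {s : Stmt Var Arr} (h : Gaps x σ)
    (hf : Frame s σ σ') (hn : s.writes .ngap = false := by rfl)
    (hg : s.touches .gap = false := by rfl) (hb : s.touches .big = false := by rfl) :
    Gaps x σ' := by
  have h1 := hf.vars _ hn
  have h2 := hf.arr _ hg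
  have h3 := hf.arr _ hb
  constructor
  · rw [h1, h.ngap_eq]
  · rw [h2, h.gap_len]
  · rw [h2, h.gap_width]
  · rw [h3, h.big_len]
  · rw [h3, h.big_width]
  · rw [h2]; exact h.gap_big
  · rw [h2]; exact h.gap_small
  · rw [h3]; exact h.big_data

/-- The mark 0 is unambiguous, because two distinct odd primes differ by at least 2 and have a
positive half-gap; doubling recovers the gap exactly since it is even. -/
theorem runs_nextPrime (h : WordOk x w) {σ : State Var Arr} (hE : Env x σ) (hG : Gaps x σ)
    {j : ℕ} (hp : σ.vars .p = oddPrime j) (hj : σ.vars .j = j) (hk : σ.vars .k = bigCount x j) :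
    Runs w nextPrime σ fun σ' t => t ≤ 50 ∧
      (j < gapCount x → σ'.vars .p = oddPrime (j + 1) ∧ σ'.vars .j = j + 1 ∧
        σ'.vars .k = bigCount x (j + 1)) ∧
      (gapCount x ≤ j → σ'.vars .p = x.sqrt + 1) := by
  have c0 := h.lt_cap_of_le le_rfl
  have hx := h.pos
  have hsq := Nat.sqrt_le_self x
  have hg := gapCount_le x
  have hbx := bigCount_le x (gapCount x)
  unfold nextPrime
  refine Runs.ite (by simp; omega) ?_ ?_
  · intro hz
    simp [hj, hG.ngap_eq] at hz
    have hle := oddPrime_le_iff.2 hz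
    have hlt := oddPrime_lt_succ j
    have h3 := three_le_oddPrime j
    have ho1 := oddPrime_mod_two j
    have ho2 := oddPrime_mod_two (j + 1)
    refine Runs.seq (Runs.ite (by simp [hj, hG.gap_len, hz]; omega) ?_ ?_)
    · intro hz'
      simp [hj] at hz'
      have hbig : BigGap x j := by
        by_contra hbig
        rw [hG.gap_small j hz hbig] at hz'
        omega
      have hbl := bigCount_lt hz hbig
      refine Runs.seq (Runs.assign (oddPrime (j + 1)) ?_ ?_ ?_)
      · simp [hk, hG.big_len]; omega
      · simp [hk, hG.big_data j hz hbig]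
      refine Runs.assign (bigCount x j + 1) (by simp [hk]; omega) (by simp [hk]) ?_
      refine Runs.assign (j + 1) (by simp [hj]; omega) (by simp [hj]) ?_
      refine ⟨by simp, fun _ => ⟨by simp, by simp, by simp [bigCount_succ_of j hbig]⟩,
        fun h => by omega⟩
    · intro hz'
      simp [hj] at hz'
      have hbig : ¬BigGap x j := fun hbig => hz' (hG.gap_big j hz hbig)
      have hd := hG.gap_small j hz hbig
      refine Runs.assign (oddPrime (j + 1)) ?_ ?_ ?_
      · simp [hj, hp, hG.gap_len, hz, hd]; omega
      · simp [hj, hp, hd]; omega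
      refine Runs.assign (j + 1) (by simp [hj]; omega) (by simp [hj]) ?_
      refine ⟨by simp, fun _ => ⟨by simp, by simp, by simp [bigCount_succ_of_not j hbig, hk]⟩,
        fun h => by omega⟩
  · intro hz
    simp [hj, hG.ngap_eq] at hz
    refine Runs.assign (x.sqrt + 1) (by simp [hE.r_eq]; omega) (by simp [hE.r_eq]) ?_
    exact ⟨by simp, fun h => by omega, fun _ => by simp⟩

theorem runs_clearAll (h : WordOk x w) {σ : State Var Arr} (hE : Env x σ) :
    Runs w clearAll σ fun σ' t => (∀ i < segLen x, Cell x σ' i []) ∧ t ≤ 20 * segLen x + 20 := by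
  have c0 := h.lt_cap_of_le le_rfl
  have hx := h.pos
  have hseg := segLen_le x
  have hsq := Nat.sqrt_le_self x
  unfold clearAll
  refine Runs.seq (Runs.assign 0 (by simp; omega) (by simp) ?_)
  refine Runs.loop (fun σ => ∀ i < σ.vars .i, Cell x σ i [])
    (fun σ => 20 * (segLen x - σ.vars .i)) (by simp) ?_ ?_ ?_
  · intro σ' _ _
    simp; omega
  · intro σ' hf hI hz
    have hE' : Env x σ' := hE.setVar.frame rfl hf
    simp [hE'.Delta_eq] at hz
    refine Runs.seq (Runs.store (σ'.vars .i) 0 (by simp) (by simp) (by simp; omega) (by simp)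
      (by rw [hE'.list_len]; exact hz) (by positivity) ?_)
    refine Runs.seq (Runs.store (σ'.vars .i) 0 (by simp) (by simp) (by simp; omega) (by simp)
      (by rw [put_len, hE'.plen_len]; exact hz) (by positivity) ?_)
    refine Runs.assign (σ'.vars .i + 1) (by simp; omega) (by simp) ⟨?_, by simp; omega⟩
    intro i hi
    simp only [setVar_vars, if_true] at hi
    refine ⟨?_, ?_, fun l₁ p l₂ hl => by simp at hl⟩
    · simp only [setVar_arr, put_data, true_and]
      split_ifs with hii
      · rfl
      · rfl
      · exact (hI i (by omega)).plen_eq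
    · simp only [setVar_arr, put_data, true_and, reduceCtorEq, false_and, if_false]
      split_ifs with hii
      · rfl
      · exact (hI i (by omega)).list_eq
  · intro σ' t hf hI hz ht
    have hE' : Env x σ' := hE.setVar.frame rfl hf
    simp [hE'.Delta_eq] at hz
    simp at ht
    exact ⟨fun i hi => hI i (by omega), by simp only [cost_lit]; omega⟩

/-- A bound for the number of steps spent on sieving `[x₁, x₂)` with the primes from `p` on. -/
def sieveWork (x x₁ x₂ p : ℕ) : ℕ :=
  ∑ p' ∈ (Finset.Icc p x.sqrt).filter Nat.Prime,
    (200 + 100 * ((Finset.Ico x₁ x₂).filter (p' ∣ ·)).card)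

/-- Passing from `p` to a larger `p'` releases the summand of `p`, which pays for processing `p`: a
fixed amount and a share for each multiple. -/
theorem sieveWork_step {x₁ x₂ p p' : ℕ} (hp : p.Prime) (hpr : p ≤ x.sqrt) (hpp : p < p') :
    sieveWork x x₁ x₂ p' + (200 + 100 * ((Finset.Ico x₁ x₂).filter (p ∣ ·)).card) ≤
      sieveWork x x₁ x₂ p := by
  have hnot : p ∉ (Finset.Icc p' x.sqrt).filter Nat.Prime := by
    simp only [Finset.mem_filter, Finset.mem_Icc]; omega
  unfold sieveWork
  rw [add_comm, ← Finset.sum_insert (f := fun p' => 200 + 100 *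
    ((Finset.Ico x₁ x₂).filter (p' ∣ ·)).card) hnot]
  refine Finset.sum_le_sum_of_subset fun q hq => ?_
  simp only [Finset.mem_insert, Finset.mem_filter, Finset.mem_Icc] at hq ⊢
  rcases hq with rfl | ⟨⟨h1, h2⟩, h3⟩
  · exact ⟨⟨le_rfl, hpr⟩, hp⟩
  · exact ⟨⟨by omega, h2⟩, h3⟩

/-- The variables `x1`, `x2` delimit a segment. -/
structure Seg (x : ℕ) (σ : State Var Arr) (x₁ x₂ : ℕ) : Prop where
  x1_eq : σ.vars .x1 = x₁
  x2_eq : σ.vars .x2 = x₂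
  one_le : 1 ≤ x₁
  lt : x₁ < x₂
  le : x₂ ≤ x + 1
  le_add : x₂ ≤ x₁ + segLen x

theorem Seg.frame {σ σ' : State Var Arr} {s : Stmt Var Arr} {x₁ x₂ : ℕ} (h : Seg x σ x₁ x₂)
    (hf : Frame s σ σ') (h1 : s.writes .x1 = false := by rfl)
    (h2 : s.writes .x2 = false := by rfl) : Seg x σ' x₁ x₂ :=
  ⟨(hf.vars _ h1).trans h.x1_eq, (hf.vars _ h2).trans h.x2_eq, h.one_le, h.lt, h.le, h.le_add⟩

/-- The lists of the segment hold the odd prime divisors below `p`. -/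
def Cells (x : ℕ) (σ : State Var Arr) (x₁ x₂ p : ℕ) : Prop :=
  ∀ i, x₁ + i < x₂ → Cell x σ i (oddPrimes (x₁ + i) p)

theorem length_oddPrimes_lt_ptrCount {n : ℕ} (hn : n ≠ 0) (hnx : n ≤ x) (p : ℕ) :
    (oddPrimes n p).length < ptrCount x := by
  have := length_oddPrimes_le_div hn (lt_of_le_of_lt hnx (Nat.lt_size_self x)) p
  unfold ptrCount
  omega

theorem length_oddPrimes_lt_size {n : ℕ} (hn : n ≠ 0) (hnx : n ≤ x) (p : ℕ) :
    (oddPrimes n p).length < x.size := by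
  refine lt_of_le_of_lt ?_ (packBits_oddPrimes_lt hn (lt_of_le_of_lt hnx (Nat.lt_size_self x)) p)
  have : ∀ l : List ℕ, (∀ q ∈ l, 2 ≤ q) → l.length ≤ packBits l := by
    intro l
    induction l with
    | nil => simp
    | cons a l ih =>
      intro hl
      have h1 := ih fun q hq => hl q (List.mem_cons_of_mem _ hq)
      have h2 : 0 < Nat.size (a / 2) := Nat.size_pos.2 (by
        have := hl a List.mem_cons_self; omega)
      simp only [List.length_cons, packBits_cons]
      omega
  exact this _ fun q hq => (mem_oddPrimes.1 hq).2.1.two_le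

theorem runs_sievePrime (h : WordOk x w) {σ : State Var Arr} (hE : Env x σ) {x₁ x₂ p : ℕ}
    (hS : Seg x σ x₁ x₂) (hp : σ.vars .p = p) (hpp : p.Prime) (hp2 : p ≠ 2) (hpr : p ≤ x)
    (hb : σ.vars .b = Nat.size (p / 2)) (hq : σ.vars .q = x₁ + (p - x₁ % p) % p)
    (hC : Cells x σ x₁ x₂ p) :
    Runs w (.loop (rd .q <ₑ rd .x2) (
      .i ::= rd .q - rd .x1 ;;
      addPrime ;;
      .q ::= rd .q + rd .p)) σ fun σ' t =>
        Cells x σ' x₁ x₂ (p + 1) ∧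
          t ≤ 100 * ((Finset.Ico x₁ x₂).filter (p ∣ ·)).card + 4 := by
  have c0 := h.lt_cap_of_le le_rfl
  have hx := h.pos
  obtain ⟨-, -, s3, s4, s5, s6⟩ := id hS
  have hppos := hpp.pos
  have hmod := Nat.mod_lt x₁ hppos
  -- The start is the first multiple of `p` not below `x₁`; the outer remainder matters when `p`
  -- already divides `x₁`.
  have hdvd0 : p ∣ x₁ + (p - x₁ % p) % p := by
    rw [Nat.dvd_iff_mod_eq_zero, Nat.add_mod, Nat.mod_mod, ← Nat.add_mod]
    have h1 : x₁ + (p - x₁ % p) = p * (x₁ / p + 1) := by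
      have := Nat.div_add_mod x₁ p
      rw [Nat.mul_succ]; omega
    rw [h1, Nat.mul_mod_right]
  have hltp : (p - x₁ % p) % p < p := Nat.mod_lt _ hppos
  -- Integers below `q` are finished for `p`, the others still have the lists of the primes below
  -- `p`. Non-multiples change sides without any work, as their list is the same for `p` and `p +
  -- 1`.
  refine Runs.loop (fun σ => p ∣ σ.vars .q ∧ x₁ ≤ σ.vars .q ∧ σ.vars .q ≤ 2 * x + 1 ∧
      ∀ i, x₁ + i < x₂ → Cell x σ i (oddPrimes (x₁ + i) (if x₁ + i < σ.vars .q then p + 1 else p)))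
    (fun σ => 100 * ((Finset.Ico (σ.vars .q) x₂).filter (p ∣ ·)).card) ?_ ?_ ?_ ?_
  · refine ⟨hq ▸ hdvd0, by omega, by omega, fun i hi => ?_⟩
    split_ifs with hlt
    · rw [oddPrimes_succ_of_not]
      · exact hC i hi
      · rintro ⟨-, hdvd⟩
        rw [hq] at hlt
        have h1 : p ∣ (x₁ + (p - x₁ % p) % p) - (x₁ + i) := Nat.dvd_sub hdvd0 hdvd
        have h2 := Nat.le_of_dvd (by omega) h1
        omega
    · exact hC i hi
  · intro σ' _ _
    simp; omega
  · rintro σ₁ hf ⟨hqd, hq1, hq2, hI⟩ hz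
    have hS₁ : Seg x σ₁ x₁ x₂ := Seg.frame hS hf
    have hE₁ : Env x σ₁ := hE.frame rfl hf
    have hp₁ : σ₁.vars .p = p := (hf.vars _ rfl).trans hp
    have hb₁ : σ₁.vars .b = Nat.size (p / 2) := (hf.vars _ rfl).trans hb
    simp [hS₁.x2_eq] at hz
    clear hf
    set q := σ₁.vars .q with hqdef
    have hcell := hI (q - x₁) (by omega)
    rw [show x₁ + (q - x₁) = q by omega, if_neg (lt_irrefl q)] at hcell
    have hsucc := oddPrimes_succ_of_dvd hpp hp2 hqd
    have hbits := packBits_oddPrimes_lt (n := q) (by omega)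
      (lt_of_le_of_lt (show q ≤ x by omega) (Nat.lt_size_self x)) (p + 1)
    rw [hsucc] at hbits
    refine Runs.seq (Runs.assign (q - x₁) (by simp [hS₁.x1_eq]; omega) (by simp [hS₁.x1_eq, hqdef]) ?_)
    refine Runs.seq ((runs_addPrime h (i := q - x₁) (p := p) hE₁.setVar (by simp) (by omega)
      (by simp [hp₁]) hpr (by simp [hb₁]) (hcell.of_arr fun _ _ _ => rfl)
      (length_oddPrimes_lt_ptrCount (by omega) (by omega) p) hbits
      (length_oddPrimes_lt_size (by omega) (by omega) p)).mono ?_)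
    rintro σ₂ t hf ⟨hc₂, hoth, ht⟩
    have hq₂ : σ₂.vars .q = q := (hf.vars _ rfl).trans (by simp [hqdef])
    have hp₂ : σ₂.vars .p = p := (hf.vars _ rfl).trans (by simp [hp₁])
    clear hf
    refine Runs.assign (q + p) (by simp [hq₂, hp₂]; omega) (by simp [hq₂, hp₂]) ?_
    simp only [setVar_vars, if_true]
    refine ⟨⟨dvd_add hqd dvd_rfl, by omega, by omega, fun i hi => ?_⟩, ?_⟩
    · refine Cell.of_arr (σ := σ₂) ?_ fun _ _ _ => rfl
      rcases lt_trichotomy (x₁ + i) q with hlt | heq | hgt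
      · rw [if_pos (by omega)]
        refine hoth i _ (by omega) (length_oddPrimes_lt_ptrCount (by omega) (by omega) _).le ?_
        have := hI i hi
        rw [if_pos hlt] at this
        exact this.of_arr fun _ _ _ => rfl
      · rw [if_pos (by omega), heq, hsucc, show i = q - x₁ by omega]
        exact hc₂
      · have hci := hI i hi
        rw [if_neg (by omega)] at hci
        have hci₂ := hoth i _ (by omega) (length_oddPrimes_lt_ptrCount (by omega) (by omega) _).le
          (hci.of_arr fun _ _ _ => rfl)
        split_ifs with hlt
        · rw [oddPrimes_succ_of_not]
          · exact hci₂
          · rintro ⟨-, hdvd⟩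
            have h1 : p ∣ (x₁ + i) - q := Nat.dvd_sub hdvd hqd
            have h2 := Nat.le_of_dvd (by omega) h1
            omega
        · exact hci₂
    · have hcard : ((Finset.Ico (q + p) x₂).filter (p ∣ ·)).card + 1 ≤
          ((Finset.Ico q x₂).filter (p ∣ ·)).card := by
        refine Finset.card_lt_card ⟨?_, ?_⟩
        · intro m hm
          simp only [Finset.mem_filter, Finset.mem_Ico] at hm ⊢
          exact ⟨⟨by omega, hm.1.2⟩, hm.2⟩
        · intro hsub
          have : q ∈ (Finset.Ico (q + p) x₂).filter (p ∣ ·) :=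
            hsub (by simp only [Finset.mem_filter, Finset.mem_Ico]; exact ⟨⟨le_rfl, hz⟩, hqd⟩)
          simp only [Finset.mem_filter, Finset.mem_Ico] at this
          omega
      simp
      omega
  · rintro σ₁ t hf ⟨hqd, hq1, hq2, hI⟩ hz ht
    have hx2 : σ₁.vars .x2 = x₂ := (hf.vars _ rfl).trans hS.x2_eq
    simp [hx2] at hz
    refine ⟨fun i hi => ?_, ?_⟩
    · have := hI i hi
      rwa [if_pos (by omega)] at this
    · have hcard : ((Finset.Ico (σ.vars .q) x₂).filter (p ∣ ·)).card ≤
          ((Finset.Ico x₁ x₂).filter (p ∣ ·)).card := by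
        refine Finset.card_le_card fun m hm => ?_
        simp only [Finset.mem_filter, Finset.mem_Ico] at hm ⊢
        exact ⟨⟨by omega, hm.1.2⟩, hm.2⟩
      simp at ht
      omega

theorem runs_sieveSegment (h : WordOk x w) {σ : State Var Arr} (hE : Env x σ) (hG : Gaps x σ)
    {x₁ x₂ : ℕ} (hS : Seg x σ x₁ x₂) (hC : ∀ i < segLen x, Cell x σ i []) :
    Runs w sieveSegment σ fun σ' t => Cells x σ' x₁ x₂ (x.sqrt + 1) ∧
      t ≤ sieveWork x x₁ x₂ 3 + 20 * x.size + 50 := by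
  have c0 := h.lt_cap_of_le le_rfl
  have hx := h.pos
  have hsq := Nat.sqrt_le_self x
  have hsx := size_le_self x
  unfold sieveSegment
  refine Runs.seq (Runs.assign 3 (by simp; omega) (by simp) ?_)
  refine Runs.seq (Runs.assign 0 (by simp; omega) (by simp) ?_)
  refine Runs.seq (Runs.assign 0 (by simp; omega) (by simp) ?_)
  refine Runs.seq (Runs.assign 1 (by simp; omega) (by simp) ?_)
  -- The alternative `p = 3` is needed for `x = 3`, where `√x + 1 = 2` and the loop is never
  -- entered. The bound on `b` is an inequality, because it is left over from the previous prime and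
  -- adjusted at the start of a pass.
  refine Runs.loop (fun σ => (σ.vars .p ≤ x.sqrt → ∃ j, σ.vars .p = oddPrime j ∧
      σ.vars .j = j ∧ σ.vars .k = bigCount x j ∧ σ.vars .b ≤ Nat.size (σ.vars .p / 2)) ∧
      (σ.vars .p ≤ x.sqrt + 1 ∨ σ.vars .p = 3) ∧ Cells x σ x₁ x₂ (σ.vars .p))
    -- Over the increasing primes `b` never decreases, so updating it costs `O(L)` per segment
    -- altogether rather than per prime.
    (fun σ => sieveWork x x₁ x₂ (σ.vars .p) + 20 * (x.size - σ.vars .b)) ?_ ?_ ?_ ?_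
  · refine ⟨fun _ => ⟨0, by simp [oddPrime_zero], by simp, by simp [bigCount], ?_⟩, by simp, ?_⟩
    · simp
    · simp only [setVar_vars, reduceCtorEq, if_false, if_true]
      intro i hi
      rw [oddPrimes_eq_nil _ le_rfl]
      exact (hC i (by have := hS.le_add; omega)).of_arr fun _ _ _ => rfl
  · intro σ' _ _
    simp; omega
  · rintro σ₁ hf ⟨hI1, -, hI3⟩ hz
    have hS₁ : Seg x σ₁ x₁ x₂ := by
      refine Seg.frame ?_ hf
      exact ⟨by simp [hS.x1_eq], by simp [hS.x2_eq], hS.one_le, hS.lt, hS.le, hS.le_add⟩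
    have hE₁ : Env x σ₁ := hE.setVar.setVar.setVar.setVar.frame rfl hf
    have hG₁ : Gaps x σ₁ := by
      refine Gaps.frame ?_ hf
      exact ⟨by simp [hG.ngap_eq], hG.gap_len, hG.gap_width, hG.big_len, hG.big_width, hG.gap_big,
        hG.gap_small, hG.big_data⟩
    clear hf
    simp [hE₁.r_eq] at hz
    obtain ⟨j, hpj, hj, hk, hb⟩ := hI1 hz
    have hlt := oddPrime_lt_succ j
    have hpp := oddPrime_prime j
    have hp3 := three_le_oddPrime j
    rw [hpj] at hb hz hI3
    have hsz : Nat.size (oddPrime j / 2) ≤ x.size := Nat.size_le_size (by omega)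
    have s1 := hS.one_le
    have s2 := hS.lt
    have s3 := hS.le
    refine Runs.seq (Q := fun σ' t => _) (Runs.mono (Runs.loop
      (Q := fun σ' t => σ'.vars .b = Nat.size (oddPrime j / 2) ∧
        t + 20 * (x.size - σ'.vars .b) ≤ 20 * (x.size - σ₁.vars .b) + 8)
      (fun σ' => σ'.vars .b ≤ Nat.size (oddPrime j / 2)) (fun σ' => 20 * (x.size - σ'.vars .b))
      hb ?_ ?_ ?_) ?_)
    · intro σ' hf hI
      have hp' : σ'.vars .p = oddPrime j := (hf.vars _ rfl).trans hpj
      have h1 := h.two_pow_size_lt (hI.trans hsz)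
      have h2 : oddPrime j >>> 1 ≤ oddPrime j := by rw [Nat.shiftRight_one]; omega
      have h3 : 1 <<< σ'.vars .b = 2 ^ σ'.vars .b := by simp [Nat.shiftLeft_eq]
      simp [hp', h3]
      omega
    · intro σ' hf hI hz'
      have hp' : σ'.vars .p = oddPrime j := (hf.vars _ rfl).trans hpj
      have h3 : 1 <<< σ'.vars .b = 2 ^ σ'.vars .b := by simp [Nat.shiftLeft_eq]
      simp [hp', h3, Nat.shiftRight_one] at hz'
      have h4 := Nat.lt_size.2 hz'
      refine Runs.assign (σ'.vars .b + 1) (by simp; omega) (by simp) ?_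
      simp
      omega
    · intro σ' t hf hI hz' ht
      have hp' : σ'.vars .p = oddPrime j := (hf.vars _ rfl).trans hpj
      have h3 : 1 <<< σ'.vars .b = 2 ^ σ'.vars .b := by simp [Nat.shiftLeft_eq]
      simp [hp', h3, Nat.shiftRight_one] at hz'
      have h4 := Nat.size_le.2 hz'
      simp at ht
      exact ⟨le_antisymm hI h4, by omega⟩
    rintro σ₂ t₂ hf ⟨hb₂, ht₂⟩
    have hS₂ : Seg x σ₂ x₁ x₂ := hS₁.frame hf
    have hE₂ : Env x σ₂ := hE₁.frame rfl hf
    have hG₂ : Gaps x σ₂ := hG₁.frame hf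
    have hp₂ : σ₂.vars .p = oddPrime j := (hf.vars _ rfl).trans hpj
    have hj₂ : σ₂.vars .j = j := (hf.vars _ rfl).trans hj
    have hk₂ : σ₂.vars .k = bigCount x j := (hf.vars _ rfl).trans hk
    have hI₂ : Cells x σ₂ x₁ x₂ (oddPrime j) := fun i hi =>
      (hI3 i hi).of_arr fun a _ _ => hf.arr a rfl
    clear hf
    have hmod := Nat.mod_lt x₁ hpp.pos
    have hmod' := Nat.mod_lt (oddPrime j - x₁ % oddPrime j) hpp.pos
    refine Runs.seq (Runs.assign (x₁ + (oddPrime j - x₁ % oddPrime j) % oddPrime j) ?_ ?_ ?_)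
    · simp [hS₂.x1_eq, hp₂]
      omega
    · simp [hS₂.x1_eq, hp₂]
    refine Runs.seq ((runs_sievePrime h (p := oddPrime j) hE₂.setVar
      (x₁ := x₁) (x₂ := x₂) ⟨by simp [hS₂.x1_eq], by simp [hS₂.x2_eq], s1, s2, s3, hS.le_add⟩
      (by simp [hp₂]) hpp (by omega) (by omega) (by simp [hb₂]) (by simp)
      fun i hi => (hI₂ i hi).of_arr fun _ _ _ => rfl).mono ?_)
    rintro σ₃ t₃ hf ⟨hC₃, ht₃⟩
    have hE₃ : Env x σ₃ := hE₂.setVar.frame rfl hf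
    have hG₃ : Gaps x σ₃ := by
      refine Gaps.frame (σ := _) ?_ hf
      exact ⟨by simp [hG₂.ngap_eq], hG₂.gap_len, hG₂.gap_width, hG₂.big_len, hG₂.big_width,
        hG₂.gap_big, hG₂.gap_small, hG₂.big_data⟩
    have hp₃ : σ₃.vars .p = oddPrime j := (hf.vars _ rfl).trans (by simp [hp₂])
    have hj₃ : σ₃.vars .j = j := (hf.vars _ rfl).trans (by simp [hj₂])
    have hk₃ : σ₃.vars .k = bigCount x j := (hf.vars _ rfl).trans (by simp [hk₂])
    have hb₃ : σ₃.vars .b = Nat.size (oddPrime j / 2) := (hf.vars _ rfl).trans (by simp [hb₂])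
    clear hf
    refine (runs_nextPrime h hE₃ hG₃ hp₃ hj₃ hk₃).mono ?_
    rintro σ₄ t₄ hf ⟨ht₄, hn1, hn2⟩
    have hb₄ : σ₄.vars .b = Nat.size (oddPrime j / 2) := (hf.vars _ rfl).trans hb₃
    -- No prime lies strictly between consecutive odd primes, so the lists already agree with those
    -- for the new value of `p`. The range of `p'` also includes the final sentinel `√x + 1`.
    have hC₄ : ∀ p', oddPrime j < p' → p' ≤ oddPrime (j + 1) → Cells x σ₄ x₁ x₂ p' := by
      intro p' h1 h2 i hi
      rw [oddPrimes_eq_of_forall_not_prime (p := oddPrime j + 1) h1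
        fun q h3 h4 => not_prime_of_between h3 (by omega)]
      exact (hC₃ i hi).of_arr fun a _ _ => hf.arr a (by cases a <;> rfl)
    clear hf
    have hlt₄ : oddPrime j < σ₄.vars .p := by
      rcases lt_or_ge j (gapCount x) with hjg | hjg
      · rw [(hn1 hjg).1]; exact hlt
      · rw [hn2 hjg]; omega
    have hwork := sieveWork_step (x := x) (x₁ := x₁) (x₂ := x₂) hpp hz hlt₄
    refine ⟨⟨fun hle => ?_, ?_, ?_⟩, ?_⟩
    · rcases lt_or_ge j (gapCount x) with hjg | hjg
      · obtain ⟨h1, h2, h3⟩ := hn1 hjg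
        refine ⟨j + 1, h1, h2, h3, ?_⟩
        rw [hb₄, h1]
        exact Nat.size_le_size (by omega)
      · rw [hn2 hjg] at hle; omega
    · rcases lt_or_ge j (gapCount x) with hjg | hjg
      · rw [(hn1 hjg).1]
        exact Or.inl ((oddPrime_le_iff.2 hjg).trans (by omega))
      · exact Or.inl (hn2 hjg).le
    · refine hC₄ _ hlt₄ ?_
      rcases lt_or_ge j (gapCount x) with hjg | hjg
      · exact (hn1 hjg).1.le
      · rw [hn2 hjg]
        have := mt (oddPrime_le_iff (x := x) (j := j)).1 (by omega)
        omega
    · simp only [hpj, hb₄, cost_bin, cost_var, cost_add, cost_sub, cost_mod] at *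
      rw [hb₂] at ht₂
      omega
  · rintro σ₁ t hf ⟨hI1, hI2, hI3⟩ hz ht
    have hr : σ₁.vars .r = x.sqrt := by
      rw [hf.vars _ rfl]; simp [hE.r_eq]
    simp [hr] at hz
    clear hf
    refine ⟨fun i hi => ?_, ?_⟩
    · have := hI3 i hi
      rcases hI2 with h2 | h2
      · rwa [show σ₁.vars .p = x.sqrt + 1 by omega] at this
      · rw [h2, oddPrimes_eq_nil _ le_rfl] at this
        rwa [oddPrimes_eq_nil _ (by omega)]
    · simp at ht
      simp only [cost_lit]
      omega

end Sieve
-- Writing the factorizations of one segment.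
section Output

open ArithmeticFunction (cardFactors)

/-- `e` is a sorted list of primes and `y` the cofactor of its product in `n`. -/
structure Split (n y : ℕ) (e : List ℕ) : Prop where
  prod_mul : e.prod * y = n
  prime : ∀ a ∈ e, a.Prime
  sorted : e.Pairwise (· ≤ ·)

theorem Split.append {n y f : ℕ} {e : List ℕ} (h : Split n (f * y) e) (hf : f.Prime)
    (hle : ∀ a ∈ e, a ≤ f) : Split n y (e ++ [f]) := by
  refine ⟨?_, ?_, ?_⟩
  · rw [← h.prod_mul]; simp; ring
  · intro a ha
    rcases List.mem_append.1 ha with ha | ha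
    · exact h.prime a ha
    · rw [List.mem_singleton.1 ha]; exact hf
  · rw [List.pairwise_append]
    exact ⟨h.sorted, by simp, by simpa using hle⟩

theorem Split.eq_primeFactorsList {n : ℕ} {e : List ℕ} (h : Split n 1 e) :
    e = n.primeFactorsList :=
  (Nat.primeFactorsList_unique (by rw [← h.prod_mul, mul_one]) h.prime).eq_of_pairwise'
    h.sorted (Nat.primeFactorsList_sorted n).pairwise

theorem cardFactors_prime_mul {f y : ℕ} (hf : f.Prime) (hy : y ≠ 0) :
    cardFactors (f * y) = cardFactors y + 1 := by
  rw [ArithmeticFunction.cardFactors_mul hf.ne_zero hy,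
    ArithmeticFunction.cardFactors_apply_prime hf, add_comm]

variable {x w : ℕ}

/-- Dividing `y` by the prime `f` as often as possible. -/
theorem runs_divideOut (h : WordOk x w) {g : Expr Var Arr} {σ : State Var Arr} {f n y : ℕ}
    {o e : List ℕ} (hg : ∀ σ' : State Var Arr, σ'.vars .f = σ.vars .f → g.Ok w σ' ∧ g.val σ' = f)
    (hgc : g.cost = 1) (hf : f.Prime) (hy : σ.vars .y = y) (hy0 : 0 < y) (hyx : y ≤ x)
    (ho : σ.out = o ++ e) (hs : Split n y e) (hle : ∀ a ∈ e, a ≤ f) :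
    Runs w (.loop (rd .y % g =ₑ 0) (.emit g ;; .y ::= rd .y / g)) σ fun σ' t =>
      ∃ y' e', σ'.vars .y = y' ∧ σ'.out = o ++ e' ∧ 0 < y' ∧ y' ∣ y ∧ ¬f ∣ y' ∧ Split n y' e' ∧
        (∀ a ∈ e', a ∈ e ∨ a = f) ∧ t + 20 * cardFactors y' ≤ 20 * cardFactors y + 10 := by
  have c0 := h.lt_cap_of_le le_rfl
  have hx := h.pos
  have hf2 := hf.two_le
  refine Runs.loop (fun σ' => ∃ y' e', σ'.vars .y = y' ∧ σ'.out = o ++ e' ∧ 0 < y' ∧ y' ∣ y ∧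
      Split n y' e' ∧ (∀ a ∈ e', a ≤ f) ∧ (∀ a ∈ e', a ∈ e ∨ a = f))
    -- Each division removes one prime factor of `y`, so the steps are paid by `Ω(y)`.
    (fun σ' => 20 * cardFactors (σ'.vars .y)) ?_ ?_ ?_ ?_
  · exact ⟨y, e, hy, ho, hy0, dvd_rfl, hs, hle, fun a ha => Or.inl ha⟩
  · rintro σ' hfr ⟨y', e', h1, h2, h3, h4, -⟩
    -- The divisor `g` is either the literal 2 or the variable `f`; the loop does not assign `f`, so
    -- the value of `g` is constant.
    obtain ⟨g1, g2⟩ := hg σ' (hfr.vars _ rfl)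
    have h5 := Nat.le_of_dvd hy0 h4
    have h6 := Nat.mod_le y' f
    simp [g1, g2, h1]
    omega
  · rintro σ' hfr ⟨y', e', h1, h2, h3, h4, h5, h6, h7⟩ hz
    obtain ⟨g1, g2⟩ := hg σ' (hfr.vars _ rfl)
    simp [h1, g2] at hz
    obtain ⟨m, rfl⟩ := Nat.dvd_of_mod_eq_zero hz
    have hm : 0 < m := Nat.pos_of_mul_pos_left h3
    have hmd : f * m / f = m := Nat.mul_div_cancel_left m hf.pos
    have hmx := Nat.le_of_dvd hy0 h4
    have hmm : m ≤ f * m := Nat.le_mul_of_pos_left m hf.pos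
    refine Runs.seq (Runs.emit f g1 g2 ?_)
    obtain ⟨g3, g4⟩ := hg ⟨σ'.vars, σ'.arr, σ'.out ++ [f]⟩ (hfr.vars _ rfl)
    refine Runs.assign m (by simp [g3, g4, h1, hmd]; omega) (by simp [g4, h1, hmd]) ?_
    refine ⟨⟨m, e' ++ [f], by simp, by simp [h2], hm, (dvd_mul_left m f).trans h4,
      h5.append hf h6, ?_, ?_⟩, ?_⟩
    · intro a ha
      rcases List.mem_append.1 ha with ha | ha
      · exact h6 a ha
      · rw [List.mem_singleton.1 ha]
    · intro a ha
      rcases List.mem_append.1 ha with ha | ha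
      · exact h7 a ha
      · exact Or.inr (List.mem_singleton.1 ha)
    · simp [h1, cardFactors_prime_mul hf hm.ne', hgc]
      omega
  · rintro σ' t hfr ⟨y', e', h1, h2, h3, h4, h5, h6, h7⟩ hz ht
    obtain ⟨g1, g2⟩ := hg σ' (hfr.vars _ rfl)
    simp [h1, g2] at hz
    refine ⟨y', e', h1, h2, h3, h4, fun hd => hz (Nat.mod_eq_zero_of_dvd hd), h5, h7, ?_⟩
    simp [h1, hy, hgc] at ht
    omega

/-- Writing the prime factors of `n` that are in its list. -/
theorem runs_emitList (h : WordOk x w) {σ : State Var Arr} (hE : Env x σ) {i n y : ℕ}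
    {o e l : List ℕ} (hi : σ.vars .i = i) (hix : i < segLen x) (hn : n ≠ 0) (hnx : n ≤ x)
    (hl : l = oddPrimes n (x.sqrt + 1)) (hc : Cell x σ i l) (hpos : σ.vars .pos = 0)
    (hy : σ.vars .y = y) (hy0 : 0 < y) (hyn : y ∣ n) (hy2 : ¬2 ∣ y) (ho : σ.out = o ++ e)
    (hs : Split n y e) (he : ∀ a ∈ e, a = 2) :
    Runs w (.loop (rd .pos <ₑ .get .plen (rd .i)) (
      getPrime ;;
      .loop (rd .y % rd .f =ₑ 0) (
        .emit (rd .f) ;;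
        .y ::= rd .y / rd .f) ;;
      .pos ::= rd .pos + 1)) σ fun σ' t =>
        ∃ y' e', σ'.vars .y = y' ∧ σ'.out = o ++ e' ∧ 0 < y' ∧ y' ∣ n ∧ ¬2 ∣ y' ∧
          (∀ b ∈ l, ¬b ∣ y') ∧ Split n y' e' ∧ (∀ a ∈ e', a = 2 ∨ a ∈ l) ∧
          t + 20 * cardFactors y' ≤ 20 * cardFactors y + 100 * l.length + 20 := by
  have c0 := h.lt_cap_of_le le_rfl
  have hx := h.pos
  have hsx := size_le_self x
  have hlM := length_oddPrimes_lt_ptrCount hn hnx (x.sqrt + 1)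
  have hlL := length_oddPrimes_lt_size hn hnx (x.sqrt + 1)
  have hbits := packBits_oddPrimes_lt hn (lt_of_le_of_lt hnx (Nat.lt_size_self x)) (x.sqrt + 1)
  have hlp := oddPrimes_pairwise n (x.sqrt + 1)
  have hmem : ∀ a ∈ l, a.Prime ∧ a ≠ 2 ∧ a ∣ n := fun a ha => (mem_oddPrimes.1 (hl ▸ ha)).2
  rw [← hl] at hlM hlL hbits hlp
  refine Runs.loop (fun σ' => ∃ y' e' l₁ l₂, l = l₁ ++ l₂ ∧ σ'.vars .pos = l₁.length ∧
      σ'.vars .y = y' ∧ σ'.out = o ++ e' ∧ 0 < y' ∧ y' ∣ n ∧ ¬2 ∣ y' ∧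
      (∀ b ∈ l₁, ¬b ∣ y') ∧ Split n y' e' ∧ (∀ a ∈ e', a = 2 ∨ a ∈ l₁))
    (fun σ' => 20 * cardFactors (σ'.vars .y) + 100 * (l.length - σ'.vars .pos)) ?_ ?_ ?_ ?_
  · exact ⟨y, e, [], l, rfl, by simp [hpos], hy, ho, hy0, hyn, hy2, by simp, hs,
      fun a ha => Or.inl (he a ha)⟩
  · intro σ' hf _
    have hE' := hE.frame rfl hf
    have hi' : σ'.vars .i = i := (hf.vars _ rfl).trans hi
    simp [hi', hE'.plen_len, hix]
    omega
  · rintro σ₁ hf ⟨y₁, e₁, l₁, l₂, h1, h2, h3, h4, h5, h6, h7, h8, h9, h10⟩ hz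
    have hE₁ : Env x σ₁ := hE.frame rfl hf
    have hi₁ : σ₁.vars .i = i := (hf.vars _ rfl).trans hi
    have hc₁ : Cell x σ₁ i l := hc.of_arr fun a _ _ => hf.arr a rfl
    clear hf
    simp [hi₁, hc₁.plen_eq, h2] at hz
    obtain ⟨p, l₃, rfl⟩ : ∃ p l₃, l₂ = p :: l₃ := by
      cases l₂ with
      | nil => rw [h1] at hz; simp at hz
      | cons p l₃ => exact ⟨p, l₃, rfl⟩
    obtain ⟨hp, hp2, hpn⟩ := hmem p (by rw [h1]; simp)
    have hpx : p ≤ x := (Nat.le_of_dvd (Nat.pos_of_ne_zero hn) hpn).trans hnx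
    have hp1 : p % 2 = 1 := hp.eq_two_or_odd.resolve_left hp2
    refine Runs.seq ((runs_getPrime h hE₁ hi₁ hix hc₁ h1 h2 hlM.le hbits hp1 hpx).mono ?_)
    rintro σ₂ t₂ hf ⟨hf₂, ht₂⟩
    have hy₂ : σ₂.vars .y = y₁ := (hf.vars _ rfl).trans h3
    have hpos₂ : σ₂.vars .pos = l₁.length := (hf.vars _ rfl).trans h2
    have ho₂ : σ₂.out = o ++ e₁ := (hf.out rfl).trans h4
    clear hf
    rw [h1, List.pairwise_append] at hlp
    have hle : ∀ a ∈ e₁, a ≤ p := fun a ha => (h10 a ha).elim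
      (fun h => h ▸ hp.two_le) fun h => (hlp.2.2 a h p List.mem_cons_self).le
    refine Runs.seq ((runs_divideOut h (f := p) (y := y₁) (fun σ' hσ => ⟨by simp, by simp [hσ, hf₂]⟩)
      (by simp) hp hy₂ h5 ((Nat.le_of_dvd (Nat.pos_of_ne_zero hn) h6).trans hnx) ho₂ h9 hle).mono ?_)
    rintro σ₃ t₃ hf ⟨y₃, e₃, g1, g2, g3, g4, g5, g6, g7, g8⟩
    have hpos₃ : σ₃.vars .pos = l₁.length := (hf.vars _ rfl).trans hpos₂
    clear hf
    refine Runs.assign (l₁.length + 1) (by simp [hpos₃]; omega) (by simp [hpos₃]) ?_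
    refine ⟨⟨y₃, e₃, l₁ ++ [p], l₃, by simp [h1], by simp, by simp [g1], by simp [g2], g3,
      g4.trans h6, fun hd => h7 (hd.trans g4), ?_, g6, ?_⟩, ?_⟩
    · intro b hb hd
      rcases List.mem_append.1 hb with hb | hb
      · exact h8 b hb (hd.trans g4)
      · rw [List.mem_singleton.1 hb] at hd
        exact g5 hd
    · intro a ha
      rcases g7 a ha with ha | rfl
      · rcases h10 a ha with ha | ha
        · exact Or.inl ha
        · exact Or.inr (List.mem_append_left _ ha)
      · simp
    · simp [g1, h2, h3]
      omega
  · rintro σ₁ t hf ⟨y₁, e₁, l₁, l₂, h1, h2, h3, h4, h5, h6, h7, h8, h9, h10⟩ hz ht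
    have hi₁ : σ₁.vars .i = i := (hf.vars _ rfl).trans hi
    have hc₁ : Cell x σ₁ i l := hc.of_arr fun a _ _ => hf.arr a rfl
    clear hf
    simp [hi₁, hc₁.plen_eq, h2] at hz
    obtain rfl : l₂ = [] := by
      rw [h1] at hz
      simpa using hz
    rw [List.append_nil] at h1
    subst h1
    refine ⟨y₁, e₁, h3, h4, h5, h6, h7, h8, h9, h10, ?_⟩
    simp [h3, hy, hpos] at ht
    omega

/-- Every prime factor of `y` exceeds `√x`, and two such factors would already make `y` larger than
`x`. -/
theorem prime_of_no_small_factor {n y : ℕ} (hnx : n ≤ x) (hn : n ≠ 0) (hyn : y ∣ n)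
    (hy1 : 1 < y) (hy2 : ¬2 ∣ y) (hy : ∀ b ∈ oddPrimes n (x.sqrt + 1), ¬b ∣ y) :
    y.Prime ∧ x.sqrt < y := by
  have key : ∀ p, p.Prime → p ∣ y → x.sqrt < p := by
    intro p hp hpy
    by_contra hle
    exact hy p (mem_oddPrimes.2 ⟨by omega, hp, by rintro rfl; exact hy2 hpy, hpy.trans hyn⟩) hpy
  have hm := key _ (Nat.minFac_prime hy1.ne') (Nat.minFac_dvd y)
  have hyx := (Nat.le_of_dvd (Nat.pos_of_ne_zero hn) hyn).trans hnx
  refine ⟨?_, lt_of_lt_of_le hm (Nat.minFac_le (by omega))⟩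
  by_contra hp
  have h1 := Nat.minFac_sq_le_self (by omega) hp
  have h2 := Nat.lt_succ_sqrt x
  have h3 : x.sqrt.succ * x.sqrt.succ ≤ y.minFac * y.minFac := Nat.mul_le_mul hm hm
  rw [sq] at h1
  omega

theorem factorizations_succ (n : ℕ) :
    factorizations (n + 1) = factorizations n ++ ((n + 1).primeFactorsList ++ [0]) := by
  rw [factorizations, List.range'_1_concat, List.flatMap_append, factorizations, add_comm]
  simp

theorem runs_outputSegment (h : WordOk x w) {σ : State Var Arr} (hE : Env x σ) {x₁ x₂ : ℕ}
    (hS : Seg x σ x₁ x₂) (hC : Cells x σ x₁ x₂ (x.sqrt + 1))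
    (ho : σ.out = factorizations (x₁ - 1)) :
    Runs w outputSegment σ fun σ' t => σ'.out = factorizations (x₂ - 1) ∧
      t ≤ ∑ n ∈ Finset.Ico x₁ x₂, (200 * cardFactors n + 200) + 20 := by
  have c0 := h.lt_cap_of_le le_rfl
  have hx := h.pos
  have s1 := hS.one_le
  have s2 := hS.lt
  have s3 := hS.le
  have s4 := hS.le_add
  unfold outputSegment
  refine Runs.seq (Runs.assign x₁ (by simp) (by simp [hS.x1_eq]) ?_)
  refine Runs.loop (fun σ => x₁ ≤ σ.vars .n ∧ σ.vars .n ≤ x₂ ∧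
      σ.out = factorizations (σ.vars .n - 1))
    (fun σ => ∑ n ∈ Finset.Ico (σ.vars .n) x₂, (200 * cardFactors n + 200)) ?_ ?_ ?_ ?_
  · simp [ho, s2.le]
  · intro σ' _ _
    simp; omega
  · rintro σ₁ hf ⟨h1, h2, h3⟩ hz
    have hE₁ : Env x σ₁ := hE.setVar.frame rfl hf
    have hS₁ : Seg x σ₁ x₁ x₂ := Seg.frame
      ⟨by simp [hS.x1_eq], by simp [hS.x2_eq], hS.one_le, hS.lt, hS.le, hS.le_add⟩ hf
    have hC₁ : Cells x σ₁ x₁ x₂ (x.sqrt + 1) := fun i hi =>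
      (hC i hi).of_arr fun a _ _ => hf.arr a rfl
    clear hf
    simp [hS₁.x2_eq] at hz
    set n := σ₁.vars .n with hn
    have hcell := hC₁ (n - x₁) (by omega)
    rw [show x₁ + (n - x₁) = n by omega] at hcell
    have hn0 : n ≠ 0 := by omega
    refine Runs.seq (Runs.assign (n - x₁) (by simp [hS₁.x1_eq]; omega) (by simp [hS₁.x1_eq, hn]) ?_)
    refine Runs.seq (Runs.assign n (by simp) (by simp [hn]) ?_)
    refine Runs.seq ((runs_divideOut h (f := 2) (y := n) (n := n) (o := factorizations (n - 1))
      (e := []) (fun σ' _ => ⟨by simp; omega, by simp⟩) (by simp) Nat.prime_two (by simp)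
      (by omega) (by omega) (by simp [h3]) ⟨by simp, by simp, by simp⟩ (by simp)).mono ?_)
    rintro σ₂ t₂ hf ⟨y, e, g1, g2, g3, g4, g5, g6, g7, g8⟩
    have hE₂ : Env x σ₂ := hE₁.setVar.setVar.frame rfl hf
    have hi₂ : σ₂.vars .i = n - x₁ := (hf.vars _ rfl).trans (by simp)
    have hn₂ : σ₂.vars .n = n := (hf.vars _ rfl).trans (by simp [hn])
    have hc₂ : Cell x σ₂ (n - x₁) (oddPrimes n (x.sqrt + 1)) :=
      hcell.of_arr fun a _ _ => hf.arr a rfl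
    clear hf
    refine Runs.seq (Runs.assign 0 (by simp; omega) (by simp) ?_)
    refine Runs.seq ((runs_emitList h (i := n - x₁) (n := n) (y := y) (e := e) hE₂.setVar
      (by simp [hi₂]) (by omega) hn0 (by omega) rfl (hc₂.of_arr fun _ _ _ => rfl) (by simp)
      (by simp [g1]) g3 g4 g5 g2 g6 (fun a ha => by simpa using g7 a ha)).mono ?_)
    rintro σ₃ t₃ hf ⟨y₃, e₃, k1, k2, k3, k4, k5, k6, k7, k8, k9⟩
    have hn₃ : σ₃.vars .n = n := (hf.vars _ rfl).trans (by simp [hn₂])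
    clear hf
    -- Extracting a prime from the list has a cost even apart from its divisions; this charges it to
    -- `Ω(n)` as well.
    have hlen : (oddPrimes n (x.sqrt + 1)).length ≤ cardFactors n := by
      rw [ArithmeticFunction.cardFactors_apply]
      exact length_oddPrimes_le_cardFactors hn0 _
    have hfac := factorizations_succ (n - 1)
    rw [show n - 1 + 1 = n by omega] at hfac
    have hy₃ := (Nat.le_of_dvd (Nat.pos_of_ne_zero hn0) k4).trans (show n ≤ x by omega)
    have hsum := Finset.sum_eq_sum_Ico_succ_bot hz fun n => 200 * cardFactors n + 200
    refine Runs.seq (Runs.ite (by simp; omega) ?_ ?_)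
    · intro hz'
      simp [k1] at hz'
      obtain ⟨hyp, hyr⟩ := prime_of_no_small_factor (by omega) hn0 k4 hz' k5 k6
      -- The cofactor may be appended last since it exceeds `√x`, and the listed primes do not;
      -- compared with 2 it suffices that `1 < y₃`.
      have hsplit : Split n 1 (e₃ ++ [y₃]) := by
        refine Split.append (by rwa [mul_one]) hyp fun a ha => ?_
        rcases k8 a ha with rfl | ha
        · exact hz'
        · have := (mem_oddPrimes.1 ha).1; omega
      refine Runs.emit y₃ (by simp) (by simp [k1]) ?_
      refine Runs.seq (Runs.emit 0 (by simp; omega) (by simp) ?_)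
      refine Runs.assign (n + 1) (by simp [hn₃]; omega) (by simp [hn₃]) ?_
      simp only [setVar_vars, if_true, setVar_out, k2, Nat.add_sub_cancel, hfac,
        ← hsplit.eq_primeFactorsList]
      refine ⟨⟨by omega, by omega, by simp⟩, ?_⟩
      simp
      omega
    · intro hz'
      simp [k1] at hz'
      have hy1 : y₃ = 1 := by omega
      rw [hy1] at k7
      refine Runs.skip ?_
      refine Runs.seq (Runs.emit 0 (by simp; omega) (by simp) ?_)
      refine Runs.assign (n + 1) (by simp [hn₃]; omega) (by simp [hn₃]) ?_
      simp only [setVar_vars, if_true, setVar_out, k2, Nat.add_sub_cancel, hfac,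
        ← k7.eq_primeFactorsList]
      refine ⟨⟨by omega, by omega, by simp⟩, ?_⟩
      simp
      omega
  · rintro σ₁ t hf ⟨h1, h2, h3⟩ hz ht
    have hx2 : σ₁.vars .x2 = x₂ := (hf.vars _ rfl).trans (by simp [hS.x2_eq])
    simp [hx2] at hz
    refine ⟨by rw [h3, show σ₁.vars .n = x₂ by omega], ?_⟩
    simp at ht
    simp only [cost_var]
    omega

end Output
-- The whole program: correctness and a combinatorial bound on the steps.
section Main

open ArithmeticFunction (cardFactors)

variable {x w : ℕ}

/-- Exchange the summations: instead of the multiples of each prime, count the primes dividing each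
`n`, at most `Ω(n)` of them. -/
theorem sieveWork_le {x₁ x₂ : ℕ} (h1 : 1 ≤ x₁) : sieveWork x x₁ x₂ 3 ≤
    200 * Nat.primeCounting x.sqrt + 100 * ∑ n ∈ Finset.Ico x₁ x₂, cardFactors n := by
  unfold sieveWork
  rw [Finset.sum_add_distrib, Finset.sum_const, smul_eq_mul, mul_comm _ 200, ← Finset.mul_sum]
  refine Nat.add_le_add (Nat.mul_le_mul_left _ ?_) (Nat.mul_le_mul_left _ ?_)
  · rw [← Nat.primesLE_card_eq_primeCounting]
    refine Finset.card_le_card fun p hp => ?_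
    simp only [Finset.mem_filter, Finset.mem_Icc] at hp
    exact Nat.mem_primesLE.2 ⟨hp.1.2, hp.2⟩
  · simp_rw [Finset.card_filter]
    rw [Finset.sum_comm]
    refine Finset.sum_le_sum fun n hn => ?_
    have hn0 : n ≠ 0 := by have := (Finset.mem_Ico.1 hn).1; omega
    rw [← Finset.card_filter, ArithmeticFunction.cardFactors_apply]
    refine le_trans (Finset.card_le_card (t := n.primeFactors) fun p hp => ?_)
      (List.toFinset_card_le _)
    simp only [Finset.mem_filter] at hp
    exact Nat.mem_primeFactors.2 ⟨hp.1.2, hp.2, hn0⟩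

/-- A bound for the number of steps spent on each segment, independently of its prime factors. -/
def segCost (x : ℕ) : ℕ :=
  20 * segLen x + 200 * Nat.primeCounting x.sqrt + 20 * x.size + 200

/-- A bound for the number of steps of the algorithm. -/
def timeBound (x : ℕ) : ℕ :=
  1500 * x + 300 * ∑ n ∈ Finset.Ico 1 (x + 1), cardFactors n + (x / segLen x + 1) * segCost x

theorem runs_factorSieve (h : WordOk x w) : Runs w factorSieve (input x) fun σ t =>
    Env x σ ∧ Gaps x σ ∧ σ.out = factorizations x ∧ t ≤ timeBound x := by
  have c0 := h.lt_cap_of_le le_rfl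
  have hx := h.pos
  have hD := segLen_le x
  have hD1 : 1 ≤ segLen x := Nat.le_add_left 1 _
  have hsq := Nat.sqrt_le_self x
  unfold factorSieve
  refine Runs.seq ((runs_setup h).mono ?_)
  rintro σ₁ t₁ - ⟨hE₁, ho₁, hg₁, hb₁, ht₁⟩
  refine Runs.seq ((runs_countGaps h hE₁ ho₁ hg₁ hb₁).mono ?_)
  rintro σ₂ t₂ - ⟨hG₂, ht₂⟩
  refine Runs.seq ((runs_storeGaps h hG₂).mono ?_)
  rintro σ₃ t₃ - ⟨hE₃, hG₃, ho₃, ht₃⟩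
  refine Runs.seq (Runs.assign 1 (by simp; omega) (by simp) ?_)
  refine Runs.loop (fun σ => Gaps x σ ∧ 1 ≤ σ.vars .x1 ∧ σ.vars .x1 ≤ x + 1 ∧
      σ.out = factorizations (σ.vars .x1 - 1))
    -- Of the coefficient 300, output uses 200 and sieving 100. The second term charges `segCost x`
    -- for each segment still to come, their number being rounded up.
    (fun σ => ∑ n ∈ Finset.Ico (σ.vars .x1) (x + 1), (300 * cardFactors n + 200) +
      (x + segLen x - σ.vars .x1) / segLen x * segCost x) ?_ ?_ ?_ ?_
  · refine ⟨⟨by simp [hG₃.ngap_eq], hG₃.gap_len, hG₃.gap_width, hG₃.big_len, hG₃.big_width,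
      hG₃.gap_big, hG₃.gap_small, hG₃.big_data⟩, by simp, by simp, by simp [ho₃, factorizations]⟩
  · intro σ _ _
    simp; omega
  · rintro σ hf ⟨hG, h1, h2, ho⟩ hz
    have hE : Env x σ := hE₃.setVar.frame rfl hf
    clear hf
    simp [hE.x_eq] at hz
    set x₁ := σ.vars .x1 with hx₁
    obtain ⟨x₂, hx₂⟩ : ∃ x₂, x₂ = min (x₁ + segLen x) (x + 1) := ⟨_, rfl⟩
    refine Runs.seq (Runs.assign (x₁ + segLen x) (by simp [hE.Delta_eq]; omega)
      (by simp [hE.Delta_eq, hx₁]) ?_)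
    refine Runs.seq (Runs.mono (Q := fun σ' t => Env x σ' ∧ Gaps x σ' ∧ Seg x σ' x₁ x₂ ∧
      σ'.out = σ.out ∧ t ≤ 20) ?_ ?_)
    · have hE' : Env x (σ.setVar .x2 (x₁ + segLen x)) := hE.setVar
      have hG' : Gaps x (σ.setVar .x2 (x₁ + segLen x)) :=
        ⟨by simp [hG.ngap_eq], hG.gap_len, hG.gap_width, hG.big_len, hG.big_width,
          hG.gap_big, hG.gap_small, hG.big_data⟩
      refine Runs.ite (by simp [hE.x_eq]; omega) ?_ ?_
      · intro hz'
        simp [hE.x_eq] at hz'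
        refine Runs.assign (x + 1) (by simp [hE.x_eq]; omega) (by simp [hE.x_eq]) ?_
        refine ⟨hE'.setVar, ⟨by simp [hG.ngap_eq], hG.gap_len, hG.gap_width, hG.big_len,
          hG.big_width, hG.gap_big, hG.gap_small, hG.big_data⟩,
          ⟨by simp [hx₁], by simp; omega, h1, by omega, by omega, by omega⟩, by simp, by simp⟩
      · intro hz'
        simp [hE.x_eq] at hz'
        exact Runs.skip ⟨hE', hG', ⟨by simp [hx₁], by simp; omega, h1, by omega, by omega, by omega⟩,
          by simp, by simp⟩
    rintro σ₄ t₄ - ⟨hE₄, hG₄, hS₄, ho₄, ht₄⟩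
    refine Runs.seq ((runs_clearAll h hE₄).mono ?_)
    rintro σ₅ t₅ hf ⟨hC₅, ht₅⟩
    have hE₅ := hE₄.frame rfl hf
    have hG₅ := hG₄.frame hf
    have hS₅ := hS₄.frame hf
    have ho₅ : σ₅.out = σ.out := (hf.out rfl).trans ho₄
    clear hf
    refine Runs.seq ((runs_sieveSegment h hE₅ hG₅ hS₅ hC₅).mono ?_)
    rintro σ₆ t₆ hf ⟨hC₆, ht₆⟩
    have hE₆ := hE₅.frame rfl hf
    have hG₆ := hG₅.frame hf
    have hS₆ := hS₅.frame hf
    have ho₆ : σ₆.out = σ.out := (hf.out rfl).trans ho₅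
    clear hf
    refine Runs.seq ((runs_outputSegment h hE₆ hS₆ hC₆ (ho₆.trans ho)).mono ?_)
    rintro σ₇ t₇ hf ⟨ho₇, ht₇⟩
    have hG₇ := hG₆.frame hf
    have hS₇ := hS₆.frame hf
    clear hf
    have hlt := hS₇.lt
    have hle := hS₇.le
    refine Runs.assign x₂ (by simp) (by simp [hS₇.x2_eq]) ?_
    simp only [setVar_vars, if_true, setVar_out]
    refine ⟨⟨⟨by simp [hG₇.ngap_eq], hG₇.gap_len, hG₇.gap_width, hG₇.big_len,
      hG₇.big_width, hG₇.gap_big, hG₇.gap_small, hG₇.big_data⟩, by omega, hle, ho₇⟩, ?_⟩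
    have hwork := sieveWork_le (x := x) (x₂ := x₂) h1
    have hsum := Finset.sum_Ico_consecutive (fun n => 300 * cardFactors n + 200) hlt.le hle
    have hsum' : ∑ n ∈ Finset.Ico x₁ x₂, (300 * cardFactors n + 200) =
        ∑ n ∈ Finset.Ico x₁ x₂, (200 * cardFactors n + 200) +
          100 * ∑ n ∈ Finset.Ico x₁ x₂, cardFactors n := by
      rw [Finset.mul_sum, ← Finset.sum_add_distrib]
      exact Finset.sum_congr rfl fun n _ => by ring
    -- A full segment lowers the quotient by exactly one. A shortened one ends at `x + 1`, where the
    -- quotient is 0.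
    have hdiv : (x + segLen x - x₂) / segLen x + 1 ≤ (x + segLen x - x₁) / segLen x := by
      rw [← Nat.add_div_right _ (by omega)]
      rcases le_total (x₁ + segLen x) (x + 1) with hc | hc
      · exact Nat.div_le_div_right (by omega)
      · rw [show x + segLen x - x₂ + segLen x = segLen x - 1 + segLen x by omega,
          Nat.add_div_right _ (by omega), Nat.div_eq_of_lt (by omega)]
        exact (Nat.one_le_div_iff (by omega)).2 (by omega)
    have hmul := Nat.mul_le_mul_right (segCost x) hdiv
    rw [Nat.succ_mul] at hmul
    have hsc : segCost x = 20 * segLen x + 200 * Nat.primeCounting x.sqrt + 20 * x.size + 200 := rfl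
    clear hx₂
    simp
    omega
  · rintro σ t hf ⟨hG, h1, h2, ho⟩ hz ht
    have hE : Env x σ := hE₃.setVar.frame rfl hf
    clear hf
    simp [hE.x_eq] at hz
    refine ⟨hE, hG, by rw [ho, show σ.vars .x1 = x + 1 by omega, Nat.add_sub_cancel], ?_⟩
    have hsum : ∑ n ∈ Finset.Ico 1 (x + 1), (300 * cardFactors n + 200) =
        300 * ∑ n ∈ Finset.Ico 1 (x + 1), cardFactors n + 200 * x := by
      rw [Finset.sum_add_distrib, Finset.mul_sum]; simp [mul_comm]
    have hdiv : (x + segLen x - 1) / segLen x ≤ x / segLen x + 1 := by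
      rw [← Nat.add_div_right _ (by omega)]
      exact Nat.div_le_div_right (by omega)
    have hmul := Nat.mul_le_mul_right (segCost x) hdiv
    simp only [setVar_vars, if_true, hsum, cost_bin, cost_var] at ht
    unfold timeBound
    simp only [cost_lit]
    omega

end Main
-- Chebyshev-type estimates, iterated logarithms, and the number of large gaps.
section Analysis

open Real
open ArithmeticFunction (cardFactors)

/-- The primes in `[2 ^ (l + 1), 2 ^ (l + 2))` have a product of at most `4 ^ (2 ^ (l + 2))`, so
there are at most `2 ^ (l + 3) / (l + 1)` of them and the block contributes at most `4 / (l + 1)`.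
-/
theorem sum_inv_primes_le (l : ℕ) :
    ∑ p ∈ (Finset.range (2 ^ (l + 1))).filter Nat.Prime, (1 / p : ℝ) ≤ 4 * (harmonic l : ℝ) := by
  induction l with
  | zero =>
    have : (Finset.range (2 ^ (0 + 1))).filter Nat.Prime = ∅ := by decide
    rw [this]; simp
  | succ l ih =>
    have hsplit : (Finset.range (2 ^ (l + 1 + 1))).filter Nat.Prime =
        (Finset.range (2 ^ (l + 1))).filter Nat.Prime ∪
          (Finset.Ico (2 ^ (l + 1)) (2 ^ (l + 1 + 1))).filter Nat.Prime := by
      rw [← Finset.filter_union, Finset.range_eq_Ico, Finset.range_eq_Ico,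
        Finset.Ico_union_Ico_eq_Ico (Nat.zero_le _) (Nat.pow_le_pow_right (by norm_num) (by omega))]
    have hdisj : Disjoint ((Finset.range (2 ^ (l + 1))).filter Nat.Prime)
        ((Finset.Ico (2 ^ (l + 1)) (2 ^ (l + 1 + 1))).filter Nat.Prime) := by
      refine Finset.disjoint_filter_filter ?_
      rw [Finset.range_eq_Ico]
      exact Finset.Ico_disjoint_Ico_consecutive _ _ _
    set B := (Finset.Ico (2 ^ (l + 1)) (2 ^ (l + 1 + 1))).filter Nat.Prime with hB
    have hcard : (l + 1) * B.card ≤ 2 * 2 ^ (l + 1 + 1) := by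
      refine (Nat.pow_le_pow_iff_right (a := 2) (by norm_num)).1 ?_
      calc 2 ^ ((l + 1) * B.card) = ∏ _p ∈ B, 2 ^ (l + 1) := by rw [pow_mul, Finset.prod_const]
        _ ≤ ∏ p ∈ B, p := Finset.prod_le_prod' fun p hp => by
            exact (Finset.mem_Ico.1 (Finset.mem_filter.1 hp).1).1
        _ ≤ primorial (2 ^ (l + 1 + 1)) := by
            refine Finset.prod_le_prod_of_subset_of_one_le' (fun p hp => ?_) fun p hp _ => ?_
            · simp only [hB, Finset.mem_filter, Finset.mem_Ico] at hp
              simp only [Finset.mem_filter, Finset.mem_range]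
              exact ⟨by omega, hp.2⟩
            · exact (Finset.mem_filter.1 hp).2.one_le
        _ ≤ 4 ^ (2 ^ (l + 1 + 1)) := primorial_le_four_pow _
        _ = 2 ^ (2 * 2 ^ (l + 1 + 1)) := by rw [pow_mul]; norm_num
    have hblock : ∑ p ∈ B, (1 / p : ℝ) ≤ 4 * ((l + 1 : ℕ) : ℝ)⁻¹ := by
      calc ∑ p ∈ B, (1 / p : ℝ) ≤ ∑ _p ∈ B, (1 / 2 ^ (l + 1) : ℝ) := by
            refine Finset.sum_le_sum fun p hp => ?_
            have h1 := (Finset.mem_Ico.1 (Finset.mem_filter.1 hp).1).1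
            refine one_div_le_one_div_of_le (by positivity) (by exact_mod_cast h1)
        _ = B.card / 2 ^ (l + 1) := by rw [Finset.sum_const, nsmul_eq_mul]; ring
        _ ≤ 4 * ((l + 1 : ℕ) : ℝ)⁻¹ := by
            have h2 : ((l + 1 : ℕ) : ℝ) * B.card ≤ 2 * 2 ^ (l + 1 + 1) := by exact_mod_cast hcard
            rw [div_le_iff₀ (by positivity), ← div_eq_mul_inv, div_mul_eq_mul_div,
              le_div_iff₀ (by positivity)]
            rw [pow_succ] at h2
            linarith
    rw [hsplit, Finset.sum_union hdisj, harmonic_succ]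
    push_cast at *
    linarith

theorem sum_cardFactors_eq (x : ℕ) :
    ∑ n ∈ Finset.Ico 1 (x + 1), cardFactors n = cardFactors x.factorial := by
  induction x with
  | zero => simp
  | succ x ih =>
    rw [Finset.sum_Ico_succ_top (by omega), ih, Nat.factorial_succ,
      ArithmeticFunction.cardFactors_mul (by omega) (Nat.factorial_ne_zero x), add_comm]

/-- Legendre's formula gives `(p - 1) v_p(x!) ≤ x`, hence `v_p(x!) ≤ 2 x / p` because `p ≤ 2 (p -
1)`. -/
theorem cardFactors_factorial_le {x l : ℕ} (hl : x < 2 ^ (l + 1)) :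
    (cardFactors x.factorial : ℝ) ≤ 8 * x * (harmonic l : ℝ) := by
  rw [ArithmeticFunction.cardFactors_eq_sum_factorization, Finsupp.sum]
  push_cast
  have hsub : x.factorial.factorization.support ⊆ (Finset.range (2 ^ (l + 1))).filter Nat.Prime := by
    intro p hp
    rw [Nat.support_factorization, Nat.mem_primeFactors] at hp
    simp only [Finset.mem_filter, Finset.mem_range]
    exact ⟨lt_of_le_of_lt ((hp.1.dvd_factorial).1 hp.2.1) hl, hp.1⟩
  calc ∑ p ∈ x.factorial.factorization.support, (x.factorial.factorization p : ℝ)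
      ≤ ∑ p ∈ (Finset.range (2 ^ (l + 1))).filter Nat.Prime, (x.factorial.factorization p : ℝ) :=
        Finset.sum_le_sum_of_subset_of_nonneg hsub fun _ _ _ => by positivity
    _ ≤ ∑ p ∈ (Finset.range (2 ^ (l + 1))).filter Nat.Prime, 2 * x * (1 / p : ℝ) := by
        refine Finset.sum_le_sum fun p hp => ?_
        have hpp := (Finset.mem_filter.1 hp).2
        have := Fact.mk hpp
        have h1 := sub_one_mul_padicValNat_factorial (p := p) x
        rw [Nat.factorization_def _ hpp]
        have h2 : (p - 1) * padicValNat p x.factorial ≤ x := by rw [h1]; exact Nat.sub_le _ _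
        have hp2 := hpp.two_le
        have h3 : p * padicValNat p x.factorial ≤ 2 * x := by
          have : p ≤ 2 * (p - 1) := by omega
          calc p * padicValNat p x.factorial ≤ 2 * (p - 1) * padicValNat p x.factorial := by gcongr
            _ = 2 * ((p - 1) * padicValNat p x.factorial) := by ring
            _ ≤ 2 * x := by gcongr
        have hp0 : (0 : ℝ) < p := by exact_mod_cast hpp.pos
        rw [mul_one_div, le_div_iff₀ hp0, mul_comm]
        exact_mod_cast h3
    _ = 2 * x * ∑ p ∈ (Finset.range (2 ^ (l + 1))).filter Nat.Prime, (1 / p : ℝ) := by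
        rw [Finset.mul_sum]
    _ ≤ 2 * x * (4 * (harmonic l : ℝ)) := by gcongr; exact sum_inv_primes_le l
    _ = 8 * x * (harmonic l : ℝ) := by ring

variable {x : ℕ}

/-- The case `x = 3` is critical: `log 3` is barely above 1. A numerical margin keeps `log (log x)`
away from 0, so that additive constants can later be absorbed into multiples of it. -/
theorem one_lt_log (hx : 3 ≤ x) : 1.09 ≤ log x := by
  have h1 : (3 : ℝ) ≤ x := by exact_mod_cast hx
  have h2 : log 3 ≤ log x := log_le_log (by norm_num) h1
  have h3 := one_sub_inv_le_log_of_pos (show (0 : ℝ) < 3 / exp 1 by positivity)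
  rw [log_div (by norm_num) (exp_ne_zero 1), log_exp, inv_div] at h3
  have := exp_one_lt_d9
  norm_num at *
  linarith

theorem loglog_ge (hx : 3 ≤ x) : 1 / 20 ≤ log (log x) := by
  have h1 := one_lt_log hx
  have h2 := one_sub_inv_le_log_of_pos (show (0 : ℝ) < log x by linarith)
  have h3 : (log x)⁻¹ ≤ (1.09)⁻¹ := inv_anti₀ (by norm_num) h1
  norm_num at *
  linarith

theorem loglog_le_log (hx : 3 ≤ x) : log (log x) ≤ log x := by
  have h1 := one_lt_log hx
  have := log_le_sub_one_of_pos (show (0 : ℝ) < log x by linarith)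
  linarith

theorem loglog_sq_le (hx : 3 ≤ x) : log (log x) ^ 2 ≤ 4 * log x := by
  have h1 := one_lt_log hx
  have h2 := loglog_ge hx
  have h3 := log_le_sub_one_of_pos (show (0 : ℝ) < √(log x) by apply sqrt_pos.2; linarith)
  rw [log_sqrt (by linarith)] at h3
  have h4 := sq_sqrt (show 0 ≤ log x by linarith)
  have h5 : log (log x) ≤ 2 * √(log x) := by linarith
  calc log (log x) ^ 2 ≤ (2 * √(log x)) ^ 2 := by gcongr
    _ = 4 * log x := by rw [mul_pow, h4]; ring

theorem log_le_sqrt_sqrt (hx : 3 ≤ x) : log x ≤ 4 * √√(x : ℝ) := by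
  have h0 : (3 : ℝ) ≤ x := by exact_mod_cast hx
  have h3 := log_le_sub_one_of_pos (show (0 : ℝ) < √√(x : ℝ) by positivity)
  rw [log_sqrt (by positivity), log_sqrt (by positivity)] at h3
  linarith

theorem log_sq_le (hx : 3 ≤ x) : log x ^ 2 ≤ 16 * √(x : ℝ) := by
  have h1 := one_lt_log hx
  have h2 := log_le_sqrt_sqrt hx
  calc log x ^ 2 ≤ (4 * √√(x : ℝ)) ^ 2 := by gcongr
    _ = 16 * √(x : ℝ) := by rw [mul_pow, sq_sqrt (by positivity)]; ring

theorem log_le_size {n : ℕ} (hn : 1 ≤ n) : log n ≤ n.size := by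
  have h1 : (n : ℝ) ≤ 2 ^ n.size := by exact_mod_cast (Nat.lt_size_self n).le
  have h2 := log_le_log (by exact_mod_cast hn) h1
  rw [log_pow] at h2
  have := log_two_lt_d9
  have h3 : (0 : ℝ) ≤ n.size := by positivity
  nlinarith

theorem size_sub_one_le_log {n : ℕ} (hn : 1 ≤ n) : ((n.size : ℝ) - 1) * log 2 ≤ log n := by
  have h0 : 0 < n.size := Nat.size_pos.2 hn
  have h1 : 2 ^ (n.size - 1) ≤ n := Nat.lt_size.1 (by omega)
  have h2 : (2 : ℝ) ^ (n.size - 1) ≤ n := by exact_mod_cast h1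
  have h3 := log_le_log (by positivity) h2
  rw [log_pow, Nat.cast_sub (by omega)] at h3
  simpa using h3

theorem size_le_three_mul_log (hx : 3 ≤ x) : (x.size : ℝ) ≤ 3 * log x := by
  have h1 := size_sub_one_le_log (show 1 ≤ x by omega)
  have h2 := one_lt_log hx
  have := log_two_gt_d9
  nlinarith

theorem loglog_le_size_size (hx : 3 ≤ x) : log (log x) ≤ x.size.size := by
  have h1 := one_lt_log hx
  have h2 := log_le_size (show 1 ≤ x by omega)
  have h3 := log_le_log (by linarith) h2
  exact h3.trans (log_le_size (by have := two_le_size hx; omega))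

theorem log_size_le (hx : 3 ≤ x) : log x.size ≤ 2 + log (log x) := by
  have h1 := one_lt_log hx
  have h2 := size_le_three_mul_log hx
  have h0 : (0 : ℝ) < x.size := by exact_mod_cast (by have := two_le_size hx; omega : 0 < x.size)
  have h3 := log_le_log h0 h2
  rw [log_mul (by norm_num) (by linarith)] at h3
  have h4 := log_le_sub_one_of_pos (show (0 : ℝ) < 3 by norm_num)
  linarith

theorem size_size_le (hx : 3 ≤ x) : (x.size.size : ℝ) ≤ 100 * log (log x) := by
  have h1 := size_sub_one_le_log (show 1 ≤ x.size by have := two_le_size hx; omega)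
  have h2 := log_size_le hx
  have h3 := loglog_ge hx
  have := log_two_gt_d9
  have h4 : (0 : ℝ) ≤ x.size.size := by positivity
  nlinarith

theorem sum_cardFactors_le (hx : 3 ≤ x) :
    ((∑ n ∈ Finset.Ico 1 (x + 1), cardFactors n : ℕ) : ℝ) ≤ 500 * (x * log (log x)) := by
  rw [sum_cardFactors_eq]
  have h2 := two_le_size hx
  have h3 := loglog_ge hx
  obtain ⟨l, hl⟩ : ∃ l, x.size = l + 1 := ⟨x.size - 1, by omega⟩
  have h4 := cardFactors_factorial_le (x := x) (l := l) (hl ▸ Nat.lt_size_self x)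
  have h5 := harmonic_le_one_add_log l
  have h6 : log l ≤ log x.size :=
    log_le_log (by exact_mod_cast (by omega : 0 < l)) (by rw [hl]; push_cast; linarith)
  have h7 := log_size_le hx
  have h8 : (harmonic l : ℝ) ≤ 62 * log (log x) := by linarith
  have hx0 : (0 : ℝ) ≤ x := by positivity
  calc _ ≤ 8 * x * (harmonic l : ℝ) := h4
    _ ≤ 8 * x * (62 * log (log x)) := by gcongr
    _ ≤ 500 * (x * log (log x)) := by nlinarith [mul_nonneg hx0 (show 0 ≤ log (log x) by linarith)]

/-- Chebyshev's bound at `√x`. Its error term `√√x` is absorbed by `log x ≤ 4 √√x`. -/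
theorem primeCounting_sqrt_le (hx : 3 ≤ x) :
    (Nat.primeCounting x.sqrt : ℝ) * log x ≤ 12 * √(x : ℝ) := by
  have h0 : (3 : ℝ) ≤ x := by exact_mod_cast hx
  have h1 : 1 < √(x : ℝ) := by rw [lt_sqrt] <;> linarith
  have h2 := Chebyshev.pi_le_log4_mul_div h1
  rw [Real.nat_floor_real_sqrt_eq_nat_sqrt, log_sqrt (by positivity), log_sqrt (by positivity)] at h2
  have h3 := one_lt_log hx
  have h4 := log_le_sqrt_sqrt hx
  have h5 : log 4 ≤ 2 := by
    rw [show (4 : ℝ) = 2 ^ 2 by norm_num, log_pow]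
    have := log_two_lt_d9
    push_cast
    linarith
  have h6 : √√(x : ℝ) * √√(x : ℝ) = √(x : ℝ) := mul_self_sqrt (by positivity)
  have h7 : √√(x : ℝ) * log x ≤ 4 * √(x : ℝ) := by
    calc √√(x : ℝ) * log x ≤ √√(x : ℝ) * (4 * √√(x : ℝ)) := by gcongr
      _ = 4 * √(x : ℝ) := by rw [mul_left_comm, h6]
  calc (Nat.primeCounting x.sqrt : ℝ) * log x
      ≤ (log 4 * √(x : ℝ) / (log x / 2 / 2) + √√(x : ℝ)) * log x := by gcongr
    _ = 4 * log 4 * √(x : ℝ) + √√(x : ℝ) * log x := by field_simp; ring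
    _ ≤ 12 * √(x : ℝ) := by nlinarith [sqrt_nonneg (x : ℝ)]

theorem gapCount_le_primeCounting (x : ℕ) : gapCount x ≤ Nat.primeCounting x.sqrt := by
  unfold gapCount Nat.primeCounting Nat.primeCounting'
  exact Nat.sub_le _ _

/-- The large gaps before the odd prime number `j` are disjoint intervals below it, each longer than
`L ^ 3`. -/
theorem bigCount_mul_le_oddPrime (x j : ℕ) :
    bigCount x j * (x.size * x.size * x.size) ≤ oddPrime j := by
  induction j with
  | zero => simp [bigCount]
  | succ j ih =>
    have hlt := oddPrime_lt_succ j
    by_cases h : BigGap x j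
    · rw [bigCount_succ_of j h, Nat.succ_mul]
      unfold BigGap at h
      omega
    · rw [bigCount_succ_of_not j h]
      omega

theorem bigCount_mul_le_sqrt (x : ℕ) :
    bigCount x (gapCount x) * (x.size * x.size * x.size) ≤ x.sqrt := by
  rcases Nat.eq_zero_or_pos (gapCount x) with h | h
  · simp [h, bigCount]
  · obtain ⟨j, hj⟩ : ∃ j, gapCount x = j + 1 := ⟨gapCount x - 1, by omega⟩
    refine (bigCount_mul_le_oddPrime x _).trans ?_
    rw [hj]
    exact oddPrime_le_iff.2 (by omega)

end Analysis
-- Asymptotic bounds for segment length, space and time.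
section Bounds

open Real
open ArithmeticFunction (cardFactors)

variable {x : ℕ}

theorem one_le_real_sqrt (hx : 3 ≤ x) : 1 ≤ √(x : ℝ) :=
  Real.one_le_sqrt.2 (by exact_mod_cast (by omega : 1 ≤ x))

theorem sqrt_le_segLen_mul (hx : 3 ≤ x) :
    √(x : ℝ) ≤ segLen x * (x.size * x.size.size : ℕ) := by
  have h1 : x.sqrt < (x.size * x.size.size) * segLen x :=
    Nat.lt_mul_div_succ _ (Nat.mul_pos (by have := two_le_size hx; omega)
      (by have := two_le_size_size hx; omega))
  have h2 : √(x : ℝ) ≤ x.sqrt + 1 := Real.real_sqrt_le_nat_sqrt_succ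
  have h3 : ((x.sqrt + 1 : ℕ) : ℝ) ≤ ((x.size * x.size.size * segLen x : ℕ) : ℝ) := by
    exact_mod_cast h1
  push_cast at *
  linarith

theorem le_segLen (hx : 3 ≤ x) :
    √(x : ℝ) / (log x * log (log x)) ≤ 300 * segLen x := by
  have h1 := sqrt_le_segLen_mul hx
  have h2 := one_lt_log hx
  have h3 := loglog_ge hx
  have h4 := size_le_three_mul_log hx
  have h5 := size_size_le hx
  rw [div_le_iff₀ (by positivity)]
  push_cast at h1
  calc √(x : ℝ) ≤ segLen x * (x.size * x.size.size) := h1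
    _ ≤ segLen x * (3 * log x * (100 * log (log x))) := by gcongr
    _ = 300 * segLen x * (log x * log (log x)) := by ring

theorem log_mul_loglog_le (hx : 3 ≤ x) : log x * log (log x) ≤ 16 * √(x : ℝ) := by
  have h2 := one_lt_log hx
  have h3 := loglog_le_log hx
  have h4 := log_sq_le hx
  nlinarith

/-- The summand 1 in `segLen` is harmless because `log x * log (log x)` is at most `16 √x`; the
quotient itself only needs that `L` and `W` dominate the two logarithms. -/
theorem segLen_le_real (hx : 3 ≤ x) :
    (segLen x : ℝ) ≤ 17 * (√(x : ℝ) / (log x * log (log x))) := by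
  have h2 := one_lt_log hx
  have h3 := loglog_ge hx
  have h4 := log_mul_loglog_le hx
  have h5 := log_le_size (show 1 ≤ x by omega)
  have h6 := loglog_le_size_size hx
  have h7 : 1 ≤ 16 * (√(x : ℝ) / (log x * log (log x))) := by
    rw [mul_div_assoc', le_div_iff₀ (by positivity)]; linarith
  have h8 : ((x.sqrt / (x.size * x.size.size) : ℕ) : ℝ) ≤ √(x : ℝ) / (log x * log (log x)) := by
    refine Nat.cast_div_le.trans ?_
    push_cast
    have : (x.sqrt : ℝ) ≤ √(x : ℝ) := Real.nat_sqrt_le_real_sqrt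
    gcongr
  unfold segLen
  push_cast at *
  linarith

theorem log_le_div_loglog (hx : 3 ≤ x) : log x ≤ 16 * (√(x : ℝ) / log (log x)) := by
  have h3 := loglog_ge hx
  rw [mul_div_assoc', le_div_iff₀ (by linarith)]
  exact log_mul_loglog_le hx

theorem gap_bits_le (hx : 3 ≤ x) :
    ((gapCount x * (3 * x.size.size) + 2 * bigCount x (gapCount x) * x.size : ℕ) : ℝ) ≤
      4000 * (√(x : ℝ) * log (log x) / log x) := by
  have h2 := one_lt_log hx
  have h3 := loglog_ge hx
  have h4 := primeCounting_sqrt_le hx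
  have h5 := size_size_le hx
  have h6 : (gapCount x : ℝ) ≤ Nat.primeCounting x.sqrt := by
    exact_mod_cast gapCount_le_primeCounting x
  have h7 : ((bigCount x (gapCount x) * (x.size * x.size * x.size) : ℕ) : ℝ) ≤ √(x : ℝ) :=
    le_trans (by exact_mod_cast bigCount_mul_le_sqrt x) Real.nat_sqrt_le_real_sqrt
  have h8 := log_le_size (show 1 ≤ x by omega)
  push_cast at *
  rw [mul_div_assoc', le_div_iff₀ (by linarith), add_mul]
  have h9 : (gapCount x : ℝ) * (3 * x.size.size) * log x ≤ 3600 * (√(x : ℝ) * log (log x)) := by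
    calc (gapCount x : ℝ) * (3 * x.size.size) * log x
        ≤ Nat.primeCounting x.sqrt * (3 * (100 * log (log x))) * log x := by gcongr
      _ = (Nat.primeCounting x.sqrt * log x) * (300 * log (log x)) := by ring
      _ ≤ (12 * √(x : ℝ)) * (300 * log (log x)) := by gcongr
      _ = 3600 * (√(x : ℝ) * log (log x)) := by ring
  -- The exponent 3 in the gap threshold is used here: one factor `L` is the cell width, and `log x
  -- ≤ L ^ 2` accounts for the other two.
  have h10 : 2 * (bigCount x (gapCount x) : ℝ) * x.size * log x ≤ 2 * √(x : ℝ) := by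
    calc 2 * (bigCount x (gapCount x) : ℝ) * x.size * log x
        ≤ 2 * (bigCount x (gapCount x) : ℝ) * x.size * (x.size * x.size) := by
          gcongr
          nlinarith
      _ = 2 * (bigCount x (gapCount x) * (x.size * x.size * x.size)) := by ring
      _ ≤ 2 * √(x : ℝ) := by gcongr
  nlinarith [sqrt_nonneg (x : ℝ)]

/-- The compressed primes fit into the overall space budget because `(log log x) ^ 2` is at most `4
log x`. -/
theorem mul_loglog_div_log_le (hx : 3 ≤ x) :
    √(x : ℝ) * log (log x) / log x ≤ 4 * (√(x : ℝ) / log (log x)) := by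
  have h2 := one_lt_log hx
  have h3 := loglog_ge hx
  have h4 := loglog_sq_le hx
  rw [mul_div_assoc', div_le_div_iff₀ (by linarith) (by linarith)]
  nlinarith [mul_le_mul_of_nonneg_left h4 (sqrt_nonneg (x : ℝ))]

theorem ptrCount_mul_size_le (x : ℕ) : ptrCount x * x.size.size ≤ 9 * x.size := by
  have h1 : 8 * x.size / x.size.size * x.size.size ≤ 8 * x.size := Nat.div_mul_le_self _ _
  have h2 := size_le_self x.size
  unfold ptrCount
  rw [Nat.succ_mul]
  omega

theorem list_bits_le (hx : 3 ≤ x) :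
    ((segLen x * x.size + segLen x * x.size.size + segLen x * ptrCount x * x.size.size : ℕ) : ℝ) ≤
      600 * (√(x : ℝ) / log (log x)) := by
  have h2 := one_lt_log hx
  have h3 := loglog_ge hx
  have h1 : segLen x * x.size + segLen x * x.size.size + segLen x * ptrCount x * x.size.size ≤
      11 * (segLen x * x.size) := by
    have h1 := Nat.mul_le_mul_left (segLen x) (ptrCount_mul_size_le x)
    have h2 := Nat.mul_le_mul_left (segLen x) (size_le_self x.size)
    rw [← mul_assoc, mul_left_comm] at h1
    omega
  calc _ ≤ ((11 * (segLen x * x.size) : ℕ) : ℝ) := by exact_mod_cast h1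
    _ = 11 * (segLen x * x.size) := by push_cast; ring
    _ ≤ 11 * (17 * (√(x : ℝ) / (log x * log (log x))) * (3 * log x)) := by
        gcongr
        · exact segLen_le_real hx
        · exact size_le_three_mul_log hx
    _ = 561 * (√(x : ℝ) / log (log x)) := by
        have : log x ≠ 0 := by linarith
        field_simp
        ring
    _ ≤ 600 * (√(x : ℝ) / log (log x)) := by
        gcongr
        norm_num

theorem timeBound_le (hx : 3 ≤ x) : (timeBound x : ℝ) ≤ 10000000 * (x * log (log x)) := by
  have h2 := one_lt_log hx
  have h3 := loglog_ge hx
  have hs := sqrt_le_segLen_mul hx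
  have hL := size_le_three_mul_log hx
  have hW := size_size_le hx
  have hπ := primeCounting_sqrt_le hx
  have hΩ := sum_cardFactors_le hx
  have hl2 := log_sq_le hx
  have hR : √(x : ℝ) * √(x : ℝ) = x := mul_self_sqrt (by positivity)
  have hR1 := one_le_real_sqrt hx
  have hD0 : (0 : ℝ) < segLen x := by
    have : 0 < segLen x := Nat.succ_pos _
    exact_mod_cast this
  have hxl : (x : ℝ) ≤ 20 * (x * log (log x)) := by
    nlinarith [show (0 : ℝ) ≤ x by positivity]
  have hL1 : (1 : ℝ) ≤ x.size := by exact_mod_cast (by have := two_le_size hx; omega : 1 ≤ x.size)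
  have hLx : (x.size : ℝ) ≤ x := by exact_mod_cast size_le_self x
  have hDx : (segLen x : ℝ) ≤ x := by
    have h4 := segLen_le x
    have h5 : x.sqrt < x := Nat.sqrt_lt_self (by omega)
    exact_mod_cast (by omega : segLen x ≤ x)
  have hπx : (Nat.primeCounting x.sqrt : ℝ) ≤ x := by
    have h4 : Nat.primeCounting x.sqrt ≤ x.sqrt + 1 := by
      unfold Nat.primeCounting Nat.primeCounting'
      exact Nat.count_le _
    have h5 : x.sqrt < x := Nat.sqrt_lt_self (by omega)
    exact_mod_cast (by omega : Nat.primeCounting x.sqrt ≤ x)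
  have hq : ((x / segLen x : ℕ) : ℝ) ≤ x / segLen x := Nat.cast_div_le
  have hq1 : (x : ℝ) / segLen x * segLen x = x := div_mul_cancel₀ _ hD0.ne'
  -- The number of segments is `O(√x L W)`. Against `π(√x)` its factor `L` cancels the logarithm in
  -- Chebyshev's bound, leaving `W`, which is `O(log log x)`.
  have hq2 : (x : ℝ) / segLen x ≤ √(x : ℝ) * (x.size * x.size.size) := by
    rw [div_le_iff₀ hD0]
    push_cast at hs
    calc (x : ℝ) = √(x : ℝ) * √(x : ℝ) := hR.symm
      _ ≤ √(x : ℝ) * (segLen x * (x.size * x.size.size)) := by gcongr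
      _ = √(x : ℝ) * (x.size * x.size.size) * segLen x := by ring
  have hπ' : (x : ℝ) / segLen x * Nat.primeCounting x.sqrt ≤ 3600 * (x * log (log x)) := by
    calc (x : ℝ) / segLen x * Nat.primeCounting x.sqrt
        ≤ √(x : ℝ) * (3 * log x * (100 * log (log x))) * Nat.primeCounting x.sqrt := by
          gcongr
          exact hq2.trans (by gcongr)
      _ = 300 * √(x : ℝ) * log (log x) * (Nat.primeCounting x.sqrt * log x) := by ring
      _ ≤ 300 * √(x : ℝ) * log (log x) * (12 * √(x : ℝ)) := by gcongr
      _ = 3600 * ((√(x : ℝ) * √(x : ℝ)) * log (log x)) := by ring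
      _ = 3600 * (x * log (log x)) := by rw [hR]
  have hL' : (x : ℝ) / segLen x * x.size ≤ 14400 * (x * log (log x)) := by
    calc (x : ℝ) / segLen x * x.size
        ≤ √(x : ℝ) * (3 * log x * (100 * log (log x))) * (3 * log x) := by
          gcongr
          exact hq2.trans (by gcongr)
      _ = 900 * √(x : ℝ) * log (log x) * log x ^ 2 := by ring
      _ ≤ 900 * √(x : ℝ) * log (log x) * (16 * √(x : ℝ)) := by gcongr
      _ = 14400 * ((√(x : ℝ) * √(x : ℝ)) * log (log x)) := by ring
      _ = 14400 * (x * log (log x)) := by rw [hR]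
  have hseg : (segCost x : ℝ) ≤
      20 * segLen x + 200 * Nat.primeCounting x.sqrt + 220 * x.size := by
    unfold segCost
    push_cast
    linarith
  have hmain : ((x / segLen x : ℕ) + 1 : ℝ) * segCost x ≤ ((x : ℝ) / segLen x + 1) *
      (20 * segLen x + 200 * Nat.primeCounting x.sqrt + 220 * x.size) := by
    gcongr
  unfold timeBound
  push_cast at *
  nlinarith

theorem sum_size_le_log {n : ℕ} (hn : 1 ≤ n) :
    ((∑ p ∈ n.primeFactors.erase 2, Nat.size (p / 2) : ℕ) : ℝ) ≤ 2 * log n := by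
  have h1 := two_pow_sum_size_le (n := n) (by omega)
  set S := ∑ p ∈ n.primeFactors.erase 2, Nat.size (p / 2)
  have h2 : (2 : ℝ) ^ S ≤ n := by exact_mod_cast h1
  have h3 := log_le_log (by positivity) h2
  rw [log_pow] at h3
  have := log_two_gt_d9
  have h4 : (0 : ℝ) ≤ S := by positivity
  nlinarith

theorem card_mul_size_size_le_log {n : ℕ} (hn : 1 ≤ n) :
    (((n.primeFactors.erase 2).card * Nat.size (Nat.size n) : ℕ) : ℝ) ≤ 32 * log n := by
  rcases Nat.eq_or_lt_of_le hn with rfl | hn2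
  · simp
  · have h1 : (((n.primeFactors.erase 2).card * Nat.size (Nat.size n) : ℕ) : ℝ) ≤ 8 * n.size := by
      exact_mod_cast card_mul_size_le (n := n) (by omega) (Nat.lt_size_self n)
    have h2 := size_sub_one_le_log hn
    have h3 : log 2 ≤ log n := log_le_log (by norm_num) (by exact_mod_cast hn2)
    have := log_two_gt_d9
    have h4 : (n.size : ℝ) ≤ 4 * log n := by nlinarith
    linarith

/-- The factor 100 is covered by `2 ^ 10` and the cube by `2 ^ (3 L)`, so the multiple `4 L` is more
than enough. -/
theorem wordOk_of_size {x : ℕ} (hx : 3 ≤ x) : WordOk x (4 * x.size + 10) := by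
  refine ⟨hx, ?_, by omega⟩
  have h1 : x + 1 ≤ 2 ^ x.size := Nat.lt_size_self x
  have h2 : (1 : ℕ) ≤ 2 ^ x.size := Nat.one_le_two_pow
  unfold cap
  calc 100 * (x + 1) ^ 3 ≤ 1024 * (2 ^ x.size) ^ 3 := by gcongr; norm_num
    _ ≤ 1024 * (2 ^ x.size) ^ 4 := by gcongr; norm_num
    _ = 2 ^ (4 * x.size + 10) := by rw [pow_add, mul_comm 4, pow_mul]; ring

end Bounds
end FactorSieve

open FactorSieve in
theorem theorem1 :
    ∃ C : ℝ, 0 < C ∧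
      (∀ x : ℕ, 3 ≤ x → ∃ (w t : ℕ) (σ : State Var Arr),
        -- the sieve on input `x` halts on a machine with `w`-bit words, where `w = O(log x)`
        x < 2 ^ w ∧ (w : ℝ) ≤ C * Real.log x ∧
        Exec w factorSieve (input x) σ t ∧
        -- it has written the complete factorizations of all `1 ≤ n ≤ x`
        σ.out = factorizations x ∧
        -- time and space
        (t : ℝ) ≤ C * (x * Real.log (Real.log x)) ∧
        (σ.bits w : ℝ) ≤ C * (√(x : ℝ) / Real.log (Real.log x)) ∧
        -- segment size
        √(x : ℝ) / (Real.log x * Real.log (Real.log x)) ≤ C * σ.vars .Delta ∧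
        (σ.vars .Delta : ℝ) ≤ C * (√(x : ℝ) / (Real.log x * Real.log (Real.log x))) ∧
        -- each integer of the segment has `O(log x)` bits for primes and `O(log x)` for pointers
        (σ.arr .list).len = σ.vars .Delta ∧
        ((σ.arr .list).width : ℝ) ≤ C * Real.log x ∧
        (σ.arr .ptr).len = σ.vars .Delta * σ.vars .M ∧
        ((σ.vars .M * (σ.arr .ptr).width : ℕ) : ℝ) ≤ C * Real.log x ∧
        -- the compressed list of the primes up to `√x`
        (((σ.arr .gap).len * (σ.arr .gap).width + (σ.arr .big).len * (σ.arr .big).width : ℕ) : ℝ)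
          ≤ C * (√(x : ℝ) * Real.log (Real.log x) / Real.log x)) ∧
      -- the odd primes dividing `n`, without their trailing bits, take `O(log n)` bits, and so do
      -- the pointers to their ends
      ∀ n : ℕ, 1 ≤ n →
        ((∑ p ∈ n.primeFactors.erase 2, Nat.size (p / 2) : ℕ) : ℝ) ≤ C * Real.log n ∧
        (((n.primeFactors.erase 2).card * Nat.size (Nat.size n) : ℕ) : ℝ) ≤ C * Real.log n := by
  refine ⟨10000000, by norm_num, fun x hx => ?_, fun n hn => ⟨?_, ?_⟩⟩
  · have hw := wordOk_of_size hx
    obtain ⟨σ, t, hexec, hE, hG, hout, ht⟩ := runs_factorSieve hw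
    have h1 := one_lt_log hx
    have h2 := loglog_ge hx
    have hL := size_le_three_mul_log hx
    have hL2 : (2 : ℝ) ≤ x.size := by exact_mod_cast two_le_size hx
    have hlog := log_le_div_loglog hx
    have hgap := gap_bits_le hx
    have hR0 : 0 ≤ √(x : ℝ) / Real.log (Real.log x) := by positivity
    refine ⟨4 * x.size + 10, t, σ, ?_, ?_, hexec, hout, ?_, ?_, ?_, ?_, ?_, ?_, ?_, ?_, ?_⟩
    · exact lt_of_le_of_lt (by have := hw.pos; nlinarith [Nat.zero_le x])
        (hw.lt_cap (n := x) (by nlinarith))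
    · push_cast; linarith
    · refine le_trans ?_ (timeBound_le hx)
      exact_mod_cast ht
    -- Three contributions: the 24 scalar words, absorbed by `log_le_div_loglog`; the compressed
    -- primes; and the arrays of the segment, which dominate.
    · have hbits : σ.bits (4 * x.size + 10) = 24 * (4 * x.size + 10) +
          (gapCount x * (3 * x.size.size) + 2 * bigCount x (gapCount x) * x.size) +
          (segLen x * x.size + segLen x * x.size.size +
            segLen x * ptrCount x * x.size.size) := by
        have hcard : Fintype.card Var = 24 := rfl
        have hsum : ∀ f : Arr → ℕ, ∑ a, f a = f .gap + f .big + f .list + f .ptr + f .plen := by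
          intro f
          have : (Finset.univ : Finset Arr) = {.gap, .big, .list, .ptr, .plen} := rfl
          rw [this]
          simp [add_assoc]
        rw [State.bits, hcard, hsum, hG.gap_len, hG.gap_width, hG.big_len, hG.big_width,
          hE.list_len, hE.list_width, hE.ptr_len, hE.ptr_width, hE.plen_len, hE.plen_width]
        ring
      have hlist := list_bits_le hx
      have hgap' := mul_loglog_div_log_le hx
      rw [hbits, Nat.cast_add, Nat.cast_add]
      push_cast at *
      linarith
    · rw [hE.Delta_eq]
      refine (le_segLen hx).trans ?_
      gcongr
      norm_num
    · rw [hE.Delta_eq]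
      refine (segLen_le_real hx).trans ?_
      gcongr
      norm_num
    · rw [hE.list_len, hE.Delta_eq]
    · rw [hE.list_width]; linarith
    · rw [hE.ptr_len, hE.Delta_eq, hE.M_eq]
    · rw [hE.ptr_width, hE.M_eq]
      have : ((ptrCount x * x.size.size : ℕ) : ℝ) ≤ 9 * x.size := by
        exact_mod_cast ptrCount_mul_size_le x
      linarith
    · rw [hG.gap_len, hG.gap_width, hG.big_len, hG.big_width]
      refine hgap.trans ?_
      gcongr
      norm_num
  · have := sum_size_le_log hn
    have h0 : 0 ≤ Real.log n := Real.log_natCast_nonneg n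
    linarith
  · have := card_mul_size_size_le_log hn
    have h0 : 0 ≤ Real.log n := Real.log_natCast_nonneg n
    linarith
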